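/- **Setting.** Let $T>0$, and let $d,D,m$ be natural numbers. Let $y=(y_1,\dots,y_m)\in(\mathbb R^d)^m=\mathbb R^{dm}$ denote the leaders' configuration. Assume: - $K\in C^2(\mathbb R^d;\mathbb R^d)$ is odd and, for some $C_K>0$, $\|K(x)\|<C_K(1+\|x\|)$ for all $x$. - $\ell\in C^2(\mathbb R^{dm}\times\mathbb R^d\times\mathbb R^d;\mathbb R)$, $\omega\in C^2(\mathbb R^d;\mathbb R^d)$, and $L(y,\mu)=\int_{\mathbb R^d}\ell\big(y,x,\int\omega\,d\mu\big)\,d\mu(x)$. - $g(y):\mathbb R^d\to\mathbb R^d$ for each $y\in\mathbb R^{dm}$, the map $(y,x)\mapsto g(y)(x)$ is $C^2$, and there are constants $G_1,G_2,G_3$ with $g(y)(x)\cdot x\le G_1\|x\|^2+G_2\max_l\|y_l\|^2+G_3$ for all $x,y$. - $f_k\in C^2(\mathbb R^{dm};\mathbb R^d)$, $k=1,\dots,m$, and there are constants $F_1,F_2$ with $f_k(y)\cdot y_k\le F_1\max_l\|y_l\|^2+F_2$ for all $k,y$. - $B_k\in\mathbb R^{d\times D}$ for $k=1,\dots,m$.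 - $\mathcal U\subset\mathbb R^D$ is non-empty, compact and convex, and $\gamma:\mathcal U\to\mathbb R$ is strictly convex and lower semicontinuous. *Controls* are the $u\in L^1([0,T];\mathcal U)$. Write $(K\star\mu)(x)=\int K(x-x')\,d\mu(x')$. **Mean-field problem.** Given $y^0\in\mathbb R^{dm}$ and a compactly supported probability measure $\mu^0$ on $\mathbb R^d$, minimize $$F(u)=\int_0^T\big[L(y(t),\mu(t))+\gamma(u(t))\big]\,dt\in(-\infty,+\infty]$$ over controls $u$, where $(y,\mu)$ is the solution, with $(y(0),\mu(0))=(y^0,\mu^0)$, of $$\dot y_k=(K\star\mu)(y_k)+f_k(y)+B_ku,\quad k=1,\dots,m,\qquad \partial_t\mu=-\nabla_x\cdot\big[(K\star\mu+g(y))\mu\big].$$ Solution means: $y$ is continuous and solves the ODEs in the Carathéodory sense; $\mu$ is a curve of probability measures, continuous for the Wasserstein distance $\mathcal W_1$, with supports in a common ball; and $$\frac{d}{dt}\int\phi\,d\mu(t)=\int\nabla\phi\cdot(K\star\mu(t)+g(y(t)))\,d\mu(t)$$ on $[0,T]$ for every $\phi\in C_c^\infty(\mathbb R^d)$. **$N$-particle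 problem.** Given $y^0$ and $x^0\in(\mathbb R^d)^N$, minimize over controls $u$ $$F_N(u)=\int_0^T\big[L(y(t),\mu_N(t))+\gamma(u(t))\big]\,dt,\qquad \mu_N(t)=\frac1N\sum_{i=1}^N\delta_{x_i(t)},$$ where $(y,x)$ is the Carathéodory solution, with $(y(0),x(0))=(y^0,x^0)$, of $$\dot y_k=\frac1N\sum_{j=1}^NK(y_k-x_j)+f_k(y)+B_ku,\qquad \dot x_i=\frac1N\sum_{j=1}^NK(x_i-x_j)+g(y)(x_i).$$ **Definition.** A control $u^*$ is a *mean-field optimal control* for $(y^0,\mu^0)$ if it is a minimizer for the mean-field problem with initial datum $(y^0,\mu^0)$ and there are controls $(u_N)_{N\ge1}$ and points $x^0_{i,N}\in\operatorname{supp}\mu^0+\overline{B(0,1)}$, $1\le i\le N$, such that 1. $\frac1N\sum_{i=1}^N\delta_{x^0_{i,N}}\rightharpoonup\mu^0$ weakly as measures; 2. for every $N\ge1$, $u_N$ is a minimizer for the $N$-particle problem with initial datum $(y^0,(x^0_{i,N})_i)$; 3. a subsequence of $(u_N)$ converges to $u^*$ weakly in $L^1([0,T];\mathbb R^D)$. **Corollary.**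 Under the above hypotheses, for every $y^0\in\mathbb R^{dm}$ and every compactly supported probability measure $\mu^0$ on $\mathbb R^d$ there exists a mean-field optimal control $u^*$ for $(y^0,\mu^0)$. -/

import Mathlib

open MeasureTheory Set Filter
open scoped Topology ENNReal Pointwise

namespace MeanFieldControl

/-- `ℝⁿ` with its Euclidean norm. -/
abbrev Euc (n : ℕ) : Type := EuclideanSpace ℝ (Fin n)

/-- The empirical measure `(1/N) ∑ᵢ δ_{xᵢ}` of `N` points of `ℝᵈ`. -/
noncomputable def empiricalMeasure {d N : ℕ} (x : Fin N → Euc d) : Measure (Euc d) :=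
  (N : ℝ≥0∞)⁻¹ • ∑ i, Measure.dirac (x i)

instance {d N : ℕ} [NeZero N] (x : Fin N → Euc d) :
    IsProbabilityMeasure (empiricalMeasure x) := by
  constructor
  have h0 : (N : ℝ≥0∞) ≠ 0 := by exact_mod_cast NeZero.ne N
  simp [empiricalMeasure, ENNReal.inv_mul_cancel h0 (ENNReal.natCast_ne_top N)]

/-- The empirical measure as a point of the space of probability measures. -/
noncomputable def empirical {d N : ℕ} [NeZero N] (x : Fin N → Euc d) :
    ProbabilityMeasure (Euc d) :=
  ⟨empiricalMeasure x, inferInstance⟩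

/-- The Wasserstein distance `W₁`: the infimum of the transport cost `∫ ‖x - y‖ dρ(x, y)` over
all measures `ρ` with marginals `μ` and `ν`. -/
noncomputable def W1 {d : ℕ} (μ ν : ProbabilityMeasure (Euc d)) : ℝ≥0∞ :=
  ⨅ (ρ : Measure (Euc d × Euc d)) (_ : ρ.map Prod.fst = (μ : Measure (Euc d)))
    (_ : ρ.map Prod.snd = (ν : Measure (Euc d))), ∫⁻ p, edist p.1 p.2 ∂ρ

/-- The convolution `(K ⋆ μ)(x) = ∫ K(x - x') dμ(x')`. -/
noncomputable def conv {d : ℕ} (K : Euc d → Euc d) (μ : ProbabilityMeasure (Euc d))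
    (x : Euc d) : Euc d :=
  ∫ x', K (x - x') ∂(μ : Measure (Euc d))

/-- The data of the control problem: the `m` leaders and the followers move in `ℝᵈ`, the controls
take values in `ℝᴰ`. A configuration `y` of the leaders is a point of `(ℝᵈ)ᵐ`. -/
structure ControlProblem (d D m : ℕ) where
  /-- the time horizon -/
  T : ℝ
  /-- the set of control values -/
  U : Set (Euc D)
  /-- the control cost (only its values on `U` matter) -/
  γ : Euc D → ℝ
  /-- the interaction kernel -/
  K : Euc d → Euc d
  /-- the drift of the leaders -/
  f : Fin m → (Fin m → Euc d) → Euc d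
  /-- the drift of the followers -/
  g : (Fin m → Euc d) → Euc d → Euc d
  /-- the control matrices -/
  B : Fin m → Matrix (Fin d) (Fin D) ℝ
  /-- the integrand of the state cost -/
  ℓ : (Fin m → Euc d) × Euc d × Euc d → ℝ
  /-- the observable entering the state cost -/
  ω : Euc d → Euc d

namespace ControlProblem

variable {d D m : ℕ} (P : ControlProblem d D m)

/-- The standing hypotheses on the data. In `g_growth` and `f_growth`, `‖y‖` is the norm of
`Fin m → Euc d`, which is the maximum norm, so that `‖y‖ ^ 2 = max_l ‖y_l‖ ^ 2`. -/
structure Hypotheses : Prop where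
  T_pos : 0 < P.T
  K_smooth : ContDiff ℝ 2 P.K
  K_odd : ∀ x, P.K (-x) = -P.K x
  K_sublinear : ∃ C > 0, ∀ x, ‖P.K x‖ < C * (1 + ‖x‖)
  ℓ_smooth : ContDiff ℝ 2 P.ℓ
  ω_smooth : ContDiff ℝ 2 P.ω
  g_smooth : ContDiff ℝ 2 (fun p : (Fin m → Euc d) × Euc d => P.g p.1 p.2)
  g_growth : ∃ G₁ G₂ G₃ : ℝ, ∀ y x,
    inner ℝ (P.g y x) x ≤ G₁ * ‖x‖ ^ 2 + G₂ * ‖y‖ ^ 2 + G₃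
  f_smooth : ∀ k, ContDiff ℝ 2 (P.f k)
  f_growth : ∃ F₁ F₂ : ℝ, ∀ k y, inner ℝ (P.f k y) (y k) ≤ F₁ * ‖y‖ ^ 2 + F₂
  U_compact : IsCompact P.U
  U_convex : Convex ℝ P.U
  U_nonempty : P.U.Nonempty
  γ_strictConvex : StrictConvexOn ℝ P.U P.γ
  γ_lsc : LowerSemicontinuousOn P.γ P.U

/-- Lebesgue measure on `[0, T]`. -/
noncomputable def timeMeasure : Measure ℝ := volume.restrict (Icc 0 P.T)

/-- `u ∈ L¹([0,T]; U)`, for a representative `u` of its class. -/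
def IsControl (u : ℝ → Euc D) : Prop :=
  MemLp u 1 P.timeMeasure ∧ ∀ᵐ t ∂P.timeMeasure, u t ∈ P.U

/-- Weak convergence in `L¹([0,T]; ℝᴰ)`, tested against `L^∞([0,T]; ℝᴰ)`. -/
def WeakL1Tendsto (u : ℕ → ℝ → Euc D) (u' : ℝ → Euc D) : Prop :=
  ∀ ψ : ℝ → Euc D, MemLp ψ ∞ P.timeMeasure →
    Tendsto (fun n => ∫ t, inner ℝ (ψ t) (u n t) ∂P.timeMeasure) atTop
      (𝓝 (∫ t, inner ℝ (ψ t) (u' t) ∂P.timeMeasure))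

/-- The velocity `(K ⋆ μ)(y_k) + f_k(y) + B_k u` of the `k`-th leader. -/
noncomputable def leaderVelocity (k : Fin m) (y : Fin m → Euc d)
    (μ : ProbabilityMeasure (Euc d)) (u : Euc D) : Euc d :=
  conv P.K μ (y k) + P.f k y + Matrix.toEuclideanLin (P.B k) u

/-- The velocity field `K ⋆ μ + g(y)` of the followers. -/
noncomputable def followerVelocity (y : Fin m → Euc d) (μ : ProbabilityMeasure (Euc d))
    (x : Euc d) : Euc d :=
  conv P.K μ x + P.g y x

/-- `y` is, on `[0,T]`, a Carathéodory solution (in integrated form) of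
`y_k' = (K ⋆ μ(t))(y_k) + f_k(y) + B_k u(t)` with `y(0) = y₀`. -/
def SolvesLeaderODE (u : ℝ → Euc D) (y₀ : Fin m → Euc d) (y : ℝ → Fin m → Euc d)
    (μ : ℝ → ProbabilityMeasure (Euc d)) : Prop :=
  ContinuousOn y (Icc 0 P.T) ∧
  ∀ t ∈ Icc 0 P.T, ∀ k,
    y t k = y₀ k + ∫ s in (0 : ℝ)..t, P.leaderVelocity k (y s) (μ s) (u s)

/-- `(y, μ)` solves, on `[0,T]`, the coupled ODE-PDE system with control `u` and initial datum
`(y₀, μ₀)`; the continuity equation `∂ₜμ = -∇ₓ·[(K ⋆ μ + g(y)) μ]` is understood in the weak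
sense, for curves that are `W₁`-continuous and have uniformly bounded supports. -/
structure IsMeanFieldSolution (u : ℝ → Euc D) (y₀ : Fin m → Euc d)
    (μ₀ : ProbabilityMeasure (Euc d)) (y : ℝ → Fin m → Euc d)
    (μ : ℝ → ProbabilityMeasure (Euc d)) : Prop where
  leaders : P.SolvesLeaderODE u y₀ y μ
  initial : μ 0 = μ₀
  support_bounded : ∃ R > 0, ∀ t ∈ Icc 0 P.T,
    (μ t : Measure (Euc d)).support ⊆ Metric.ball 0 R
  continuous_W1 : ∀ t ∈ Icc 0 P.T,
    Tendsto (fun s => W1 (μ s) (μ t)) (𝓝[Icc 0 P.T] t) (𝓝 0)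
  continuity_equation : ∀ φ : Euc d → ℝ, ContDiff ℝ (⊤ : ℕ∞) φ → HasCompactSupport φ →
    ∀ t ∈ Icc 0 P.T,
      HasDerivWithinAt (fun s => ∫ x, φ x ∂(μ s : Measure (Euc d)))
        (∫ x, inner ℝ (gradient φ x) (P.followerVelocity (y t) (μ t) x)
          ∂(μ t : Measure (Euc d)))
        (Icc 0 P.T) t

/-- `(y, x)` solves, on `[0,T]`, the system of ODEs for `m` leaders and `N` followers with control
`u` and initial datum `(y₀, x₀)`. Here `K ⋆ μ_N` is `(1/N) ∑ⱼ K(· - x_j)` for the empirical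
measure `μ_N` of `x`. -/
structure IsParticleSolution {N : ℕ} [NeZero N] (u : ℝ → Euc D) (y₀ : Fin m → Euc d)
    (x₀ : Fin N → Euc d) (y : ℝ → Fin m → Euc d) (x : ℝ → Fin N → Euc d) : Prop where
  leaders : P.SolvesLeaderODE u y₀ y (fun t => empirical (x t))
  continuousOn : ContinuousOn x (Icc 0 P.T)
  followers : ∀ t ∈ Icc 0 P.T, ∀ i,
    x t i = x₀ i + ∫ s in (0 : ℝ)..t, P.followerVelocity (y s) (empirical (x s)) (x s i)

/-- `L(y, μ) = ∫ ℓ(y, x, ∫ ω dμ) dμ(x)`. -/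
noncomputable def stateCost (y : Fin m → Euc d) (μ : ProbabilityMeasure (Euc d)) : ℝ :=
  ∫ x, P.ℓ (y, x, ∫ z, P.ω z ∂(μ : Measure (Euc d))) ∂(μ : Measure (Euc d))

open Classical in
/-- The cost `∫₀ᵀ [L(y(t), μ(t)) + γ(u(t))] dt` of a control and its trajectory, with values in
`(-∞, +∞]`: along trajectories the integrand is measurable and bounded below, so that its integral
is `+∞` when it is not integrable. -/
noncomputable def cost (u : ℝ → Euc D) (y : ℝ → Fin m → Euc d)
    (μ : ℝ → ProbabilityMeasure (Euc d)) : EReal :=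
  if Integrable (fun t => P.stateCost (y t) (μ t) + P.γ (u t)) P.timeMeasure then
    ((∫ t, (P.stateCost (y t) (μ t) + P.γ (u t)) ∂P.timeMeasure : ℝ) : EReal)
  else ⊤

/-- `u` is an optimal control of the mean-field problem with initial datum `(y₀, μ₀)`. -/
def IsMeanFieldOptimal (y₀ : Fin m → Euc d) (μ₀ : ProbabilityMeasure (Euc d))
    (u : ℝ → Euc D) : Prop :=
  P.IsControl u ∧ (∃ y μ, P.IsMeanFieldSolution u y₀ μ₀ y μ) ∧
  ∀ y μ, P.IsMeanFieldSolution u y₀ μ₀ y μ →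
    ∀ v, P.IsControl v → ∀ z ν, P.IsMeanFieldSolution v y₀ μ₀ z ν →
      P.cost u y μ ≤ P.cost v z ν

/-- `u` is an optimal control of the problem with `N` followers and initial datum `(y₀, x₀)`. -/
def IsParticleOptimal {N : ℕ} [NeZero N] (y₀ : Fin m → Euc d) (x₀ : Fin N → Euc d)
    (u : ℝ → Euc D) : Prop :=
  P.IsControl u ∧ (∃ y x, P.IsParticleSolution u y₀ x₀ y x) ∧
  ∀ y x, P.IsParticleSolution u y₀ x₀ y x →
    ∀ v, P.IsControl v → ∀ z w, P.IsParticleSolution v y₀ x₀ z w →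
      P.cost u y (fun t => empirical (x t)) ≤ P.cost v z (fun t => empirical (w t))

/-- `u` is a mean-field optimal control for the initial datum `(y₀, μ₀)`: it is optimal for the
mean-field problem, and it is the weak `L¹` limit of a subsequence of a sequence of optimal
controls of the problems with `N = n + 1` followers, whose initial positions lie in
`supp μ₀ + B̄(0,1)` and have empirical measures converging weakly to `μ₀`. -/
def IsMeanFieldOptimalControl (y₀ : Fin m → Euc d) (μ₀ : ProbabilityMeasure (Euc d))
    (u : ℝ → Euc D) : Prop :=
  P.IsMeanFieldOptimal y₀ μ₀ u ∧
  ∃ (uN : ℕ → ℝ → Euc D) (x₀ : (n : ℕ) → Fin (n + 1) → Euc d),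
    (∀ n i, x₀ n i ∈ (μ₀ : Measure (Euc d)).support + Metric.closedBall (0 : Euc d) 1) ∧
    Tendsto (fun n => empirical (x₀ n)) atTop (𝓝 μ₀) ∧
    (∀ n, P.IsParticleOptimal y₀ (x₀ n) (uN n)) ∧
    ∃ j : ℕ → ℕ, StrictMono j ∧ P.WeakL1Tendsto (fun n => uN (j n)) u

end ControlProblem

end MeanFieldControl

/-!
The proof is the direct method, combined with a stability estimate for the coupled system that
covers at once the mean-field limit and the dependence on the control.

*Stability.* On bounded sets all data are Lipschitz. For two weak solutions `(y, μ)` and `(z, ν)`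
with bounded supports, Dobrushin's estimate bounds `‖y t - z t‖` and the Kantorovich–Rubinstein
distance of `μ t` and `ν t` by the distance of `μ 0` and `ν 0` and by the *primitives* of
`B_k (u - v)` (`IsMeanFieldSolution.stability`). It is proved for arbitrary weak solutions, without
a representation by characteristics: the continuity equation is tested with mollifications of all
`1`-Lipschitz functions at once, a test function at time `τ > s` being compared with its composition
with `id + (τ - s) V` at time `s`, where `V` is the velocity field; Gronwall's inequality applies to
the lower right Dini derivative of the supremum. In particular solutions are unique.

*Existence and bounds.* Labelling the followers by the points of a compact probability space turns
the system into an ODE in the Banach space `(ℝᵈ)ᵐ × C(S, ℝᵈ)`, solved by the Picard–Lindelöf theorem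
for truncated data (`exists_isLagrangianSolution`); finite label spaces give the particle system,
whose empirical measures therefore are mean-field solutions. The one-sided growth conditions bound
the solutions independently of the truncation (`IsLagrangianSolution.norm_sq_le`), so that the
truncation is not seen, and by uniqueness every solution obeys the bound
(`exists_isMeanFieldSolution`).

*Optimization.* Controls take values in a compact convex set, so they are weakly sequentially compact
in `L²` (`exists_subseq_weakL2Tendsto`). The controls enter affinely: weak convergence implies uniform
convergence of their primitives, hence convergence of the trajectories and of the state cost
(`tendsto_integral_stateCost`), while `u ↦ ∫ γ(u)` has convex and strongly closed sublevel sets and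
is thus weakly lower semicontinuous (`WeakL2Tendsto.integral_γ_le`). This gives minimizers for every
initial distribution, including empirical ones, and shows that weak limits of minimizers are
minimizers when the initial distributions converge (`isMeanFieldOptimal_of_tendsto`). Suitable
empirical distributions are obtained by sampling `μ₀` (`exists_seq_krBound_empirical`).
-/

open scoped NNReal Convolution

namespace MeanFieldControl

variable {d D m : ℕ}

/-! ### Measures with bounded support and transport distances -/

lemma ae_norm_le_of_support_subset {μ : Measure (Euc d)} {R : ℝ}
    (h : μ.support ⊆ Metric.closedBall 0 R) : ∀ᵐ x ∂μ, ‖x‖ ≤ R := by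
  filter_upwards [Measure.support_mem_ae (μ := μ)] with x hx
  simpa using h hx

lemma integrable_of_ae_norm_le {F : Type*} [NormedAddCommGroup F] {μ : Measure (Euc d)}
    [IsFiniteMeasure μ] {R : ℝ} (h : ∀ᵐ x ∂μ, ‖x‖ ≤ R) {f : Euc d → F} (hf : Continuous f) :
    Integrable f μ := by
  obtain ⟨C, hC⟩ := (isCompact_closedBall (0 : Euc d) R).exists_bound_of_continuousOn
    hf.continuousOn
  refine Integrable.of_bound hf.aestronglyMeasurable C ?_
  filter_upwards [h] with x hx
  exact hC x (by simpa using hx)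

lemma integrable_of_norm_le {F : Type*} [NormedAddCommGroup F] {μ : Measure (Euc d)}
    [IsFiniteMeasure μ] {C : ℝ} {f : Euc d → F} (hf : Continuous f) (h : ∀ x, ‖f x‖ ≤ C) :
    Integrable f μ :=
  Integrable.of_bound hf.aestronglyMeasurable C (Eventually.of_forall h)

/-- The easy half of Kantorovich duality. -/
lemma norm_integral_sub_le_of_W1_lt {F : Type*} [NormedAddCommGroup F] [NormedSpace ℝ F]
    {μ ν : ProbabilityMeasure (Euc d)} {κ : ℝ} (hκ : W1 μ ν < ENNReal.ofReal κ)
    {C : ℝ≥0} {h : Euc d → F} (hh : LipschitzWith C h)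
    (hμ : Integrable h (μ : Measure (Euc d))) (hν : Integrable h (ν : Measure (Euc d))) :
    ‖∫ x, h x ∂(μ : Measure (Euc d)) - ∫ x, h x ∂(ν : Measure (Euc d))‖ ≤ C * κ := by
  have hκ0 : 0 < κ := by
    by_contra hcon
    rw [ENNReal.ofReal_of_nonpos (not_lt.1 hcon)] at hκ
    exact not_lt_zero hκ
  simp only [W1, iInf_lt_iff] at hκ
  obtain ⟨ρ, h1, h2, hρ⟩ := hκ
  have e1 : ∫ x, h x ∂(μ : Measure (Euc d)) = ∫ p, h p.1 ∂ρ := by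
    rw [← h1, integral_map measurable_fst.aemeasurable]
    rw [h1]; exact hμ.1
  have e2 : ∫ x, h x ∂(ν : Measure (Euc d)) = ∫ p, h p.2 ∂ρ := by
    rw [← h2, integral_map measurable_snd.aemeasurable]
    rw [h2]; exact hν.1
  have i1 : Integrable (fun p : Euc d × Euc d => h p.1) ρ := by
    rw [← h1] at hμ
    exact hμ.comp_measurable measurable_fst
  have i2 : Integrable (fun p : Euc d × Euc d => h p.2) ρ := by
    rw [← h2] at hν
    exact hν.comp_measurable measurable_snd
  rw [e1, e2, ← integral_sub i1 i2]
  have hi : ∫⁻ p : Euc d × Euc d, ‖h p.1 - h p.2‖ₑ ∂ρ ≤ ENNReal.ofReal (C * κ) := by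
    calc ∫⁻ p : Euc d × Euc d, ‖h p.1 - h p.2‖ₑ ∂ρ
        ≤ ∫⁻ p : Euc d × Euc d, (C : ℝ≥0∞) * edist p.1 p.2 ∂ρ := by
          refine lintegral_mono fun p => ?_
          rw [← edist_eq_enorm_sub]
          exact hh _ _
      _ = C * ∫⁻ p : Euc d × Euc d, edist p.1 p.2 ∂ρ := by
          rw [lintegral_const_mul' _ _ (by simp)]
      _ ≤ C * ENNReal.ofReal κ := by gcongr
      _ = ENNReal.ofReal (C * κ) := by
          rw [ENNReal.ofReal_mul (by positivity)]; simp
  have := (enorm_integral_le_lintegral_enorm (fun p : Euc d × Euc d => h p.1 - h p.2)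
    (μ := ρ)).trans hi
  rw [← ofReal_norm] at this
  exact (ENNReal.ofReal_le_ofReal_iff (by positivity)).1 this

/-- The Kantorovich–Rubinstein distance of `μ` and `ν` is at most `D`: the integrals of every
`1`-Lipschitz function differ by at most `D`. -/
def KRBound (D : ℝ) (μ ν : ProbabilityMeasure (Euc d)) : Prop :=
  ∀ φ : Euc d → ℝ, LipschitzWith 1 φ →
    ∫ x, φ x ∂(μ : Measure (Euc d)) - ∫ x, φ x ∂(ν : Measure (Euc d)) ≤ D

namespace KRBound

variable {D : ℝ} {μ ν : ProbabilityMeasure (Euc d)}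

lemma nonneg (h : KRBound D μ ν) : 0 ≤ D := by
  simpa using h (fun _ => 0) (LipschitzWith.const' 0)

lemma refl (μ : ProbabilityMeasure (Euc d)) : KRBound 0 μ μ := fun φ _ => by simp

lemma mono {D' : ℝ} (h : KRBound D μ ν) (hD : D ≤ D') : KRBound D' μ ν :=
  fun φ hφ => (h φ hφ).trans hD

lemma symm (h : KRBound D μ ν) : KRBound D ν μ := fun φ hφ => by
  have := h (fun x => -φ x) hφ.neg
  simp only [integral_neg] at this
  linarith

lemma sub_le (h : KRBound D μ ν) {C : ℝ≥0} {φ : Euc d → ℝ} (hφ : LipschitzWith C φ) :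
    ∫ x, φ x ∂(μ : Measure (Euc d)) - ∫ x, φ x ∂(ν : Measure (Euc d)) ≤ C * D := by
  rcases eq_or_ne C 0 with rfl | hC
  · have hc : φ = fun _ => φ 0 := by
      funext x
      have := hφ.dist_le_mul x 0
      simpa [dist_eq_zero] using this
    rw [hc]
    simp
  · have hC' : (0 : ℝ) < C := by positivity
    have := h (fun x => (C : ℝ)⁻¹ * φ x) (by
      refine LipschitzWith.of_dist_le_mul fun x y => ?_
      have := hφ.dist_le_mul x y
      rw [Real.dist_eq] at *
      rw [← mul_sub, abs_mul, abs_of_pos (inv_pos.2 hC')]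
      rw [inv_mul_le_iff₀ hC']
      simpa using this)
    simp only [integral_const_mul] at this
    rw [← mul_sub, inv_mul_le_iff₀ hC'] at this
    exact this

/-- Vector-valued functions are tested in the direction of the difference of their integrals, so
that the constant does not depend on the dimension. -/
lemma norm_sub_le (h : KRBound D μ ν) {F : Type*} [NormedAddCommGroup F] [InnerProductSpace ℝ F]
    [CompleteSpace F] {C : ℝ≥0} {f : Euc d → F} (hf : LipschitzWith C f)
    (hμ : Integrable f (μ : Measure (Euc d))) (hν : Integrable f (ν : Measure (Euc d))) :
    ‖∫ x, f x ∂(μ : Measure (Euc d)) - ∫ x, f x ∂(ν : Measure (Euc d))‖ ≤ C * D := by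
  set a := ∫ x, f x ∂(μ : Measure (Euc d)) - ∫ x, f x ∂(ν : Measure (Euc d)) with ha
  have h1 := h.sub_le (φ := fun x => inner ℝ a (f x)) (C := ‖a‖₊ * C) (by
    refine LipschitzWith.of_dist_le_mul fun x y => ?_
    rw [Real.dist_eq, ← inner_sub_right]
    refine (abs_real_inner_le_norm _ _).trans ?_
    rw [NNReal.coe_mul, coe_nnnorm, mul_assoc]
    gcongr
    rw [← dist_eq_norm]
    exact hf.dist_le_mul x y)
  rw [integral_inner hμ, integral_inner hν, ← inner_sub_right, ← ha,
    real_inner_self_eq_norm_sq] at h1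
  rcases (norm_nonneg a).eq_or_lt with h0 | h0
  · rw [← h0]
    have := h.nonneg
    positivity
  · have : ‖a‖ * ‖a‖ ≤ ‖a‖ * (C * D) := by
      rw [NNReal.coe_mul, coe_nnnorm] at h1
      nlinarith
    exact le_of_mul_le_mul_left this h0

end KRBound

/-! ### Mollification -/

section mollifier

/-- A smooth bump function supported in the ball of radius `ε`. -/
noncomputable def mollifier (d : ℕ) {ε : ℝ} (hε : 0 < ε) : ContDiffBump (0 : Euc d) :=
  ⟨ε / 2, ε, by positivity, by linarith⟩

/-- The mollification of `φ` at scale `ε`. -/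
noncomputable def mollify {ε : ℝ} (hε : 0 < ε) (φ : Euc d → ℝ) : Euc d → ℝ :=
  (mollifier d hε).normed volume ⋆[ContinuousLinearMap.lsmul ℝ ℝ, volume] φ

variable {ε : ℝ} (hε : 0 < ε)

lemma mollify_apply (φ : Euc d → ℝ) (x : Euc d) :
    mollify hε φ x = ∫ z, (mollifier d hε).normed volume z * φ (x - z) := rfl

lemma mollify_const_mul (a : ℝ) (φ : Euc d → ℝ) (x : Euc d) :
    mollify hε (fun x => a * φ x) x = a * mollify hε φ x := by
  rw [mollify_apply, mollify_apply, ← integral_const_mul]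
  congr 1 with z
  ring

lemma integrable_normed_mul {φ : Euc d → ℝ} (hφ : Continuous φ) (x : Euc d) :
    Integrable (fun z => (mollifier d hε).normed volume z * φ (x - z)) :=
  (((mollifier d hε).continuous_normed).mul (hφ.comp (continuous_const.sub continuous_id)))
    |>.integrable_of_hasCompactSupport ((mollifier d hε).hasCompactSupport_normed.mul_right)

/-- Mollification is monotone, and it commutes with adding constants. -/
lemma mollify_le_of_le {φ₁ φ₂ : Euc d → ℝ} (h₁ : Continuous φ₁) (h₂ : Continuous φ₂)
    {x₁ x₂ : Euc d} {c : ℝ} (h : ∀ z, ‖z‖ ≤ ε → φ₁ (x₁ - z) ≤ φ₂ (x₂ - z) + c) :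
    mollify hε φ₁ x₁ ≤ mollify hε φ₂ x₂ + c := by
  set η := (mollifier d hε).normed volume
  have hc : c = ∫ z, η z * c := by
    rw [integral_mul_const, (mollifier d hε).integral_normed, one_mul]
  rw [mollify_apply, mollify_apply, hc, ← integral_add (integrable_normed_mul hε h₂ x₂)
    ((mollifier d hε).integrable_normed.mul_const c)]
  refine integral_mono (integrable_normed_mul hε h₁ x₁) ((integrable_normed_mul hε h₂ x₂).add
    ((mollifier d hε).integrable_normed.mul_const c)) fun z => ?_
  change η z * φ₁ (x₁ - z) ≤ η z * φ₂ (x₂ - z) + η z * c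
  by_cases hz : ‖z‖ ≤ ε
  · rw [← mul_add]
    exact mul_le_mul_of_nonneg_left (h z hz) ((mollifier d hε).nonneg_normed z)
  · have : η z = 0 := by
      have : z ∉ Function.support η := by
        rw [(mollifier d hε).support_normed_eq]
        simp only [mollifier, Metric.mem_ball, dist_zero_right, not_lt]
        exact (not_le.1 hz).le
      simpa using this
    simp [this]

lemma lipschitzWith_mollify {φ : Euc d → ℝ} {C : ℝ≥0} (hφ : LipschitzWith C φ) :
    LipschitzWith C (mollify hε φ) := by
  refine LipschitzWith.of_le_add_mul _ fun x y => ?_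
  refine mollify_le_of_le hε hφ.continuous hφ.continuous fun z _ => ?_
  have := hφ.le_add_mul (x - z) (y - z)
  rwa [dist_sub_right] at this

lemma mollify_le {φ : Euc d → ℝ} (hφ : LipschitzWith 1 φ) (x : Euc d) :
    mollify hε φ x ≤ φ x + ε := by
  have h := mollify_le_of_le hε (φ₂ := fun _ => φ x) (x₁ := x) (x₂ := x) (c := ε)
    hφ.continuous continuous_const (fun z hz => by
      have := hφ.le_add_mul (x - z) x
      simp only [NNReal.coe_one, one_mul, dist_eq_norm] at this
      rw [sub_sub_cancel_left, norm_neg] at this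
      linarith)
  refine h.trans (le_of_eq ?_)
  rw [mollify_apply, integral_mul_const, (mollifier d hε).integral_normed, one_mul]

lemma le_mollify {φ : Euc d → ℝ} (hφ : LipschitzWith 1 φ) (x : Euc d) :
    φ x ≤ mollify hε φ x + ε := by
  have h := mollify_le_of_le hε (φ₁ := fun _ => φ x) (x₁ := x) (x₂ := x) (c := ε)
    continuous_const hφ.continuous (fun z hz => by
      have := hφ.le_add_mul x (x - z)
      simp only [NNReal.coe_one, one_mul, dist_eq_norm, sub_sub_cancel] at this
      linarith)
  refine (le_of_eq ?_).trans h
  rw [mollify_apply, integral_mul_const, (mollifier d hε).integral_normed, one_mul]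

lemma contDiff_mollify {φ : Euc d → ℝ} (hφ : Continuous φ) :
    ContDiff ℝ (⊤ : ℕ∞) (mollify hε φ) :=
  (mollifier d hε).hasCompactSupport_normed.contDiff_convolution_left _
    (mollifier d hε).contDiff_normed hφ.locallyIntegrable

/-- The derivatives of the mollifications of all `1`-Lipschitz functions have a common Lipschitz
constant: the second derivative of the mollification only involves one derivative of `φ`. -/
lemma exists_lipschitzWith_fderiv_mollify :
    ∃ C : ℝ≥0, ∀ φ : Euc d → ℝ, LipschitzWith 1 φ →
      LipschitzWith C (fderiv ℝ (mollify hε φ)) := by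
  set η := (mollifier d hε).normed volume with hη
  have hc : HasCompactSupport η := (mollifier d hε).hasCompactSupport_normed
  have hd : ContDiff ℝ 1 η := (mollifier d hε).contDiff_normed (n := 1)
  have hci : Continuous (fderiv ℝ η) := hd.continuous_fderiv one_ne_zero
  have hint : Integrable (fun z => ‖fderiv ℝ η z‖) :=
    (hci.integrable_of_hasCompactSupport (hc.fderiv (𝕜 := ℝ))).norm
  refine ⟨⟨∫ z, ‖fderiv ℝ η z‖, integral_nonneg fun _ => norm_nonneg _⟩, fun φ hφ => ?_⟩
  have hderiv : ∀ x, fderiv ℝ (mollify hε φ) x = ∫ z, φ (x - z) • fderiv ℝ η z := by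
    intro x
    have := (hc.hasFDerivAt_convolution_left (ContinuousLinearMap.lsmul ℝ ℝ) hd
      (hφ.continuous.locallyIntegrable (μ := volume)) x).fderiv
    rw [mollify, this, convolution_def]
    congr 1 with z w
    simp [ContinuousLinearMap.precompL_apply, mul_comm]
  have hi : ∀ x, Integrable (fun z => φ (x - z) • fderiv ℝ η z) := fun x =>
    ((hφ.continuous.comp (continuous_const.sub continuous_id)).smul hci)
      |>.integrable_of_hasCompactSupport ((hc.fderiv (𝕜 := ℝ)).smul_left)
  refine LipschitzWith.of_dist_le_mul fun x y => ?_
  rw [dist_eq_norm, hderiv, hderiv, ← integral_sub (hi x) (hi y)]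
  change _ ≤ (∫ z, ‖fderiv ℝ η z‖) * dist x y
  rw [← integral_mul_const]
  refine norm_integral_le_of_norm_le (hint.mul_const _) (Eventually.of_forall fun z => ?_)
  rw [← sub_smul, norm_smul, mul_comm]
  gcongr
  have := hφ.dist_le_mul (x - z) (y - z)
  rw [dist_sub_right] at this
  simpa [dist_eq_norm] using this

/-- Second order Taylor estimate for a function with Lipschitz derivative. -/
lemma abs_sub_sub_fderiv_le {f : Euc d → ℝ} (hf : Differentiable ℝ f) {C : ℝ≥0}
    (hC : LipschitzWith C (fderiv ℝ f)) (x h : Euc d) :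
    |f (x + h) - f x - fderiv ℝ f x h| ≤ C * ‖h‖ ^ 2 := by
  have := (convex_closedBall x ‖h‖).norm_image_sub_le_of_norm_fderiv_le' (𝕜 := ℝ) (f := f)
    (φ := fderiv ℝ f x) (C := C * ‖h‖) (x := x) (y := x + h) (fun z _ => hf z)
    (fun z hz => by
      rw [← dist_eq_norm]
      refine (hC.dist_le_mul z x).trans ?_
      gcongr
      simpa using hz) (by simp) (by simp)
  simp only [add_sub_cancel_left, Real.norm_eq_abs] at this
  rw [pow_two, ← mul_assoc]
  exact this

end mollifier

/-! ### Problems with bounded Lipschitz data -/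

namespace ControlProblem

/-- The data of the problem are bounded by `L` and `L`-Lipschitz. -/
structure IsTame (P : ControlProblem d D m) (L : ℝ≥0) : Prop where
  K_lip : LipschitzWith L P.K
  K_le : ∀ x, ‖P.K x‖ ≤ L
  g_lip : LipschitzWith L (fun p : (Fin m → Euc d) × Euc d => P.g p.1 p.2)
  g_le : ∀ y x, ‖P.g y x‖ ≤ L
  f_lip : ∀ k, LipschitzWith L (P.f k)
  f_le : ∀ k y, ‖P.f k y‖ ≤ L
  ω_lip : LipschitzWith L P.ω
  ω_le : ∀ x, ‖P.ω x‖ ≤ L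
  ℓ_lip : LipschitzWith L P.ℓ
  ℓ_le : ∀ p, ‖P.ℓ p‖ ≤ L

namespace IsTame

variable {P : ControlProblem d D m} {L : ℝ≥0} (hP : P.IsTame L)
include hP

lemma integrable_K (μ : Measure (Euc d)) [IsFiniteMeasure μ] (x : Euc d) :
    Integrable (fun x' => P.K (x - x')) μ :=
  integrable_of_norm_le (hP.K_lip.continuous.comp (continuous_const.sub continuous_id))
    (fun _ => hP.K_le _)

lemma lipschitzWith_K_sub (x : Euc d) : LipschitzWith L (fun x' => P.K (x - x')) :=
  LipschitzWith.of_dist_le_mul fun a b => by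
    simpa only [dist_sub_left] using hP.K_lip.dist_le_mul (x - a) (x - b)

lemma norm_conv_le (μ : ProbabilityMeasure (Euc d)) (x : Euc d) : ‖conv P.K μ x‖ ≤ L := by
  have := norm_integral_le_of_norm_le_const (μ := (μ : Measure (Euc d)))
    (f := fun x' => P.K (x - x')) (C := L) (Eventually.of_forall fun _ => hP.K_le _)
  simpa [conv] using this

lemma lipschitzWith_conv (μ : ProbabilityMeasure (Euc d)) : LipschitzWith L (conv P.K μ) := by
  refine LipschitzWith.of_dist_le_mul fun x y => ?_
  rw [dist_eq_norm, conv, conv, ← integral_sub (hP.integrable_K _ _) (hP.integrable_K _ _)]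
  have := norm_integral_le_of_norm_le_const (μ := (μ : Measure (Euc d)))
    (f := fun x' => P.K (x - x') - P.K (y - x')) (C := L * dist x y)
    (Eventually.of_forall fun z => by
      rw [← dist_eq_norm]
      simpa using hP.K_lip.dist_le_mul (x - z) (y - z))
  simpa using this

lemma norm_conv_sub_le {μ ν : ProbabilityMeasure (Euc d)} {D : ℝ} (h : KRBound D μ ν)
    (x : Euc d) : ‖conv P.K μ x - conv P.K ν x‖ ≤ L * D :=
  h.norm_sub_le (hP.lipschitzWith_K_sub x) (hP.integrable_K _ _) (hP.integrable_K _ _)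

lemma norm_conv_sub_le_of_W1_lt {μ ν : ProbabilityMeasure (Euc d)} {κ : ℝ}
    (h : W1 μ ν < ENNReal.ofReal κ) (x : Euc d) : ‖conv P.K μ x - conv P.K ν x‖ ≤ L * κ :=
  norm_integral_sub_le_of_W1_lt h (hP.lipschitzWith_K_sub x) (hP.integrable_K _ _)
    (hP.integrable_K _ _)

lemma norm_followerVelocity_le (y : Fin m → Euc d) (μ : ProbabilityMeasure (Euc d)) (x : Euc d) :
    ‖P.followerVelocity y μ x‖ ≤ 2 * L := by
  refine (norm_add_le _ _).trans ?_
  have := hP.norm_conv_le μ x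
  have := hP.g_le y x
  linarith

lemma lipschitzWith_g (y : Fin m → Euc d) : LipschitzWith L (P.g y) :=
  LipschitzWith.of_dist_le_mul fun a b => by
    simpa [Prod.dist_eq] using hP.g_lip.dist_le_mul (y, a) (y, b)

lemma norm_g_sub_le (y z : Fin m → Euc d) (x : Euc d) : ‖P.g y x - P.g z x‖ ≤ L * ‖y - z‖ := by
  simpa [Prod.dist_eq, dist_eq_norm] using hP.g_lip.dist_le_mul (y, x) (z, x)

lemma lipschitzWith_followerVelocity (y : Fin m → Euc d) (μ : ProbabilityMeasure (Euc d)) :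
    LipschitzWith (L + L) (P.followerVelocity y μ) :=
  (hP.lipschitzWith_conv μ).add (hP.lipschitzWith_g y)

lemma norm_followerVelocity_sub_le {y z : Fin m → Euc d} {μ ν : ProbabilityMeasure (Euc d)}
    {x : Euc d} {κ : ℝ} (h : ‖conv P.K μ x - conv P.K ν x‖ ≤ L * κ) :
    ‖P.followerVelocity y μ x - P.followerVelocity z ν x‖ ≤ L * (κ + ‖y - z‖) := by
  rw [followerVelocity, followerVelocity, add_sub_add_comm, mul_add]
  exact (norm_add_le _ _).trans (add_le_add h (hP.norm_g_sub_le y z x))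

/-- Lipschitz estimate for the part of the leaders' velocity that does not depend on the control. -/
lemma norm_leaderDrift_sub_le {y z : Fin m → Euc d} {μ ν : ProbabilityMeasure (Euc d)}
    {D : ℝ} (h : KRBound D μ ν) (k : Fin m) :
    ‖(conv P.K μ (y k) + P.f k y) - (conv P.K ν (z k) + P.f k z)‖ ≤ L * (D + 2 * ‖y - z‖) := by
  have h1 := hP.norm_conv_sub_le h (y k)
  have h2 : ‖conv P.K ν (y k) - conv P.K ν (z k)‖ ≤ L * ‖y - z‖ := by
    rw [← dist_eq_norm]
    refine ((hP.lipschitzWith_conv ν).dist_le_mul _ _).trans ?_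
    rw [dist_eq_norm]
    gcongr
    exact norm_le_pi_norm (y - z) k
  have h3 : ‖P.f k y - P.f k z‖ ≤ L * ‖y - z‖ := by
    simpa [dist_eq_norm] using (hP.f_lip k).dist_le_mul y z
  have e : (conv P.K μ (y k) + P.f k y) - (conv P.K ν (z k) + P.f k z)
      = (conv P.K μ (y k) - conv P.K ν (y k)) + (conv P.K ν (y k) - conv P.K ν (z k))
        + (P.f k y - P.f k z) := by abel
  rw [e]
  refine (norm_add₃_le).trans ?_
  linarith

end IsTame

/-! ### The continuity equation against smooth functions of arbitrary growth -/

variable {P : ControlProblem d D m}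

namespace IsMeanFieldSolution

variable {u : ℝ → Euc D} {y₀ : Fin m → Euc d} {μ₀ : ProbabilityMeasure (Euc d)}
  {y : ℝ → Fin m → Euc d} {μ : ℝ → ProbabilityMeasure (Euc d)}
  (h : P.IsMeanFieldSolution u y₀ μ₀ y μ)
include h

lemma exists_ae_norm_le : ∃ R > 0, ∀ t ∈ Icc 0 P.T, ∀ᵐ x ∂(μ t : Measure (Euc d)), ‖x‖ ≤ R := by
  obtain ⟨R, hR, H⟩ := h.support_bounded
  exact ⟨R, hR, fun t ht =>
    ae_norm_le_of_support_subset ((H t ht).trans Metric.ball_subset_closedBall)⟩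

/-- As the supports are bounded, the test functions need not have compact support. -/
lemma hasDerivWithinAt_integral {φ : Euc d → ℝ} (hφ : ContDiff ℝ (⊤ : ℕ∞) φ) {t : ℝ}
    (ht : t ∈ Icc 0 P.T) :
    HasDerivWithinAt (fun s => ∫ x, φ x ∂(μ s : Measure (Euc d)))
      (∫ x, fderiv ℝ φ x (P.followerVelocity (y t) (μ t) x) ∂(μ t : Measure (Euc d)))
      (Icc 0 P.T) t := by
  obtain ⟨R, hR, H⟩ := h.exists_ae_norm_le
  let χ : ContDiffBump (0 : Euc d) := ⟨R + 1, R + 2, by linarith, by linarith⟩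
  have hχ : ∀ x, ‖x‖ ≤ R → (fun x => χ x * φ x) =ᶠ[𝓝 x] φ := by
    intro x hx
    have : ∀ᶠ z in 𝓝 x, z ∈ Metric.ball (0 : Euc d) (R + 1) :=
      Metric.isOpen_ball.mem_nhds (by simp; linarith)
    filter_upwards [this] with z hz
    rw [χ.one_of_mem_closedBall (Metric.ball_subset_closedBall hz), one_mul]
  have key := h.continuity_equation (fun x => χ x * φ x) (χ.contDiff.mul hφ)
    χ.hasCompactSupport.mul_right t ht
  have e : ∀ s ∈ Icc 0 P.T, ∫ x, χ x * φ x ∂(μ s : Measure (Euc d))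
      = ∫ x, φ x ∂(μ s : Measure (Euc d)) := fun s hs =>
    integral_congr_ae (by filter_upwards [H s hs] with x hx using (hχ x hx).eq_of_nhds)
  have e2 : (∫ x, inner ℝ (gradient (fun x => χ x * φ x) x) (P.followerVelocity (y t) (μ t) x)
      ∂(μ t : Measure (Euc d)))
      = ∫ x, fderiv ℝ φ x (P.followerVelocity (y t) (μ t) x) ∂(μ t : Measure (Euc d)) :=
    integral_congr_ae (by
      filter_upwards [H t ht] with x hx
      rw [inner_gradient_left, (hχ x hx).fderiv_eq])
  rw [e2] at key
  exact key.congr (fun s hs => (e s hs).symm) (e t ht).symm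

end IsMeanFieldSolution

end ControlProblem

/-! ### Integrals with variable upper end point -/

lemma hasDerivWithinAt_integral_of_continuousOn {E : Type*} [NormedAddCommGroup E]
    [NormedSpace ℝ E] [CompleteSpace E] {T : ℝ} (hT : 0 ≤ T) {f : ℝ → E}
    (hf : ContinuousOn f (Icc 0 T)) {t : ℝ} (ht : t ∈ Icc 0 T) :
    HasDerivWithinAt (fun t => ∫ s in (0 : ℝ)..t, f s) (f t) (Icc 0 T) t := by
  have hc : Continuous (IccExtend hT ((Icc 0 T).domRestrict f)) :=
    (continuousOn_iff_continuous_domRestrict.1 hf).Icc_extend'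
  have heq : ∀ s ∈ Icc 0 T, IccExtend hT ((Icc 0 T).domRestrict f) s = f s := fun s hs => by
    rw [IccExtend_of_mem hT _ hs]; rfl
  have h1 := (hc.integral_hasStrictDerivAt 0 t).hasDerivAt.hasDerivWithinAt (s := Icc 0 T)
  rw [heq t ht] at h1
  have e : ∀ r ∈ Icc 0 T, ∫ s in (0 : ℝ)..r, f s
      = ∫ s in (0 : ℝ)..r, IccExtend hT ((Icc 0 T).domRestrict f) s := fun r hr => by
    refine intervalIntegral.integral_congr fun s hs => ?_
    rw [uIcc_of_le hr.1] at hs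
    exact (heq s ⟨hs.1, hs.2.trans hr.2⟩).symm
  exact h1.congr e (e t ht)

lemma intervalIntegrable_of_continuousOn {E : Type*} [NormedAddCommGroup E]
    {T : ℝ} {f : ℝ → E} (hf : ContinuousOn f (Icc 0 T)) {s t : ℝ} (hs : s ∈ Icc 0 T)
    (ht : t ∈ Icc 0 T) : IntervalIntegrable f volume s t :=
  (hf.mono (uIcc_subset_Icc hs ht)).intervalIntegrable

/-! ### Stability of the mean-field system -/

namespace ControlProblem

variable {P : ControlProblem d D m} {L : ℝ≥0}

lemma IsControl.intervalIntegrable {u : ℝ → Euc D} (hu : P.IsControl u) (k : Fin m) {s t : ℝ}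
    (hs : s ∈ Icc 0 P.T) (ht : t ∈ Icc 0 P.T) :
    IntervalIntegrable (fun s => Matrix.toEuclideanLin (P.B k) (u s)) volume s t := by
  have h1 : Integrable u P.timeMeasure := memLp_one_iff_integrable.1 hu.1
  have h2 : IntegrableOn (fun s => Matrix.toEuclideanLin (P.B k) (u s)) (Icc 0 P.T) :=
    (Matrix.toEuclideanLin (P.B k)).toContinuousLinearMap.integrable_comp h1
  refine IntegrableOn.intervalIntegrable (h2.mono_set (uIcc_subset_Icc hs ht))

namespace IsMeanFieldSolution

variable {u : ℝ → Euc D} {y₀ : Fin m → Euc d} {μ₀ : ProbabilityMeasure (Euc d)}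
  {y : ℝ → Fin m → Euc d} {μ : ℝ → ProbabilityMeasure (Euc d)}
  (h : P.IsMeanFieldSolution u y₀ μ₀ y μ)
include h

lemma eventually_close {s : ℝ} (hs : s ∈ Icc 0 P.T) {κ : ℝ} (hκ : 0 < κ) :
    ∀ᶠ r in 𝓝[Icc 0 P.T] s, W1 (μ r) (μ s) < ENNReal.ofReal κ ∧ ‖y r - y s‖ < κ := by
  refine ((h.continuous_W1 s hs).eventually (gt_mem_nhds (by simpa using hκ))).and ?_
  have := (h.leaders.1 s hs).eventually (Metric.ball_mem_nhds (y s) hκ)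
  filter_upwards [this] with r hr
  rwa [← dist_eq_norm]

/-- A functional of the state which is Lipschitz for `W₁` is continuous along solutions. -/
lemma continuousOn_of_W1 {E : Type*} [NormedAddCommGroup E] {F : ℝ → E} {C : ℝ} (hC : 0 ≤ C)
    (hF : ∀ r ∈ Icc 0 P.T, ∀ s ∈ Icc 0 P.T, ∀ κ : ℝ, W1 (μ r) (μ s) < ENNReal.ofReal κ →
      ‖y r - y s‖ < κ → ‖F r - F s‖ ≤ C * κ) : ContinuousOn F (Icc 0 P.T) := by
  intro s hs
  refine Metric.tendsto_nhds.2 fun η hη => ?_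
  have hκ : 0 < η / (C + 1) := by positivity
  filter_upwards [h.eventually_close hs hκ, self_mem_nhdsWithin] with r hr hrT
  rw [dist_eq_norm]
  refine (hF r hrT s hs _ hr.1 hr.2).trans_lt ?_
  rw [mul_div_assoc', div_lt_iff₀ (by positivity)]
  nlinarith

lemma continuousOn_leaderDrift (hP : P.IsTame L) (k : Fin m) :
    ContinuousOn (fun s => conv P.K (μ s) (y s k) + P.f k (y s)) (Icc 0 P.T) := by
  refine h.continuousOn_of_W1 (C := L + L + L) (by positivity) fun r _ s _ κ hκ hyκ => ?_
  have h1 := hP.norm_conv_sub_le_of_W1_lt hκ (y r k)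
  have h2 : ‖conv P.K (μ s) (y r k) - conv P.K (μ s) (y s k)‖ ≤ L * κ := by
    rw [← dist_eq_norm]
    refine ((hP.lipschitzWith_conv _).dist_le_mul _ _).trans ?_
    rw [dist_eq_norm]
    gcongr
    exact (norm_le_pi_norm (y r - y s) k).trans hyκ.le
  have h3 : ‖P.f k (y r) - P.f k (y s)‖ ≤ L * κ := by
    rw [← dist_eq_norm]
    refine ((hP.f_lip k).dist_le_mul _ _).trans ?_
    rw [dist_eq_norm]
    gcongr
  have e : (conv P.K (μ r) (y r k) + P.f k (y r)) - (conv P.K (μ s) (y s k) + P.f k (y s))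
      = (conv P.K (μ r) (y r k) - conv P.K (μ s) (y r k))
        + (conv P.K (μ s) (y r k) - conv P.K (μ s) (y s k))
        + (P.f k (y r) - P.f k (y s)) := by abel
  rw [e]
  refine norm_add₃_le.trans ?_
  linarith

lemma leader_eq (hP : P.IsTame L) (hu : P.IsControl u) {t : ℝ} (ht : t ∈ Icc 0 P.T) (k : Fin m) :
    y t k = y₀ k + ((∫ s in (0 : ℝ)..t, (conv P.K (μ s) (y s k) + P.f k (y s)))
      + ∫ s in (0 : ℝ)..t, Matrix.toEuclideanLin (P.B k) (u s)) := by
  have h0 : (0 : ℝ) ∈ Icc 0 P.T := ⟨le_rfl, ht.1.trans ht.2⟩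
  rw [h.leaders.2 t ht k, ← intervalIntegral.integral_add
    (intervalIntegrable_of_continuousOn (h.continuousOn_leaderDrift hP k) h0 ht)
    (hu.intervalIntegrable k h0 ht)]
  rfl

/-- First order expansion in time of the integrals of mollified `1`-Lipschitz functions. The
uniformity in `φ` comes from the continuity of `μ` for `W₁` and from the uniform Lipschitz bound
on the derivatives of the mollifications. -/
lemma eventually_abs_integral_mollify_sub_le (hP : P.IsTame L) {ε : ℝ} (hε : 0 < ε) {s : ℝ}
    (hs : s ∈ Ico 0 P.T) {κ : ℝ} (hκ : 0 < κ) :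
    ∀ᶠ τ in 𝓝[>] s, ∀ φ : Euc d → ℝ, LipschitzWith 1 φ →
      |∫ x, mollify hε φ x ∂(μ τ : Measure (Euc d)) - ∫ x, mollify hε φ x ∂(μ s : Measure (Euc d))
        - (τ - s) * ∫ x, fderiv ℝ (mollify hε φ) x (P.followerVelocity (y s) (μ s) x)
          ∂(μ s : Measure (Euc d))| ≤ κ * (τ - s) := by
  obtain ⟨C, hC⟩ := exists_lipschitzWith_fderiv_mollify (d := d) hε
  have hs' : s ∈ Icc 0 P.T := Ico_subset_Icc_self hs
  -- `2 L` for the velocity field and `2 L + 2 L C` for the integrand, both tested at distance `κ / A`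
  set A : ℝ := 4 * L + 2 * L * C + 1 with hA
  have hApos : 0 < A := by positivity
  have hκ' : 0 < κ / A := by positivity
  obtain ⟨ρ, hρ, H⟩ := Metric.mem_nhdsWithin_iff.1 (h.eventually_close hs' hκ')
  have hτ : ∀ᶠ τ in 𝓝[>] s, τ ∈ Ioo s (min (s + ρ) P.T) :=
    Ioo_mem_nhdsGT (lt_min (by linarith) hs.2)
  filter_upwards [hτ] with τ hτ φ hφ
  obtain ⟨hsτ, hτ2⟩ := hτ
  have hτρ : τ < s + ρ := hτ2.trans_le (min_le_left _ _)
  have hτT : τ < P.T := hτ2.trans_le (min_le_right _ _)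
  set M := mollify hε φ with hM
  have hMc : ContDiff ℝ (⊤ : ℕ∞) M := contDiff_mollify hε hφ.continuous
  have hM1 : ∀ x, ‖fderiv ℝ M x‖ ≤ 1 := fun x => by
    simpa using norm_fderiv_le_of_lipschitz ℝ (lipschitzWith_mollify hε hφ) (x₀ := x)
  have hM2 : LipschitzWith C (fderiv ℝ M) := hC φ hφ
  have hvlip : ∀ r, LipschitzWith (L + L) (P.followerVelocity (y r) (μ r)) := fun r =>
    hP.lipschitzWith_followerVelocity _ _
  have hvle : ∀ r x, ‖P.followerVelocity (y r) (μ r) x‖ ≤ 2 * L := fun r x =>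
    hP.norm_followerVelocity_le _ _ _
  have hFlip : ∀ r, LipschitzWith (C * (2 * L) + (L + L))
      (fun x => fderiv ℝ M x (P.followerVelocity (y r) (μ r) x)) := fun r => by
    refine LipschitzWith.of_dist_le_mul fun x x' => ?_
    set v := P.followerVelocity (y r) (μ r)
    have e : fderiv ℝ M x (v x) - fderiv ℝ M x' (v x')
        = (fderiv ℝ M x - fderiv ℝ M x') (v x) + fderiv ℝ M x' (v x - v x') := by
      simp
    rw [dist_eq_norm, e]
    have h1 : ‖(fderiv ℝ M x - fderiv ℝ M x') (v x)‖ ≤ C * dist x x' * (2 * L) := by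
      refine (ContinuousLinearMap.le_opNorm _ _).trans ?_
      gcongr
      · rw [← dist_eq_norm]; exact hM2.dist_le_mul _ _
      · exact hvle r x
    have h2 : ‖fderiv ℝ M x' (v x - v x')‖ ≤ 1 * ((L + L : ℝ≥0) * dist x x') := by
      refine (ContinuousLinearMap.le_opNorm _ _).trans ?_
      gcongr
      · exact hM1 x'
      · rw [← dist_eq_norm]; exact (hvlip r).dist_le_mul _ _
    refine (norm_add_le _ _).trans ?_
    have hc : ((C * (2 * L) + (L + L) : ℝ≥0) : ℝ) = C * (2 * L) + (L + L) := by push_cast; rfl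
    rw [hc]
    push_cast at h2
    linarith
  have hFle : ∀ r x, ‖fderiv ℝ M x (P.followerVelocity (y r) (μ r) x)‖ ≤ 2 * L := fun r x => by
    refine (ContinuousLinearMap.le_opNorm _ _).trans ?_
    have := mul_le_mul (hM1 x) (hvle r x) (norm_nonneg _) zero_le_one
    linarith
  -- the time derivative of the integral of `M`, which stays close to its value at time `s`
  set q' : ℝ → ℝ := fun r => ∫ x, fderiv ℝ M x (P.followerVelocity (y r) (μ r) x)
    ∂(μ r : Measure (Euc d)) with hq'
  have hsub : Icc s τ ⊆ Icc 0 P.T := Icc_subset_Icc hs.1 hτT.le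
  have hbound : ∀ r ∈ Icc s τ, ‖q' r - q' s‖ ≤ κ := by
    intro r hr
    have hrT := hsub hr
    have hclose := H ⟨by
      rw [Metric.mem_ball, Real.dist_eq, abs_of_nonneg (by linarith [hr.1])]
      linarith [hr.2], hrT⟩
    have e1 : ‖q' r - ∫ x, fderiv ℝ M x (P.followerVelocity (y s) (μ s) x)
        ∂(μ r : Measure (Euc d))‖ ≤ L * (κ / A + κ / A) := by
      rw [hq', ← integral_sub (integrable_of_norm_le (hFlip r).continuous (hFle r))
        (integrable_of_norm_le (hFlip s).continuous (hFle s))]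
      have := norm_integral_le_of_norm_le_const (μ := (μ r : Measure (Euc d)))
        (f := fun x => fderiv ℝ M x (P.followerVelocity (y r) (μ r) x)
          - fderiv ℝ M x (P.followerVelocity (y s) (μ s) x)) (C := L * (κ / A + κ / A))
        (Eventually.of_forall fun x => by
          rw [← map_sub]
          refine (ContinuousLinearMap.le_opNorm _ _).trans ?_
          have h1 := hP.norm_followerVelocity_sub_le (y := y r) (z := y s)
            (hP.norm_conv_sub_le_of_W1_lt hclose.1 x)
          have h2 : L * (κ / A + ‖y r - y s‖) ≤ L * (κ / A + κ / A) := by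
            gcongr
            exact hclose.2.le
          have := mul_le_mul (hM1 x) (h1.trans h2) (norm_nonneg _) zero_le_one
          linarith)
      simpa using this
    have e2 := norm_integral_sub_le_of_W1_lt hclose.1 (hFlip s)
      (integrable_of_norm_le (hFlip s).continuous (hFle s))
      (integrable_of_norm_le (hFlip s).continuous (hFle s))
    have e3 := norm_sub_le_norm_sub_add_norm_sub (q' r)
      (∫ x, fderiv ℝ M x (P.followerVelocity (y s) (μ s) x) ∂(μ r : Measure (Euc d))) (q' s)
    refine e3.trans ((add_le_add e1 e2).trans ?_)
    have : κ = A * (κ / A) := by field_simp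
    push_cast
    nth_rewrite 4 [this]
    rw [hA]
    nlinarith
  have hder : ∀ r ∈ Icc s τ, HasDerivWithinAt
      (fun r => ∫ x, M x ∂(μ r : Measure (Euc d)) - r * q' s) (q' r - q' s) (Icc s τ) r := by
    intro r hr
    have h1 := (h.hasDerivWithinAt_integral hMc (hsub hr)).mono hsub
    have h2 := ((hasDerivAt_id r).mul_const (q' s)).hasDerivWithinAt (s := Icc s τ)
    rw [one_mul] at h2
    exact h1.sub h2
  have := (convex_Icc s τ).norm_image_sub_le_of_norm_hasDerivWithin_le hder hbound
    (left_mem_Icc.2 hsτ.le) (right_mem_Icc.2 hsτ.le)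
  rw [Real.norm_eq_abs, Real.norm_eq_abs, abs_of_pos (sub_pos.2 hsτ)] at this
  refine le_trans (le_of_eq ?_) this
  congr 1
  ring

end IsMeanFieldSolution

end ControlProblem

/-- The supremum over `1`-Lipschitz `φ` of the differences of the integrals of the mollification
of `φ`; it approximates the Kantorovich–Rubinstein distance up to `2 ε`. -/
noncomputable def mollDist {ε : ℝ} (hε : 0 < ε) (μ ν : ProbabilityMeasure (Euc d)) : ℝ :=
  ⨆ φ : {φ : Euc d → ℝ // LipschitzWith 1 φ},
    (∫ x, mollify hε φ.1 x ∂(μ : Measure (Euc d)) - ∫ x, mollify hε φ.1 x ∂(ν : Measure (Euc d)))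

section mollDist

variable {ε : ℝ} (hε : 0 < ε) {μ ν : ProbabilityMeasure (Euc d)} {R : ℝ}

lemma mollDist_le {D : ℝ}
    (H : ∀ φ : Euc d → ℝ, LipschitzWith 1 φ → ∫ x, mollify hε φ x ∂(μ : Measure (Euc d))
      - ∫ x, mollify hε φ x ∂(ν : Measure (Euc d)) ≤ D) : mollDist hε μ ν ≤ D :=
  haveI : Nonempty {φ : Euc d → ℝ // LipschitzWith 1 φ} := ⟨⟨fun _ => 0, LipschitzWith.const' 0⟩⟩
  ciSup_le fun φ => H φ.1 φ.2

lemma abs_integral_sub_le {φ : Euc d → ℝ} (hφ : LipschitzWith 1 φ)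
    (hμ : ∀ᵐ x ∂(μ : Measure (Euc d)), ‖x‖ ≤ R) :
    |∫ x, φ x ∂(μ : Measure (Euc d)) - φ 0| ≤ R := by
  have hi := integrable_of_ae_norm_le hμ hφ.continuous
  have e : ∫ x, φ x ∂(μ : Measure (Euc d)) - φ 0 = ∫ x, (φ x - φ 0) ∂(μ : Measure (Euc d)) := by
    rw [integral_sub hi (integrable_const _)]; simp
  rw [e]
  have := norm_integral_le_of_norm_le_const (μ := (μ : Measure (Euc d)))
    (f := fun x => φ x - φ 0) (C := R) (by
      filter_upwards [hμ] with x hx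
      rw [← dist_eq_norm]
      refine (hφ.dist_le_mul x 0).trans ?_
      simpa using hx)
  simpa using this

variable (hμ : ∀ᵐ x ∂(μ : Measure (Euc d)), ‖x‖ ≤ R) (hν : ∀ᵐ x ∂(ν : Measure (Euc d)), ‖x‖ ≤ R)
include hμ hν

lemma le_mollDist {φ : Euc d → ℝ} (hφ : LipschitzWith 1 φ) :
    ∫ x, mollify hε φ x ∂(μ : Measure (Euc d)) - ∫ x, mollify hε φ x ∂(ν : Measure (Euc d))
      ≤ mollDist hε μ ν := by
  refine le_ciSup (f := fun φ : {φ : Euc d → ℝ // LipschitzWith 1 φ} =>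
    ∫ x, mollify hε φ.1 x ∂(μ : Measure (Euc d)) - ∫ x, mollify hε φ.1 x ∂(ν : Measure (Euc d)))
    ⟨R + R, ?_⟩ ⟨φ, hφ⟩
  rintro _ ⟨ψ, rfl⟩
  have h1 := abs_le.1 (abs_integral_sub_le (lipschitzWith_mollify hε ψ.2) hμ)
  have h2 := abs_le.1 (abs_integral_sub_le (lipschitzWith_mollify hε ψ.2) hν)
  dsimp only
  linarith [h1.2, h2.1]

/-- The bound for `C`-Lipschitz functions; mollification commutes with multiplication by `C`. -/
lemma mul_le_mollDist {C : ℝ≥0} (hC : 0 < C) {φ : Euc d → ℝ} (hφ : LipschitzWith C φ) :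
    ∫ x, mollify hε φ x ∂(μ : Measure (Euc d)) - ∫ x, mollify hε φ x ∂(ν : Measure (Euc d))
      ≤ C * mollDist hε μ ν := by
  have hC' : (0 : ℝ) < C := by positivity
  have := le_mollDist hε hμ hν (φ := fun x => (C : ℝ)⁻¹ * φ x) (by
    refine LipschitzWith.of_dist_le_mul fun x y => ?_
    have := hφ.dist_le_mul x y
    rw [Real.dist_eq] at *
    rw [← mul_sub, abs_mul, abs_of_pos (inv_pos.2 hC'), inv_mul_le_iff₀ hC']
    simpa using this)
  simp only [mollify_const_mul, integral_const_mul] at this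
  rw [← mul_sub, inv_mul_le_iff₀ hC'] at this
  exact this

lemma krBound_mollDist : KRBound (mollDist hε μ ν + 2 * ε) μ ν := fun φ hφ => by
  have hc := (lipschitzWith_mollify hε hφ).continuous
  have h1 : ∫ x, φ x ∂(μ : Measure (Euc d)) ≤ ∫ x, mollify hε φ x ∂(μ : Measure (Euc d)) + ε := by
    have := integral_mono (μ := (μ : Measure (Euc d))) (integrable_of_ae_norm_le hμ hφ.continuous)
      ((integrable_of_ae_norm_le hμ hc).add (integrable_const ε)) (le_mollify hε hφ)
    simp only [Pi.add_apply] at this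
    rw [integral_add (integrable_of_ae_norm_le hμ hc) (integrable_const ε)] at this
    simpa using this
  have h2 : ∫ x, mollify hε φ x ∂(ν : Measure (Euc d)) ≤ ∫ x, φ x ∂(ν : Measure (Euc d)) + ε := by
    have := integral_mono (μ := (ν : Measure (Euc d))) (integrable_of_ae_norm_le hν hc)
      ((integrable_of_ae_norm_le hν hφ.continuous).add (integrable_const ε)) (mollify_le hε hφ)
    simp only [Pi.add_apply] at this
    rw [integral_add (integrable_of_ae_norm_le hν hφ.continuous) (integrable_const ε)] at this
    simpa using this
  have h3 := le_mollDist hε hμ hν hφ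
  linarith

end mollDist

/-- Transporting the argument of `φ` along a Lipschitz field `v` and mollifying commute up to an
error of order `δ ε`: this is where the Lipschitz regularity of the velocity enters. -/
lemma abs_mollify_comp_sub_le {ε : ℝ} (hε : 0 < ε) {C : ℝ≥0} {φ : Euc d → ℝ}
    (hφ : LipschitzWith 1 φ) (hC : LipschitzWith C (fderiv ℝ (mollify hε φ)))
    {v : Euc d → Euc d} {V : ℝ} {Λ : ℝ≥0} (hv : LipschitzWith Λ v) (hV : ∀ x, ‖v x‖ ≤ V)
    {δ : ℝ} (hδ : 0 ≤ δ) (x : Euc d) :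
    |mollify hε φ x + δ * fderiv ℝ (mollify hε φ) x (v x) - mollify hε (fun x => φ (x + δ • v x)) x|
      ≤ δ * Λ * ε + C * (δ * V) ^ 2 := by
  have hψ : Continuous (fun x => φ (x + δ • v x)) :=
    hφ.continuous.comp (continuous_id.add (hv.continuous.const_smul δ))
  have h0 : ∀ z : Euc d, ‖z‖ ≤ ε → dist (x + δ • v x - z) (x - z + δ • v (x - z)) ≤ δ * Λ * ε := by
    intro z hz
    have e : x + δ • v x - z - (x - z + δ • v (x - z)) = δ • (v x - v (x - z)) := by
      rw [smul_sub]; abel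
    rw [dist_eq_norm, e, norm_smul, Real.norm_of_nonneg hδ, ← dist_eq_norm, mul_assoc]
    gcongr
    refine (hv.dist_le_mul _ _).trans ?_
    gcongr
    simpa [dist_eq_norm] using hz
  have h1 : mollify hε φ (x + δ • v x) ≤ mollify hε (fun x => φ (x + δ • v x)) x + δ * Λ * ε :=
    mollify_le_of_le hε hφ.continuous hψ fun z hz => by
      have := hφ.le_add_mul (x + δ • v x - z) (x - z + δ • v (x - z))
      have := h0 z hz
      simp only [NNReal.coe_one, one_mul] at *
      linarith
  have h2 : mollify hε (fun x => φ (x + δ • v x)) x ≤ mollify hε φ (x + δ • v x) + δ * Λ * ε :=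
    mollify_le_of_le hε hψ hφ.continuous fun z hz => by
      have := hφ.le_add_mul (x - z + δ • v (x - z)) (x + δ • v x - z)
      have := h0 z hz
      rw [dist_comm] at this
      simp only [NNReal.coe_one, one_mul] at *
      linarith
  have h3 := abs_sub_sub_fderiv_le ((contDiff_mollify hε hφ.continuous).differentiable (by simp))
    hC x (δ • v x)
  have h4 : (C : ℝ) * ‖δ • v x‖ ^ 2 ≤ C * (δ * V) ^ 2 := by
    rw [norm_smul, Real.norm_of_nonneg hδ]
    gcongr
    exact hV x
  rw [map_smul, smul_eq_mul] at h3
  rw [abs_le] at h3 ⊢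
  constructor <;> linarith [h3.1, h3.2]

namespace ControlProblem

variable {P : ControlProblem d D m} {L : ℝ≥0}

namespace IsMeanFieldSolution

variable {u v : ℝ → Euc D} {y₀ : Fin m → Euc d} {μ₀ ν₀ : ProbabilityMeasure (Euc d)}
  {y z : ℝ → Fin m → Euc d} {μ ν : ℝ → ProbabilityMeasure (Euc d)}

/-- One step of the duality argument: a test function `φ` for the time `τ > s` is replaced by
`φ ∘ (id + (τ - s) V)` at time `s`, where `V` is the velocity of the first solution. -/
lemma eventually_mollDist_le (h : P.IsMeanFieldSolution u y₀ μ₀ y μ)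
    (h' : P.IsMeanFieldSolution v y₀ ν₀ z ν) (hP : P.IsTame L) {ε : ℝ} (hε : 0 < ε) {s : ℝ}
    (hs : s ∈ Ico 0 P.T) {κ : ℝ} (hκ : 0 < κ) :
    ∀ᶠ τ in 𝓝[>] s, mollDist hε (μ τ) (ν τ) ≤ mollDist hε (μ s) (ν s)
      + (τ - s) * (3 * L * mollDist hε (μ s) (ν s) + L * ‖y s - z s‖ + 6 * L * ε + κ) := by
  obtain ⟨C, hC⟩ := exists_lipschitzWith_fderiv_mollify (d := d) hε
  obtain ⟨R, -, hμR⟩ := h.exists_ae_norm_le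
  obtain ⟨R', -, hνR⟩ := h'.exists_ae_norm_le
  have hs' : s ∈ Icc 0 P.T := Ico_subset_Icc_self hs
  replace hμR : ∀ᵐ x ∂(μ s : Measure (Euc d)), ‖x‖ ≤ max R R' := by
    filter_upwards [hμR s hs'] with x hx using hx.trans (le_max_left _ _)
  replace hνR : ∀ᵐ x ∂(ν s : Measure (Euc d)), ‖x‖ ≤ max R R' := by
    filter_upwards [hνR s hs'] with x hx using hx.trans (le_max_right _ _)
  have hsmall : ∀ᶠ τ in 𝓝[>] s, (τ - s) * (8 * C * L ^ 2) < κ / 2 := by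
    have : Tendsto (fun τ => (τ - s) * (8 * C * L ^ 2)) (𝓝[>] s)
        (𝓝 ((s - s) * (8 * C * L ^ 2))) :=
      (((continuous_id.sub continuous_const).mul continuous_const).tendsto s).mono_left
        nhdsWithin_le_nhds
    rw [sub_self, zero_mul] at this
    exact this.eventually (gt_mem_nhds (by positivity))
  filter_upwards [h.eventually_abs_integral_mollify_sub_le hP hε hs (κ := κ / 4) (by positivity),
    h'.eventually_abs_integral_mollify_sub_le hP hε hs (κ := κ / 4) (by positivity),
    hsmall, self_mem_nhdsWithin] with τ h1 h2 h3 hτ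
  refine mollDist_le hε fun φ hφ => ?_
  have hδ : 0 < τ - s := sub_pos.2 hτ
  set δ := τ - s
  set V := P.followerVelocity (y s) (μ s)
  set W := P.followerVelocity (z s) (ν s)
  have hVlip : LipschitzWith (L + L) V := hP.lipschitzWith_followerVelocity _ _
  have hWlip : LipschitzWith (L + L) W := hP.lipschitzWith_followerVelocity _ _
  have hVle : ∀ x, ‖V x‖ ≤ 2 * L := hP.norm_followerVelocity_le _ _
  have hWle : ∀ x, ‖W x‖ ≤ 2 * L := hP.norm_followerVelocity_le _ _
  set M := mollify hε φ
  have hMc : ContDiff ℝ (⊤ : ℕ∞) M := contDiff_mollify hε hφ.continuous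
  have hM1 : ∀ x, ‖fderiv ℝ M x‖ ≤ 1 := fun x => by
    simpa using norm_fderiv_le_of_lipschitz ℝ (lipschitzWith_mollify hε hφ) (x₀ := x)
  have hMcont : Continuous M := hMc.continuous
  have hfc : Continuous (fderiv ℝ M) := hMc.continuous_fderiv (by simp)
  set ψ : Euc d → ℝ := fun x => φ (x + δ • V x)
  have hψlip : LipschitzWith (1 + δ.toNNReal * (L + L)) ψ := by
    refine LipschitzWith.of_dist_le_mul fun a b => ?_
    refine (hφ.dist_le_mul _ _).trans ?_
    rw [NNReal.coe_one, one_mul]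
    refine (dist_add_add_le _ _ _ _).trans ?_
    rw [dist_smul₀, Real.norm_of_nonneg hδ.le, NNReal.coe_add, NNReal.coe_mul,
      Real.coe_toNNReal _ hδ.le, NNReal.coe_one, add_mul, one_mul, mul_assoc]
    gcongr
    exact hVlip.dist_le_mul a b
  have hψM : Continuous (mollify hε ψ) := (contDiff_mollify hε hψlip.continuous).continuous
  have hcomm : ∀ x, |M x + δ * fderiv ℝ M x (V x) - mollify hε ψ x|
      ≤ δ * (L + L : ℝ≥0) * ε + C * (δ * (2 * L)) ^ 2 := fun x =>
    abs_mollify_comp_sub_le hε hφ (hC φ hφ) hVlip hVle hδ.le x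
  set c := δ * (L + L : ℝ≥0) * ε + C * (δ * (2 * L)) ^ 2 with hc
  have hcont : ∀ {X : Euc d → Euc d}, Continuous X → Continuous (fun x => fderiv ℝ M x (X x)) :=
    fun hX => hfc.clm_apply hX
  have ib : ∀ {X : Euc d → Euc d} (ρ : ProbabilityMeasure (Euc d)), Continuous X →
      (∀ x, ‖X x‖ ≤ 2 * L) → Integrable (fun x => fderiv ℝ M x (X x)) (ρ : Measure (Euc d)) := by
    intro X ρ hX hXle
    refine integrable_of_norm_le (hcont hX) (C := 2 * L) fun x => ?_
    refine (ContinuousLinearMap.le_opNorm _ _).trans ?_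
    have := mul_le_mul (hM1 x) (hXle x) (norm_nonneg _) zero_le_one
    linarith
  have iVμ := ib (μ s) hVlip.continuous hVle
  have iVν := ib (ν s) hVlip.continuous hVle
  have iWν := ib (ν s) hWlip.continuous hWle
  have iMμ := integrable_of_ae_norm_le hμR hMcont
  have iMν := integrable_of_ae_norm_le hνR hMcont
  have iψμ := integrable_of_ae_norm_le hμR hψM
  have iψν := integrable_of_ae_norm_le hνR hψM
  have e1 : ∫ x, M x ∂(μ s : Measure (Euc d)) + δ * ∫ x, fderiv ℝ M x (V x)
      ∂(μ s : Measure (Euc d)) ≤ ∫ x, mollify hε ψ x ∂(μ s : Measure (Euc d)) + c := by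
    have := integral_mono (iMμ.add (iVμ.const_mul δ)) (iψμ.add (integrable_const c))
      (fun x => by
        have := (abs_le.1 (hcomm x)).2
        simp only [Pi.add_apply]
        linarith)
    simp only [Pi.add_apply] at this
    rw [integral_add iMμ (iVμ.const_mul δ), integral_add iψμ (integrable_const c),
      integral_const_mul] at this
    simpa using this
  have e2 : ∫ x, mollify hε ψ x ∂(ν s : Measure (Euc d)) ≤ ∫ x, M x ∂(ν s : Measure (Euc d))
      + δ * ∫ x, fderiv ℝ M x (V x) ∂(ν s : Measure (Euc d)) + c := by
    have := integral_mono (iψν.sub (integrable_const c)) (iMν.add (iVν.const_mul δ))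
      (fun x => by
        have := (abs_le.1 (hcomm x)).1
        simp only [Pi.add_apply, Pi.sub_apply]
        linarith)
    simp only [Pi.add_apply, Pi.sub_apply] at this
    rw [integral_sub iψν (integrable_const c), integral_add iMν (iVν.const_mul δ),
      integral_const_mul, sub_le_iff_le_add] at this
    simpa using this
  set Δ := mollDist hε (μ s) (ν s)
  have hKR : KRBound (Δ + 2 * ε) (μ s) (ν s) := krBound_mollDist hε hμR hνR
  have e3 : ∫ x, fderiv ℝ M x (V x) ∂(ν s : Measure (Euc d))
      ≤ ∫ x, fderiv ℝ M x (W x) ∂(ν s : Measure (Euc d)) + L * (Δ + 2 * ε + ‖y s - z s‖) := by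
    have := integral_mono iVν (iWν.add (integrable_const (L * (Δ + 2 * ε + ‖y s - z s‖))))
      (fun x => by
        have h1 : ‖V x - W x‖ ≤ L * (Δ + 2 * ε + ‖y s - z s‖) :=
          hP.norm_followerVelocity_sub_le (hP.norm_conv_sub_le hKR x)
        have h2 : fderiv ℝ M x (V x - W x) ≤ 1 * ‖V x - W x‖ :=
          (le_abs_self _).trans ((ContinuousLinearMap.le_opNorm _ _).trans
            (mul_le_mul_of_nonneg_right (hM1 x) (norm_nonneg _)))
        rw [map_sub] at h2
        simp only [Pi.add_apply]
        linarith)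
    simp only [Pi.add_apply] at this
    rw [integral_add iWν (integrable_const _)] at this
    simpa using this
  have e4 := mul_le_mollDist hε hμR hνR (add_pos_of_pos_of_nonneg one_pos zero_le) hψlip
  rw [NNReal.coe_add, NNReal.coe_mul, Real.coe_toNNReal _ hδ.le, NNReal.coe_one,
    NNReal.coe_add] at e4
  have e5 := (abs_le.1 (h1 φ hφ)).2
  have e6 := (abs_le.1 (h2 φ hφ)).1
  have e7 := mul_le_mul_of_nonneg_left e3 hδ.le
  have e8 := mul_le_mul_of_nonneg_left h3.le hδ.le
  rw [NNReal.coe_add] at hc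
  nlinarith

lemma continuousOn_mollDist (h : P.IsMeanFieldSolution u y₀ μ₀ y μ)
    (h' : P.IsMeanFieldSolution v y₀ ν₀ z ν) {ε : ℝ} (hε : 0 < ε) :
    ContinuousOn (fun s => mollDist hε (μ s) (ν s)) (Icc 0 P.T) := by
  obtain ⟨R, -, hμR⟩ := h.exists_ae_norm_le
  obtain ⟨R', -, hνR⟩ := h'.exists_ae_norm_le
  replace hμR : ∀ s ∈ Icc 0 P.T, ∀ᵐ x ∂(μ s : Measure (Euc d)), ‖x‖ ≤ max R R' := fun s hs => by
    filter_upwards [hμR s hs] with x hx using hx.trans (le_max_left _ _)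
  replace hνR : ∀ s ∈ Icc 0 P.T, ∀ᵐ x ∂(ν s : Measure (Euc d)), ‖x‖ ≤ max R R' := fun s hs => by
    filter_upwards [hνR s hs] with x hx using hx.trans (le_max_right _ _)
  intro s hs
  refine Metric.tendsto_nhds.2 fun η hη => ?_
  filter_upwards [h.eventually_close hs (κ := η / 4) (by positivity),
    h'.eventually_close hs (κ := η / 4) (by positivity), self_mem_nhdsWithin] with r hr hr' hrT
  have key : ∀ φ : Euc d → ℝ, LipschitzWith 1 φ →
      |(∫ x, mollify hε φ x ∂(μ r : Measure (Euc d)) - ∫ x, mollify hε φ x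
        ∂(ν r : Measure (Euc d))) - (∫ x, mollify hε φ x ∂(μ s : Measure (Euc d))
        - ∫ x, mollify hε φ x ∂(ν s : Measure (Euc d)))| ≤ η / 2 := by
    intro φ hφ
    have hl := lipschitzWith_mollify hε hφ
    have h1 := norm_integral_sub_le_of_W1_lt hr.1 hl
      (integrable_of_ae_norm_le (hμR r hrT) hl.continuous)
      (integrable_of_ae_norm_le (hμR s hs) hl.continuous)
    have h2 := norm_integral_sub_le_of_W1_lt hr'.1 hl
      (integrable_of_ae_norm_le (hνR r hrT) hl.continuous)
      (integrable_of_ae_norm_le (hνR s hs) hl.continuous)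
    rw [Real.norm_eq_abs, NNReal.coe_one, one_mul, abs_le] at h1 h2
    rw [abs_le]
    constructor <;> linarith [h1.1, h1.2, h2.1, h2.2]
  have a1 : mollDist hε (μ r) (ν r) ≤ mollDist hε (μ s) (ν s) + η / 2 :=
    mollDist_le hε fun φ hφ => by
      have := le_mollDist hε (hμR s hs) (hνR s hs) hφ
      linarith [(abs_le.1 (key φ hφ)).2]
  have a2 : mollDist hε (μ s) (ν s) ≤ mollDist hε (μ r) (ν r) + η / 2 :=
    mollDist_le hε fun φ hφ => by
      have := le_mollDist hε (hμR r hrT) (hνR r hrT) hφ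
      linarith [(abs_le.1 (key φ hφ)).1]
  rw [Real.dist_eq, abs_lt]
  constructor <;> linarith

/-- **Dobrushin's stability estimate** for weak solutions of the coupled system. -/
theorem stability (h : P.IsMeanFieldSolution u y₀ μ₀ y μ)
    (h' : P.IsMeanFieldSolution v y₀ ν₀ z ν) (hP : P.IsTame L)
    (hu : P.IsControl u) (hv : P.IsControl v) {β D₀ : ℝ} (hβ0 : 0 ≤ β)
    (hβ : ∀ t ∈ Icc 0 P.T, ∀ k, ‖(∫ s in (0 : ℝ)..t, Matrix.toEuclideanLin (P.B k) (u s))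
      - ∫ s in (0 : ℝ)..t, Matrix.toEuclideanLin (P.B k) (v s)‖ ≤ β)
    (h0 : KRBound D₀ μ₀ ν₀) {t : ℝ} (ht : t ∈ Icc 0 P.T) :
    KRBound ((D₀ + β) * Real.exp (4 * L * P.T)) (μ t) (ν t) ∧
      ‖y t - z t‖ ≤ (D₀ + β) * Real.exp (4 * L * P.T) := by
  have hT : 0 ≤ P.T := ht.1.trans ht.2
  have h00 : (0 : ℝ) ∈ Icc 0 P.T := ⟨le_rfl, hT⟩
  obtain ⟨R, -, hμR⟩ := h.exists_ae_norm_le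
  obtain ⟨R', -, hνR⟩ := h'.exists_ae_norm_le
  replace hμR : ∀ s ∈ Icc 0 P.T, ∀ᵐ x ∂(μ s : Measure (Euc d)), ‖x‖ ≤ max R R' := fun s hs => by
    filter_upwards [hμR s hs] with x hx using hx.trans (le_max_left _ _)
  replace hνR : ∀ s ∈ Icc 0 P.T, ∀ᵐ x ∂(ν s : Measure (Euc d)), ‖x‖ ≤ max R R' := fun s hs => by
    filter_upwards [hνR s hs] with x hx using hx.trans (le_max_right _ _)
  have main : ∀ ε : ℝ, 0 < ε →
      KRBound (gronwallBound (D₀ + β) (4 * L) (8 * L * ε) t + 2 * ε) (μ t) (ν t) ∧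
      ‖y t - z t‖ ≤ gronwallBound (D₀ + β) (4 * L) (8 * L * ε) t + 2 * ε := by
    intro ε hε
    set Δ : ℝ → ℝ := fun s => mollDist hε (μ s) (ν s) with hΔ
    have hΔc : ContinuousOn Δ (Icc 0 P.T) := h.continuousOn_mollDist h' hε
    have hΔ0 : ∀ s ∈ Icc 0 P.T, 0 ≤ Δ s := fun s hs => by
      have := le_mollDist hε (hμR s hs) (hνR s hs) (φ := fun _ => 0) (LipschitzWith.const' 0)
      simpa [mollify_apply] using this
    set b : ℝ → ℝ := fun s => L * (Δ s + 2 * ε + 2 * ‖y s - z s‖) with hb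
    have hbc : ContinuousOn b (Icc 0 P.T) :=
      continuousOn_const.mul ((hΔc.add continuousOn_const).add
        (continuousOn_const.mul (h.leaders.1.sub h'.leaders.1).norm))
    -- `H` is a differentiable majorant of the distance of the leaders
    set H : ℝ → ℝ := fun t => β + ∫ s in (0 : ℝ)..t, b s with hH
    have hHd : ∀ s ∈ Icc 0 P.T, HasDerivWithinAt H (b s) (Icc 0 P.T) s := fun s hs =>
      (hasDerivWithinAt_integral_of_continuousOn hT hbc hs).const_add β
    have hKR : ∀ s ∈ Icc 0 P.T, KRBound (Δ s + 2 * ε) (μ s) (ν s) := fun s hs =>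
      krBound_mollDist hε (hμR s hs) (hνR s hs)
    have hb0 : ∀ s ∈ Icc 0 P.T, 0 ≤ b s := fun s hs => by
      have := hΔ0 s hs
      positivity
    have hH0 : ∀ s ∈ Icc 0 P.T, 0 ≤ H s := fun s hs => by
      refine add_nonneg hβ0 (intervalIntegral.integral_nonneg hs.1 fun r hr => hb0 r ?_)
      exact ⟨hr.1, hr.2.trans hs.2⟩
    have hle : ∀ s ∈ Icc 0 P.T, ‖y s - z s‖ ≤ H s := by
      intro s hs
      refine (pi_norm_le_iff_of_nonneg (hH0 s hs)).2 fun k => ?_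
      rw [Pi.sub_apply, h.leader_eq hP hu hs k, h'.leader_eq hP hv hs k]
      have e : ∀ a p q p' q' : Euc d, (a + (p + q)) - (a + (p' + q')) = (q - q') + (p - p') := by
        intros; abel
      rw [e, ← intervalIntegral.integral_sub
        (intervalIntegrable_of_continuousOn (h.continuousOn_leaderDrift hP k) h00 hs)
        (intervalIntegrable_of_continuousOn (h'.continuousOn_leaderDrift hP k) h00 hs)]
      refine (norm_add_le _ _).trans (add_le_add (hβ s hs k) ?_)
      refine intervalIntegral.norm_integral_le_of_norm_le hs.1 (ae_of_all _ fun r hr => ?_)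
        (intervalIntegrable_of_continuousOn hbc h00 hs)
      exact hP.norm_leaderDrift_sub_le (hKR r ⟨hr.1.le, hr.2.trans hs.2⟩) k
    -- only the lower right Dini derivative of `Δ` is controlled, which is enough for Gronwall
    have hg := le_gronwallBound_of_liminf_deriv_right_le (f := fun s => Δ s + H s)
      (f' := fun s => (3 * L * Δ s + L * ‖y s - z s‖ + 6 * L * ε) + b s) (δ := D₀ + β)
      (K := 4 * L) (ε := 8 * L * ε) (a := 0) (b := P.T)
      (hΔc.add fun s hs => (hHd s hs).continuousWithinAt)
      (by
        intro s hs r hr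
        refine Eventually.frequently ?_
        have hs' := Ico_subset_Icc_self hs
        set g := r - ((3 * L * Δ s + L * ‖y s - z s‖ + 6 * L * ε) + b s) with hgdef
        have hg : 0 < g := sub_pos.2 hr
        have h1 : Tendsto (slope H s) (𝓝[>] s) (𝓝 (b s)) :=
          (hasDerivWithinAt_iff_tendsto_slope' (by simp)).1
            ((hHd s hs').mono_of_mem_nhdsWithin (Icc_mem_nhdsGT_of_mem hs))
        filter_upwards [h.eventually_mollDist_le h' hP hε hs (κ := g / 4) (by positivity),
          h1.eventually (gt_mem_nhds (show b s < b s + g / 4 by linarith)),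
          self_mem_nhdsWithin] with τ a1 a2 hτ
        have hδ : 0 < τ - s := sub_pos.2 hτ
        rw [slope_def_field, div_lt_iff₀ hδ] at a2
        rw [inv_mul_lt_iff₀ hδ]
        have : r = g + ((3 * L * Δ s + L * ‖y s - z s‖ + 6 * L * ε) + b s) := by
          rw [hgdef]; ring
        rw [this]
        have a3 : Δ τ ≤ Δ s + (τ - s) * (3 * L * Δ s + L * ‖y s - z s‖ + 6 * L * ε + g / 4) := a1
        nlinarith [mul_pos hδ hg])
      (by
        have : Δ 0 ≤ D₀ := mollDist_le hε fun φ hφ => by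
          rw [h.initial, h'.initial]
          exact h0 _ (lipschitzWith_mollify hε hφ)
        simpa [hH] using this)
      (by
        intro s hs
        have hs' := Ico_subset_Icc_self hs
        have h1 := mul_le_mul_of_nonneg_left (hle s hs') L.coe_nonneg
        have h2 := mul_nonneg L.coe_nonneg (hH0 s hs')
        simp only [hb]
        nlinarith)
      t ht
    rw [sub_zero] at hg
    refine ⟨(hKR t ht).mono ?_, ?_⟩
    · linarith [hH0 t ht]
    · linarith [hle t ht, hΔ0 t ht]
  have hlim : Tendsto (fun ε : ℝ => gronwallBound (D₀ + β) (4 * L) (8 * L * ε) t + 2 * ε)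
      (𝓝[>] 0) (𝓝 ((D₀ + β) * Real.exp (4 * L * t))) := by
    have hc : Continuous (fun ε : ℝ => gronwallBound (D₀ + β) (4 * L) (8 * L * ε) t + 2 * ε) :=
      ((gronwallBound_continuous_ε _ _ _).comp (continuous_const.mul continuous_id)).add
        (continuous_const.mul continuous_id)
    have := (hc.tendsto 0).mono_left (nhdsWithin_le_nhds (s := Ioi 0))
    simpa [gronwallBound_ε0] using this
  have hexp : (D₀ + β) * Real.exp (4 * L * t) ≤ (D₀ + β) * Real.exp (4 * L * P.T) := by
    have := h0.nonneg
    gcongr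
    exact ht.2
  constructor
  · intro φ hφ
    refine le_trans (ge_of_tendsto hlim ?_) hexp
    filter_upwards [self_mem_nhdsWithin] with ε hε using (main ε hε).1 φ hφ
  · refine le_trans (ge_of_tendsto hlim ?_) hexp
    filter_upwards [self_mem_nhdsWithin] with ε hε using (main ε hε).2

end IsMeanFieldSolution

end ControlProblem

/-! ### Lagrangian solutions -/

section law

variable {S : Type*} [TopologicalSpace S] [MeasurableSpace S] [OpensMeasurableSpace S]

/-- The distribution of the followers' positions `X`, when the followers are labelled by the points
of the probability space `(S, σ)`. -/
noncomputable def law (σ : ProbabilityMeasure S) (X : C(S, Euc d)) : ProbabilityMeasure (Euc d) :=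
  σ.map X.continuous.measurable.aemeasurable

variable (σ : ProbabilityMeasure S)

lemma integral_law (X : C(S, Euc d)) {F : Type*} [NormedAddCommGroup F] [NormedSpace ℝ F]
    {h : Euc d → F} (hh : Continuous h) :
    ∫ x, h x ∂(law σ X : Measure (Euc d)) = ∫ s, h (X s) ∂(σ : Measure S) := by
  rw [law, ProbabilityMeasure.toMeasure_map, integral_map X.continuous.measurable.aemeasurable]
  exact hh.aestronglyMeasurable

variable [CompactSpace S]

lemma ae_law_norm_le {X : C(S, Euc d)} {R : ℝ} (hX : ‖X‖ ≤ R) :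
    ∀ᵐ x ∂(law σ X : Measure (Euc d)), ‖x‖ ≤ R := by
  rw [law, ProbabilityMeasure.toMeasure_map, ae_map_iff X.continuous.measurable.aemeasurable
    (measurableSet_le measurable_norm measurable_const)]
  exact Eventually.of_forall fun s => (X.norm_coe_le_norm s).trans hX

lemma support_law_subset {X : C(S, Euc d)} {R : ℝ} (hX : ‖X‖ ≤ R) :
    (law σ X : Measure (Euc d)).support ⊆ Metric.closedBall 0 R := by
  refine Measure.support_subset_of_isClosed Metric.isClosed_closedBall ?_
  filter_upwards [ae_law_norm_le σ hX] with x hx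
  simpa using hx

lemma integrable_comp_continuousMap [SecondCountableTopology S]
    {F : Type*} [NormedAddCommGroup F] {h : Euc d → F}
    (hh : Continuous h) (X : C(S, Euc d)) : Integrable (fun s => h (X s)) (σ : Measure S) :=
  Integrable.of_bound (hh.comp X.continuous).aestronglyMeasurable
    ‖(⟨fun s => h (X s), hh.comp X.continuous⟩ : C(S, F))‖ (Eventually.of_forall fun s =>
      ContinuousMap.norm_coe_le_norm (⟨fun s => h (X s), hh.comp X.continuous⟩ : C(S, F)) s)

lemma krBound_law [SecondCountableTopology S] (X Y : C(S, Euc d)) :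
    KRBound ‖X - Y‖ (law σ X) (law σ Y) := fun φ hφ => by
  rw [integral_law σ X hφ.continuous, integral_law σ Y hφ.continuous,
    ← integral_sub (integrable_comp_continuousMap σ hφ.continuous X)
      (integrable_comp_continuousMap σ hφ.continuous Y)]
  have := norm_integral_le_of_norm_le_const (μ := (σ : Measure S))
    (f := fun s => φ (X s) - φ (Y s)) (C := ‖X - Y‖) (Eventually.of_forall fun s => by
      rw [← dist_eq_norm]
      refine (hφ.dist_le_mul _ _).trans ?_
      rw [NNReal.coe_one, one_mul, dist_eq_norm]
      exact (X - Y).norm_coe_le_norm s)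
  simpa using (le_abs_self _).trans this

lemma W1_law_le (X Y : C(S, Euc d)) : W1 (law σ X) (law σ Y) ≤ ENNReal.ofReal ‖X - Y‖ := by
  have hX := X.continuous.measurable
  have hY := Y.continuous.measurable
  refine (iInf₂_le ((σ : Measure S).map fun s => (X s, Y s))
    (by rw [Measure.map_map measurable_fst (hX.prodMk hY)]; rfl)).trans
    ((iInf_le _ (by rw [Measure.map_map measurable_snd (hX.prodMk hY)]; rfl)).trans ?_)
  rw [lintegral_map (measurable_fst.edist measurable_snd) (hX.prodMk hY)]
  calc ∫⁻ s, edist (X s) (Y s) ∂(σ : Measure S)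
      ≤ ∫⁻ _, ENNReal.ofReal ‖X - Y‖ ∂(σ : Measure S) := by
        refine lintegral_mono fun s => ?_
        rw [edist_dist, dist_eq_norm]
        exact ENNReal.ofReal_le_ofReal ((X - Y).norm_coe_le_norm s)
    _ = ENNReal.ofReal ‖X - Y‖ := by simp

end law

namespace ControlProblem

variable {S : Type*} [TopologicalSpace S] [MeasurableSpace S] [OpensMeasurableSpace S]
  [CompactSpace S] {P : ControlProblem d D m} {L : ℝ≥0}

/-- The mean-field system in Lagrangian coordinates: the followers are labelled by the points of a
compact probability space `(S, σ)`, and `X t s` is the position at time `t` of the follower with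
label `s`. For finite `S` this is the particle system. -/
structure IsLagrangianSolution (P : ControlProblem d D m) (σ : ProbabilityMeasure S)
    (u : ℝ → Euc D) (y₀ : Fin m → Euc d) (X₀ : C(S, Euc d)) (y : ℝ → Fin m → Euc d)
    (X : ℝ → C(S, Euc d)) : Prop where
  leaders : P.SolvesLeaderODE u y₀ y (fun t => law σ (X t))
  initial : X 0 = X₀
  continuousOn : ContinuousOn X (Icc 0 P.T)
  followers : ∀ t ∈ Icc 0 P.T, ∀ s, HasDerivWithinAt (fun r => X r s)
    (P.followerVelocity (y t) (law σ (X t)) (X t s)) (Icc 0 P.T) t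

/-- The drift of the mean-field system in Lagrangian coordinates. -/
noncomputable def lagrangianField (hP : P.IsTame L) (σ : ProbabilityMeasure S)
    (p : (Fin m → Euc d) × C(S, Euc d)) : (Fin m → Euc d) × C(S, Euc d) :=
  (fun k => conv P.K (law σ p.2) (p.1 k) + P.f k p.1,
    ⟨fun s => P.followerVelocity p.1 (law σ p.2) (p.2 s),
      (hP.lipschitzWith_followerVelocity p.1 (law σ p.2)).continuous.comp p.2.continuous⟩)

lemma norm_lagrangianField_le (hP : P.IsTame L) (σ : ProbabilityMeasure S)
    (p : (Fin m → Euc d) × C(S, Euc d)) : ‖lagrangianField hP σ p‖ ≤ 2 * L := by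
  refine max_le ((pi_norm_le_iff_of_nonneg (by positivity)).2 fun k => ?_)
    ((ContinuousMap.norm_le _ (by positivity)).2 fun s => hP.norm_followerVelocity_le _ _ _)
  refine (norm_add_le _ _).trans ?_
  have := hP.norm_conv_le (law σ p.2) (p.1 k)
  have := hP.f_le k p.1
  linarith

lemma lipschitzWith_lagrangianField [SecondCountableTopology S] (hP : P.IsTame L)
    (σ : ProbabilityMeasure S) : LipschitzWith (4 * L) (lagrangianField hP σ) := by
  refine LipschitzWith.of_dist_le_mul fun p q => ?_
  have hKR := krBound_law σ p.2 q.2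
  have h1 : ‖p.1 - q.1‖ ≤ dist p q := by rw [← dist_eq_norm]; exact le_max_left _ _
  have h2 : ‖p.2 - q.2‖ ≤ dist p q := by rw [← dist_eq_norm]; exact le_max_right _ _
  have hL := L.coe_nonneg
  have hd : 0 ≤ dist p q := dist_nonneg
  rw [dist_eq_norm, NNReal.coe_mul]
  refine max_le ((pi_norm_le_iff_of_nonneg (by positivity)).2 fun k => ?_)
    ((ContinuousMap.norm_le _ (by positivity)).2 fun s => ?_)
  · refine (hP.norm_leaderDrift_sub_le hKR k).trans ?_
    push_cast
    nlinarith
  · change ‖P.followerVelocity p.1 (law σ p.2) (p.2 s)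
      - P.followerVelocity q.1 (law σ q.2) (q.2 s)‖ ≤ _
    have e1 := hP.norm_followerVelocity_sub_le (y := p.1) (z := q.1)
      (hP.norm_conv_sub_le hKR (p.2 s))
    have e2 := (hP.lipschitzWith_followerVelocity q.1 (law σ q.2)).dist_le_mul (p.2 s) (q.2 s)
    have e3 : dist (p.2 s) (q.2 s) ≤ dist p q := by
      rw [dist_eq_norm]; exact ((p.2 - q.2).norm_coe_le_norm s).trans h2
    have e4 := norm_sub_le_norm_sub_add_norm_sub (P.followerVelocity p.1 (law σ p.2) (p.2 s))
      (P.followerVelocity q.1 (law σ q.2) (p.2 s)) (P.followerVelocity q.1 (law σ q.2) (q.2 s))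
    rw [dist_eq_norm (P.followerVelocity _ _ _)] at e2
    push_cast at e2 ⊢
    nlinarith

lemma eq_add_integral_of_hasDerivWithinAt {E : Type*} [NormedAddCommGroup E] [NormedSpace ℝ E]
    [CompleteSpace E] {T : ℝ} {f f' : ℝ → E}
    (hf : ∀ t ∈ Icc 0 T, HasDerivWithinAt f (f' t) (Icc 0 T) t) (hf' : ContinuousOn f' (Icc 0 T))
    {t : ℝ} (ht : t ∈ Icc 0 T) : f t = f 0 + ∫ s in (0 : ℝ)..t, f' s := by
  have hsub : Icc 0 t ⊆ Icc 0 T := Icc_subset_Icc_right ht.2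
  rw [intervalIntegral.integral_eq_sub_of_hasDerivAt_of_le ht.1
    (fun s hs => ((hf s (hsub hs)).continuousWithinAt.mono hsub))
    (fun s hs => (hf s (hsub (Ioo_subset_Icc_self hs))).hasDerivAt
      (Icc_mem_nhds hs.1 (hs.2.trans_le ht.2)))
    (intervalIntegrable_of_continuousOn hf' ⟨le_rfl, ht.1.trans ht.2⟩ ht)]
  abel

/-- Existence of Lagrangian solutions. Subtracting the primitive of the control term from the
leaders' positions turns the system into an ODE with continuous right-hand side in the Banach
space `(ℝᵈ)ᵐ × C(S, ℝᵈ)`. -/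
theorem exists_isLagrangianSolution [SecondCountableTopology S] (hP : P.IsTame L) (hT : 0 < P.T)
    {u : ℝ → Euc D} (hu : P.IsControl u) (σ : ProbabilityMeasure S) (y₀ : Fin m → Euc d)
    (X₀ : C(S, Euc d)) : ∃ y X, P.IsLagrangianSolution σ u y₀ X₀ y X := by
  have h0 : (0 : ℝ) ∈ Icc 0 P.T := ⟨le_rfl, hT.le⟩
  have hT' : P.T ∈ Icc 0 P.T := ⟨hT.le, le_rfl⟩
  set b : ℝ → Fin m → Euc d := fun t k =>
    ∫ s in (0 : ℝ)..t, Matrix.toEuclideanLin (P.B k) (u s) with hb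
  have hbc : ContinuousOn b (Icc 0 P.T) := continuousOn_pi.2 fun k => by
    have := intervalIntegral.continuousOn_primitive_interval' (hu.intervalIntegrable k h0 hT')
      (left_mem_uIcc)
    rwa [uIcc_of_le hT.le] at this
  set G := lagrangianField hP σ
  have hG := lipschitzWith_lagrangianField hP σ
  have hpl : IsPicardLindelof (fun t p => G (p + (b t, 0))) (tmin := 0) (tmax := P.T) ⟨0, h0⟩
      (y₀, X₀) (2 * L * P.T.toNNReal) 0 (2 * L) (4 * L) := by
    refine ⟨fun t _ => LipschitzWith.lipschitzOnWith ?_, fun p _ => ?_, fun t _ p _ => ?_, ?_⟩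
    · refine LipschitzWith.of_dist_le_mul fun p q => ?_
      have := hG.dist_le_mul (p + (b t, 0)) (q + (b t, 0))
      rwa [dist_add_right] at this
    · exact hG.continuous.comp_continuousOn
        (continuousOn_const.add (hbc.prodMk continuousOn_const))
    · exact norm_lagrangianField_le hP σ _
    · simp [hT.le]
  obtain ⟨α, hα0, hα⟩ := hpl.exists_eq_forall_mem_Icc_hasDerivWithinAt₀
  have hαc : ContinuousOn α (Icc 0 P.T) := fun t ht => (hα t ht).continuousWithinAt
  have hpc : ContinuousOn (fun t => α t + (b t, (0 : C(S, Euc d)))) (Icc 0 P.T) :=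
    hαc.add (hbc.prodMk continuousOn_const)
  have hGc : ContinuousOn (fun t => G (α t + (b t, 0))) (Icc 0 P.T) :=
    hG.continuous.comp_continuousOn hpc
  refine ⟨fun t => (α t).1 + b t, fun t => (α t).2, ⟨?_, fun t ht k => ?_⟩, ?_, ?_, ?_⟩
  · exact (continuous_fst.comp_continuousOn hαc).add hbc
  · have h1 : ∀ t ∈ Icc 0 P.T, HasDerivWithinAt (fun t => (α t).1 k)
        ((G (α t + (b t, 0))).1 k) (Icc 0 P.T) t := fun t ht =>
      hasDerivWithinAt_pi.1 (hα t ht).fst k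
    have h2 := eq_add_integral_of_hasDerivWithinAt h1
      (((continuous_apply k).comp continuous_fst).comp_continuousOn hGc) ht
    have h3 : (α 0).1 k = y₀ k := by rw [show α 0 = (y₀, X₀) from hα0]
    change (α t).1 k + b t k = _
    rw [h2, h3, add_assoc]
    congr 1
    have hi : IntervalIntegrable (fun s => (G (α s + (b s, 0))).1 k) volume 0 t :=
      intervalIntegrable_of_continuousOn
        (((continuous_apply k).comp continuous_fst).comp_continuousOn hGc) h0 ht
    refine (intervalIntegral.integral_add hi (hu.intervalIntegrable k h0 ht)).symm.trans ?_
    refine intervalIntegral.integral_congr fun s _ => ?_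
    simp [G, lagrangianField, leaderVelocity]
  · rw [show α 0 = (y₀, X₀) from hα0]
  · exact continuous_snd.comp_continuousOn hαc
  · intro t ht s
    have h1 := (hα t ht).snd
    have h2 := (ContinuousMap.evalCLM ℝ s).hasFDerivAt.comp_hasDerivWithinAt t h1
    simpa [G, lagrangianField, Function.comp_def] using h2

/-- The distribution of a Lagrangian solution solves the continuity equation. -/
theorem IsLagrangianSolution.isMeanFieldSolution [SecondCountableTopology S] (hP : P.IsTame L)
    {u : ℝ → Euc D} {σ : ProbabilityMeasure S} {y₀ : Fin m → Euc d}
    {X₀ : C(S, Euc d)} {y : ℝ → Fin m → Euc d} {X : ℝ → C(S, Euc d)}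
    (h : P.IsLagrangianSolution σ u y₀ X₀ y X) :
    P.IsMeanFieldSolution u y₀ (law σ X₀) y (fun t => law σ (X t)) where
  leaders := h.leaders
  initial := by rw [h.initial]
  support_bounded := by
    obtain ⟨R, hR⟩ := isCompact_Icc.exists_bound_of_continuousOn h.continuousOn
    refine ⟨max R 0 + 1, by positivity, fun t ht => (support_law_subset σ (hR t ht)).trans ?_⟩
    exact Metric.closedBall_subset_ball (by linarith [le_max_left R 0])
  continuous_W1 := fun t ht => by
    have h1 : Tendsto (fun s => ENNReal.ofReal ‖X s - X t‖) (𝓝[Icc 0 P.T] t) (𝓝 0) := by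
      have := ENNReal.tendsto_ofReal ((h.continuousOn t ht).sub_const (X t)).norm
      simpa using this
    exact tendsto_of_tendsto_of_tendsto_of_le_of_le tendsto_const_nhds h1
      (fun _ => zero_le) (fun s => W1_law_le σ (X s) (X t))
  continuity_equation := fun φ hφ hφc t ht => by
    have hφ1 : Continuous (fderiv ℝ φ) := hφ.continuous_fderiv (by simp)
    have hφd : Differentiable ℝ φ := hφ.differentiable (by simp)
    obtain ⟨C, hC⟩ := (hφ.of_le (m := 1) (by norm_cast)).lipschitzWith_of_hasCompactSupport
      (𝕂 := ℝ) hφc one_ne_zero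
    have hvc : ∀ t, Continuous (P.followerVelocity (y t) (law σ (X t))) := fun t =>
      (hP.lipschitzWith_followerVelocity _ _).continuous
    rw [integral_law σ (X t) (by simp_rw [inner_gradient_left]; exact hφ1.clm_apply (hvc t))]
    simp_rw [inner_gradient_left, integral_law σ _ hφ.continuous]
    have hpt : ∀ s : S, HasDerivWithinAt (fun r => φ (X r s)) (fderiv ℝ φ (X t s)
        (P.followerVelocity (y t) (law σ (X t)) (X t s))) (Icc 0 P.T) t := fun s =>
      (hφd (X t s)).hasFDerivAt.comp_hasDerivWithinAt t (h.followers t ht s)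
    have hlip : ∀ s : S, ∀ r ∈ Icc 0 P.T, ‖X r s - X t s‖ ≤ 2 * L * ‖r - t‖ := fun s r hr =>
      (convex_Icc 0 P.T).norm_image_sub_le_of_norm_hasDerivWithin_le
        (fun q hq => h.followers q hq s) (fun q _ => hP.norm_followerVelocity_le _ _ _) ht hr
    refine hasDerivWithinAt_iff_tendsto_slope.2 ?_
    have hslope : slope (fun r => ∫ s, φ (X r s) ∂(σ : Measure S)) t
        = fun r => ∫ s, slope (fun r => φ (X r s)) t r ∂(σ : Measure S) := by
      funext r
      simp only [slope_def_field]
      rw [integral_div, integral_sub (integrable_comp_continuousMap σ hφ.continuous _)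
        (integrable_comp_continuousMap σ hφ.continuous _)]
    rw [hslope]
    refine tendsto_integral_filter_of_dominated_convergence (fun _ => C * (2 * L)) ?_ ?_
      (integrable_const _) (Eventually.of_forall fun s =>
        hasDerivWithinAt_iff_tendsto_slope.1 (hpt s))
    · refine Eventually.of_forall fun r => ?_
      simp only [slope_def_field]
      exact (((hφ.continuous.comp (X r).continuous).sub
        (hφ.continuous.comp (X t).continuous)).div_const _).aestronglyMeasurable
    · filter_upwards [self_mem_nhdsWithin] with r hr
      refine Eventually.of_forall fun s => ?_
      have hne : r - t ≠ 0 := sub_ne_zero.2 hr.2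
      rw [slope_def_field, norm_div, div_le_iff₀ (norm_pos_iff.2 hne), ← dist_eq_norm]
      refine (hC.dist_le_mul _ _).trans ?_
      rw [mul_assoc, dist_eq_norm]
      gcongr
      exact hlip s r hr.1

end ControlProblem

/-! ### A priori bounds -/

/-- The chain rule for the square of the norm along a curve with bounded derivative: the error of
the first order expansion of `‖z‖²` on `[s, t]` is of order `(t - s)²`. -/
lemma norm_sq_eq_add_integral {E : Type*} [NormedAddCommGroup E] [InnerProductSpace ℝ E]
    [CompleteSpace E] {T : ℝ} {z p : ℝ → E} {z₀ : E} {C : ℝ} (hp : IntegrableOn p (Icc 0 T))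
    (hpC : ∀ᵐ s ∂volume.restrict (Icc 0 T), ‖p s‖ ≤ C)
    (hz : ∀ t ∈ Icc 0 T, z t = z₀ + ∫ s in (0 : ℝ)..t, p s) {t : ℝ} (ht : t ∈ Icc 0 T) :
    IntegrableOn (fun s => inner ℝ (z s) (p s)) (Icc 0 T) ∧
    ‖z t‖ ^ 2 = ‖z₀‖ ^ 2 + 2 * ∫ s in (0 : ℝ)..t, inner ℝ (z s) (p s) := by
  have hT : 0 ≤ T := ht.1.trans ht.2
  have h00 : (0 : ℝ) ∈ Icc 0 T := ⟨le_rfl, hT⟩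
  have hpi : ∀ {s t}, s ∈ Icc 0 T → t ∈ Icc 0 T → IntervalIntegrable p volume s t :=
    fun hs ht => (hp.mono_set (uIcc_subset_Icc hs ht)).intervalIntegrable
  have hae : ∀ {s t}, s ∈ Icc 0 T → t ∈ Icc 0 T → ∀ᵐ r, r ∈ Ioc s t → ‖p r‖ ≤ C := by
    intro s t hs ht
    have := (ae_restrict_iff' measurableSet_Icc).1 hpC
    filter_upwards [this] with r hr hrs
    exact hr ⟨hs.1.trans hrs.1.le, hrs.2.trans ht.2⟩
  have hsub : ∀ {s t}, s ∈ Icc 0 T → t ∈ Icc 0 T → z t - z s = ∫ r in s..t, p r := by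
    intro s t hs ht
    rw [hz t ht, hz s hs, add_sub_add_left_eq_sub,
      intervalIntegral.integral_interval_sub_left (hpi h00 ht) (hpi h00 hs)]
  have hlip : ∀ {s t}, s ∈ Icc 0 T → t ∈ Icc 0 T → s ≤ t → ‖z t - z s‖ ≤ C * (t - s) := by
    intro s t hs ht hst
    rw [hsub hs ht]
    have := intervalIntegral.norm_integral_le_of_norm_le_const_ae (f := p) (a := s) (b := t)
      (C := C) (by rw [uIoc_of_le hst]; exact hae hs ht)
    rwa [abs_of_nonneg (sub_nonneg.2 hst)] at this
  have hzc : ContinuousOn z (Icc 0 T) := by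
    have := intervalIntegral.continuousOn_primitive_interval' (hpi h00 ⟨hT, le_rfl⟩) left_mem_uIcc
    rw [uIcc_of_le hT] at this
    exact (continuousOn_const.add this).congr hz
  obtain ⟨Z, hZ⟩ := isCompact_Icc.exists_bound_of_continuousOn hzc
  have hint : IntegrableOn (fun s => inner ℝ (z s) (p s)) (Icc 0 T) := by
    refine Integrable.of_bound ((hzc.aestronglyMeasurable measurableSet_Icc).inner hp.1)
      (Z * C) ?_
    filter_upwards [hpC, ae_restrict_mem measurableSet_Icc] with s h1 h2
    refine (norm_inner_le_norm _ _).trans ?_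
    exact mul_le_mul (hZ s h2) h1 (norm_nonneg _) ((norm_nonneg _).trans (hZ s h2))
  refine ⟨hint, ?_⟩
  have hii : ∀ {s t}, s ∈ Icc 0 T → t ∈ Icc 0 T →
      IntervalIntegrable (fun s => inner ℝ (z s) (p s)) volume s t :=
    fun hs ht => (hint.mono_set (uIcc_subset_Icc hs ht)).intervalIntegrable
  -- `|G t - G s| ≤ 3 C² (t - s)²`, so that `G` has derivative zero
  set G : ℝ → ℝ := fun t => ‖z t‖ ^ 2 - 2 * ∫ s in (0 : ℝ)..t, inner ℝ (z s) (p s) with hG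
  have hGle : ∀ {s t}, s ∈ Icc 0 T → t ∈ Icc 0 T → s ≤ t →
      |G t - G s| ≤ 3 * C ^ 2 * (t - s) ^ 2 := by
    intro s t hs ht hst
    have e1 : G t - G s = ‖z t - z s‖ ^ 2 + 2 * ∫ r in s..t, inner ℝ (z s - z r) (p r) := by
      have i1 : (∫ r in (0 : ℝ)..t, inner ℝ (z r) (p r)) - ∫ r in (0 : ℝ)..s, inner ℝ (z r) (p r)
          = ∫ r in s..t, inner ℝ (z r) (p r) :=
        intervalIntegral.integral_interval_sub_left (hii h00 ht) (hii h00 hs)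
      have i2 : ∫ r in s..t, inner ℝ (z s - z r) (p r)
          = inner ℝ (z s) (z t - z s) - ∫ r in s..t, inner ℝ (z r) (p r) := by
        simp_rw [inner_sub_left]
        have i3 : IntervalIntegrable (fun r => inner ℝ (z s) (p r)) volume s t :=
          ⟨(hpi hs ht).1.const_inner _, (hpi hs ht).2.const_inner _⟩
        rw [intervalIntegral.integral_sub i3 (hii hs ht), hsub hs ht]
        congr 1
        rw [intervalIntegral.integral_of_le hst, intervalIntegral.integral_of_le hst,
          integral_inner (hpi hs ht).1]
      have i4 : ‖z t‖ ^ 2 = ‖z s‖ ^ 2 + 2 * inner ℝ (z s) (z t - z s) + ‖z t - z s‖ ^ 2 := by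
        rw [← norm_add_sq_real, add_sub_cancel]
      rw [i2, ← i1, hG]
      dsimp only
      rw [i4]
      ring
    have e2 : ‖∫ r in s..t, inner ℝ (z s - z r) (p r)‖ ≤ C ^ 2 * (t - s) * |t - s| := by
      refine intervalIntegral.norm_integral_le_of_norm_le_const_ae ?_
      rw [uIoc_of_le hst]
      filter_upwards [hae hs ht] with r hr hrs
      have hC : 0 ≤ C := (norm_nonneg _).trans (hr hrs)
      refine (norm_inner_le_norm _ _).trans ?_
      have h1 : ‖z s - z r‖ ≤ C * (t - s) := by
        rw [norm_sub_rev]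
        refine (hlip hs ⟨hs.1.trans hrs.1.le, hrs.2.trans ht.2⟩ hrs.1.le).trans ?_
        gcongr
        exact hrs.2
      calc ‖z s - z r‖ * ‖p r‖ ≤ C * (t - s) * C :=
            mul_le_mul h1 (hr hrs) (norm_nonneg _) ((norm_nonneg _).trans h1)
        _ = C ^ 2 * (t - s) := by ring
    rw [abs_of_nonneg (sub_nonneg.2 hst), Real.norm_eq_abs] at e2
    have e3 : ‖z t - z s‖ ^ 2 ≤ (C * (t - s)) ^ 2 :=
      pow_le_pow_left₀ (norm_nonneg _) (hlip hs ht hst) 2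
    rw [e1]
    refine (abs_add_le _ _).trans ?_
    rw [abs_of_nonneg (by positivity), abs_mul, abs_two]
    nlinarith
  have hGd : ∀ s ∈ Icc 0 T, HasDerivWithinAt G 0 (Icc 0 T) s := by
    intro s hs
    rw [hasDerivWithinAt_iff_isLittleO]
    have h1 : (fun r => G r - G s - (r - s) • (0 : ℝ)) =O[𝓝[Icc 0 T] s]
        fun r => ‖r - s‖ ^ 2 := by
      refine Asymptotics.IsBigO.of_bound (3 * C ^ 2) ?_
      filter_upwards [self_mem_nhdsWithin] with r hr
      rw [smul_zero, sub_zero, norm_pow, norm_norm, Real.norm_eq_abs, Real.norm_eq_abs, sq_abs]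
      rcases le_total s r with h | h
      · exact hGle hs hr h
      · rw [abs_sub_comm, ← neg_sub s r, neg_sq]
        exact hGle hr hs h
    exact h1.trans_isLittleO ((Asymptotics.isLittleO_pow_sub_sub s one_lt_two).mono
      nhdsWithin_le_nhds)
  rcases hT.eq_or_lt with rfl | hT'
  · obtain rfl : t = 0 := le_antisymm ht.2 ht.1
    rw [hz 0 h00]
    simp
  have hconst := constant_of_derivWithin_zero (fun s hs => (hGd s hs).differentiableWithinAt)
    (fun s hs => (hGd s (Ico_subset_Icc_self hs)).derivWithin
      (uniqueDiffOn_Icc hT' s (Ico_subset_Icc_self hs))) t ht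
  have hz0 : z 0 = z₀ := by rw [hz 0 h00]; simp
  simp only [hG, intervalIntegral.integral_same, hz0, mul_zero, sub_zero] at hconst
  linarith

/-- Integral form of Gronwall's inequality. -/
lemma le_gronwallBound_of_le_integral {T a K : ℝ} (hK : 0 ≤ K) {F : ℝ → ℝ}
    (hF : ContinuousOn F (Icc 0 T))
    (h : ∀ t ∈ Icc 0 T, F t ≤ a + ∫ s in (0 : ℝ)..t, K * (1 + F s)) {t : ℝ} (ht : t ∈ Icc 0 T) :
    F t ≤ gronwallBound a K K t := by
  have hT : 0 ≤ T := ht.1.trans ht.2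
  have hd : ∀ s ∈ Icc 0 T, HasDerivWithinAt (fun t => a + ∫ s in (0 : ℝ)..t, K * (1 + F s))
      (K * (1 + F s)) (Icc 0 T) s := fun s hs =>
    (hasDerivWithinAt_integral_of_continuousOn hT
      (continuousOn_const.mul (continuousOn_const.add hF)) hs).const_add a
  have := le_gronwallBound_of_liminf_deriv_right_le (a := 0) (b := T) (δ := a) (K := K) (ε := K)
    (f' := fun s => K * (1 + F s))
    (fun s hs => (hd s hs).continuousWithinAt)
    (fun s hs r hr => by
      refine Eventually.frequently ?_
      have h1 := (hasDerivWithinAt_iff_tendsto_slope' (by simp)).1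
        ((hd s (Ico_subset_Icc_self hs)).mono_of_mem_nhdsWithin (Icc_mem_nhdsGT_of_mem hs))
      filter_upwards [h1.eventually (gt_mem_nhds hr)] with q hq
      rwa [slope_def_field, div_eq_inv_mul] at hq)
    (by simp)
    (fun s hs => by
      have := mul_le_mul_of_nonneg_left (h s (Ico_subset_Icc_self hs)) hK
      linarith) t ht
  rw [sub_zero] at this
  exact (h t ht).trans this

namespace ControlProblem

variable {S : Type*} [TopologicalSpace S] [MeasurableSpace S] [OpensMeasurableSpace S]
  [CompactSpace S] {P : ControlProblem d D m} {L : ℝ≥0}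

/-- The growth conditions on the data, with a single constant `A`. -/
structure HasGrowth (P : ControlProblem d D m) (A : ℝ) : Prop where
  nonneg : 0 ≤ A
  K_le : ∀ x, ‖P.K x‖ ≤ A * (1 + ‖x‖)
  g_le : ∀ y x, inner ℝ (P.g y x) x ≤ A * (1 + ‖x‖ ^ 2 + ‖y‖ ^ 2)
  f_le : ∀ k y, inner ℝ (P.f k y) (y k) ≤ A * (1 + ‖y‖ ^ 2)
  B_le : ∀ k, ∀ u ∈ P.U, ‖Matrix.toEuclideanLin (P.B k) u‖ ≤ A

/-- The bound for the square of the norm of the state at time `T` given by Gronwall's inequality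
from the growth constant `A` and the size `r` of the initial datum. -/
noncomputable def aprioriBound (A T r : ℝ) : ℝ := gronwallBound (r ^ 2) (10 * A) (10 * A) T

lemma norm_conv_law_le {A : ℝ} (hA : P.HasGrowth A) (σ : ProbabilityMeasure S)
    (X : C(S, Euc d)) (hP : P.IsTame L) {N : ℝ} (hX : ‖X‖ ≤ N) {x : Euc d} (hx : ‖x‖ ≤ N) :
    ‖conv P.K (law σ X) x‖ ≤ A * (1 + 2 * N) := by
  rw [conv, integral_law σ X (h := fun x' => P.K (x - x')) (hP.lipschitzWith_K_sub x).continuous]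
  have := norm_integral_le_of_norm_le_const (μ := (σ : Measure S))
    (f := fun s => P.K (x - X s)) (C := A * (1 + 2 * N)) (Eventually.of_forall fun s => by
      refine (hA.K_le _).trans (mul_le_mul_of_nonneg_left ?_ hA.nonneg)
      have h1 := norm_sub_le x (X s)
      have h2 := (X.norm_coe_le_norm s).trans hX
      linarith)
  simpa using this

lemma continuousOn_followerVelocity_law [SecondCountableTopology S] (hP : P.IsTame L)
    (σ : ProbabilityMeasure S) {y : ℝ → Fin m → Euc d} {X : ℝ → C(S, Euc d)} {I : Set ℝ}
    (hy : ContinuousOn y I) (hX : ContinuousOn X I) (s : S) :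
    ContinuousOn (fun t => P.followerVelocity (y t) (law σ (X t)) (X t s)) I := by
  have : ContinuousOn (fun t => (lagrangianField hP σ (y t, X t)).2 s) I :=
    (ContinuousEvalConst.continuous_eval_const s).comp_continuousOn
      (continuous_snd.comp_continuousOn
        ((lipschitzWith_lagrangianField hP σ).continuous.comp_continuousOn (hy.prodMk hX)))
  exact this

/-- The a priori bound: it does not depend on the label space, on the control or on `L`. -/
theorem IsLagrangianSolution.norm_sq_le [SecondCountableTopology S] (hP : P.IsTame L) {A : ℝ}
    (hA : P.HasGrowth A) {u : ℝ → Euc D} (hu : P.IsControl u)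
    {σ : ProbabilityMeasure S} {y₀ : Fin m → Euc d}
    {X₀ : C(S, Euc d)} {y : ℝ → Fin m → Euc d} {X : ℝ → C(S, Euc d)}
    (h : P.IsLagrangianSolution σ u y₀ X₀ y X) {r : ℝ} (hy₀ : ‖y₀‖ ≤ r) (hX₀ : ‖X₀‖ ≤ r)
    {t : ℝ} (ht : t ∈ Icc 0 P.T) :
    ‖y t‖ ^ 2 ≤ aprioriBound A P.T r ∧ ‖X t‖ ^ 2 ≤ aprioriBound A P.T r := by
  have hT : 0 ≤ P.T := ht.1.trans ht.2
  have h00 : (0 : ℝ) ∈ Icc 0 P.T := ⟨le_rfl, hT⟩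
  have hmf := h.isMeanFieldSolution hP
  set N : ℝ → ℝ := fun t => ‖(y t, X t)‖ with hN
  have hNc : ContinuousOn N (Icc 0 P.T) := (h.leaders.1.prodMk h.continuousOn).norm
  have hyN : ∀ t, ‖y t‖ ≤ N t := fun t => le_max_left _ _
  have hXN : ∀ t, ‖X t‖ ≤ N t := fun t => le_max_right _ _
  have hN0 : ∀ t, 0 ≤ N t := fun t => norm_nonneg _
  have hNc2 : ContinuousOn (fun s => 5 * A * (1 + N s ^ 2)) (Icc 0 P.T) :=
    continuousOn_const.mul (continuousOn_const.add (hNc.pow 2))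
  have hae : ∀ᵐ s ∂volume.restrict (Icc 0 P.T), s ∈ Icc 0 P.T ∧ u s ∈ P.U :=
    (ae_restrict_mem measurableSet_Icc).and hu.2
  have hr2 : ∀ {F : Type _} [NormedAddCommGroup F] {a : F}, ‖a‖ ≤ r → ‖a‖ ^ 2 ≤ r ^ 2 :=
    fun ha => pow_le_pow_left₀ (norm_nonneg _) ha 2
  have hA0 := hA.nonneg
  -- leaders and followers are treated alike; their velocities satisfy `⟪z, p⟫ ≤ 5 A (1 + N²)`,
  -- since `N A (1 + 2 N)` bounds the interaction, `A (1 + 2 N²)` the drift and `N A` the control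
  have key : ∀ {p z : ℝ → Euc d} {z₀ : Euc d} {C : ℝ}, IntegrableOn p (Icc 0 P.T) →
      (∀ᵐ s ∂volume.restrict (Icc 0 P.T), ‖p s‖ ≤ C) →
      (∀ t ∈ Icc 0 P.T, z t = z₀ + ∫ s in (0 : ℝ)..t, p s) → ‖z₀‖ ≤ r →
      (∀ᵐ s ∂volume.restrict (Icc 0 P.T), inner ℝ (z s) (p s) ≤ 5 * A * (1 + N s ^ 2)) →
      ∀ t ∈ Icc 0 P.T, ‖z t‖ ^ 2 ≤ r ^ 2 + ∫ s in (0 : ℝ)..t, 10 * A * (1 + N s ^ 2) := by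
    intro p z z₀ C hp hpC hz hz₀ hle t ht
    obtain ⟨hi, he⟩ := norm_sq_eq_add_integral hp hpC hz ht
    have hsub : Icc 0 t ⊆ Icc 0 P.T := Icc_subset_Icc_right ht.2
    have h1 : ∫ s in (0 : ℝ)..t, inner ℝ (z s) (p s)
        ≤ ∫ s in (0 : ℝ)..t, 5 * A * (1 + N s ^ 2) := by
      refine intervalIntegral.integral_mono_ae_restrict ht.1
        (hi.mono_set (uIcc_subset_Icc h00 ht)).intervalIntegrable
        (intervalIntegrable_of_continuousOn hNc2 h00 ht) ?_
      exact ae_mono (Measure.restrict_mono hsub le_rfl) hle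
    have h2 : ∫ s in (0 : ℝ)..t, 10 * A * (1 + N s ^ 2)
        = 2 * ∫ s in (0 : ℝ)..t, 5 * A * (1 + N s ^ 2) := by
      rw [← intervalIntegral.integral_const_mul]
      congr 1 with s
      ring
    rw [he, h2]
    have := hr2 hz₀
    linarith
  have hlead : ∀ k, ∀ t ∈ Icc 0 P.T,
      ‖y t k‖ ^ 2 ≤ r ^ 2 + ∫ s in (0 : ℝ)..t, 10 * A * (1 + N s ^ 2) := by
    intro k
    refine key (p := fun s => P.leaderVelocity k (y s) (law σ (X s)) (u s))
      (C := L + L + A) ?_ ?_ (fun t ht => h.leaders.2 t ht k)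
      ((norm_le_pi_norm y₀ k).trans hy₀) ?_
    · have h1 : IntegrableOn (fun s => conv P.K (law σ (X s)) (y s k) + P.f k (y s))
          (Icc 0 P.T) := (hmf.continuousOn_leaderDrift hP k).integrableOn_Icc
      have h2 : IntegrableOn (fun s => Matrix.toEuclideanLin (P.B k) (u s)) (Icc 0 P.T) :=
        (Matrix.toEuclideanLin (P.B k)).toContinuousLinearMap.integrable_comp
          (memLp_one_iff_integrable.1 hu.1)
      exact h1.add h2
    · filter_upwards [hae] with s hs
      refine norm_add₃_le.trans ?_
      have h1 := hP.norm_conv_le (law σ (X s)) (y s k)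
      have h2 := hP.f_le k (y s)
      have h3 := hA.B_le k _ hs.2
      linarith
    · filter_upwards [hae] with s hs
      have hyk : ‖y s k‖ ≤ N s := (norm_le_pi_norm (y s) k).trans (hyN s)
      rw [leaderVelocity, inner_add_right, inner_add_right]
      have h1 := (real_inner_le_norm (y s k) (conv P.K (law σ (X s)) (y s k))).trans
        (mul_le_mul hyk (norm_conv_law_le hA σ (X s) hP (hXN s) hyk) (norm_nonneg _) (hN0 s))
      have h2 := hA.f_le k (y s)
      rw [real_inner_comm] at h2
      have h3 := (real_inner_le_norm (y s k) (Matrix.toEuclideanLin (P.B k) (u s))).trans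
        (mul_le_mul hyk (hA.B_le k _ hs.2) (norm_nonneg _) (hN0 s))
      have h4 : A * (1 + ‖y s‖ ^ 2) ≤ A * (1 + N s ^ 2) := by
        gcongr
        exact hyN s
      nlinarith [mul_nonneg hA0 (sq_nonneg (N s - 1)), mul_nonneg hA0 (sq_nonneg (N s))]
  have hfoll : ∀ s, ∀ t ∈ Icc 0 P.T,
      ‖X t s‖ ^ 2 ≤ r ^ 2 + ∫ s in (0 : ℝ)..t, 10 * A * (1 + N s ^ 2) := by
    intro s
    have hvc := continuousOn_followerVelocity_law hP σ h.leaders.1 h.continuousOn s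
    refine key (p := fun t => P.followerVelocity (y t) (law σ (X t)) (X t s)) (C := 2 * L)
      (z₀ := X₀ s) hvc.integrableOn_Icc
      (Eventually.of_forall fun t => hP.norm_followerVelocity_le _ _ _)
      (fun t ht => ?_) ((X₀.norm_coe_le_norm s).trans hX₀) ?_
    · have := eq_add_integral_of_hasDerivWithinAt (fun t ht => h.followers t ht s) hvc ht
      rwa [h.initial] at this
    · refine Eventually.of_forall fun q => ?_
      have hXs : ‖X q s‖ ≤ N q := ((X q).norm_coe_le_norm s).trans (hXN q)
      rw [followerVelocity, inner_add_right]
      have h1 := (real_inner_le_norm (X q s) (conv P.K (law σ (X q)) (X q s))).trans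
        (mul_le_mul hXs (norm_conv_law_le hA σ (X q) hP (hXN q) hXs) (norm_nonneg _) (hN0 q))
      have h2 := hA.g_le (y q) (X q s)
      rw [real_inner_comm] at h2
      have h4 : A * (1 + ‖X q s‖ ^ 2 + ‖y q‖ ^ 2) ≤ A * (1 + N q ^ 2 + N q ^ 2) := by
        gcongr
        exact hyN q
      nlinarith [mul_nonneg hA0 (sq_nonneg (N q - 1)), mul_nonneg hA0 (sq_nonneg (N q))]
  have hint0 : ∀ t ∈ Icc 0 P.T, 0 ≤ r ^ 2 + ∫ s in (0 : ℝ)..t, 10 * A * (1 + N s ^ 2) :=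
    fun t ht => add_nonneg (sq_nonneg _)
      (intervalIntegral.integral_nonneg ht.1 fun s _ => by positivity)
  have hNle : ∀ t ∈ Icc 0 P.T, N t ^ 2 ≤ r ^ 2 + ∫ s in (0 : ℝ)..t, 10 * A * (1 + N s ^ 2) := by
    intro t ht
    rw [← Real.le_sqrt (hN0 t) (hint0 t ht)]
    refine max_le ((pi_norm_le_iff_of_nonneg (Real.sqrt_nonneg _)).2 fun k => ?_)
      ((ContinuousMap.norm_le _ (Real.sqrt_nonneg _)).2 fun s => ?_)
    · exact Real.le_sqrt_of_sq_le (hlead k t ht)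
    · exact Real.le_sqrt_of_sq_le (hfoll s t ht)
  have hfin : N t ^ 2 ≤ aprioriBound A P.T r :=
    (le_gronwallBound_of_le_integral (by positivity) (hNc.pow 2) hNle ht).trans
      (gronwallBound_mono (sq_nonneg _) (by positivity) (by positivity) ht.2)
  exact ⟨(pow_le_pow_left₀ (norm_nonneg _) (hyN t) 2).trans hfin,
    (pow_le_pow_left₀ (norm_nonneg _) (hXN t) 2).trans hfin⟩

end ControlProblem

/-! ### Truncation of the data -/

section cutoff

variable {E F : Type*} [NormedAddCommGroup E] [NormedSpace ℝ E] [FiniteDimensional ℝ E]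
  [NormedAddCommGroup F] [NormedSpace ℝ F]

/-- The bump function underlying `cutoff`. -/
noncomputable def cutoffBump (E : Type*) [NormedAddCommGroup E] (R : ℝ) : ContDiffBump (0 : E) :=
  ⟨|R| + 1, |R| + 2, by positivity, by linarith⟩

/-- A smooth compactly supported cutoff function which is `1` on the ball of radius `R`. -/
noncomputable def cutoff (R : ℝ) (x : E) : ℝ := cutoffBump E R x

lemma cutoff_nonneg (R : ℝ) (x : E) : 0 ≤ cutoff R x := (cutoffBump E R).nonneg

lemma cutoff_le_one (R : ℝ) (x : E) : cutoff R x ≤ 1 := (cutoffBump E R).le_one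

lemma cutoff_eq_one {R : ℝ} {x : E} (hx : ‖x‖ ≤ R) : cutoff R x = 1 := by
  refine (cutoffBump E R).one_of_mem_closedBall ?_
  simp only [cutoffBump, Metric.mem_closedBall, dist_zero_right]
  linarith [le_abs_self R]

lemma cutoff_smul_eq {R : ℝ} {x : E} (hx : ‖x‖ ≤ R) (a : F) : cutoff R x • a = a := by
  rw [cutoff_eq_one hx, one_smul]

lemma exists_lipschitzWith_cutoff_smul {f : E → F} (hf : ContDiff ℝ 2 f) (R : ℝ) :
    ∃ L : ℝ≥0, LipschitzWith L (fun x => cutoff R x • f x) ∧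
      ∀ x, ‖cutoff R x • f x‖ ≤ L := by
  have hc : HasCompactSupport (fun x => cutoff R x • f x) :=
    (cutoffBump E R).hasCompactSupport.smul_right
  have hd : ContDiff ℝ 2 (fun x => cutoff R x • f x) := (cutoffBump E R).contDiff.smul hf
  obtain ⟨L₁, h₁⟩ := hd.lipschitzWith_of_hasCompactSupport hc two_ne_zero
  obtain ⟨L₂, h₂⟩ := hc.exists_bound_of_continuous hd.continuous
  refine ⟨max L₁ L₂.toNNReal, h₁.weaken (le_max_left _ _), fun x => (h₂ x).trans ?_⟩
  rw [NNReal.coe_max]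
  exact (Real.le_coe_toNNReal L₂).trans (le_max_right _ _)

end cutoff

namespace ControlProblem

/-- The problem whose data are cut off outside balls. The data seen by a state of size at most `R`
do not change, provided that `R'` bounds `ω` on the ball of radius `R`. -/
noncomputable def truncate (P : ControlProblem d D m) (R R' : ℝ) : ControlProblem d D m where
  T := P.T
  U := P.U
  γ := P.γ
  -- `K` is evaluated at differences of two points of the ball of radius `R`
  K := fun x => cutoff (2 * R) x • P.K x
  f := fun k y => cutoff R y • P.f k y
  g := fun y x => cutoff R (y, x) • P.g y x
  B := P.B
  ℓ := fun p => cutoff (max R R') p • P.ℓ p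
  ω := fun x => cutoff R x • P.ω x

variable {P : ControlProblem d D m} {R R' : ℝ}

lemma exists_isTame_truncate (hP : P.Hypotheses) (R R' : ℝ) :
    ∃ L, (P.truncate R R').IsTame L := by
  obtain ⟨LK, hK, hK'⟩ := exists_lipschitzWith_cutoff_smul hP.K_smooth (2 * R)
  obtain ⟨Lg, hg, hg'⟩ := exists_lipschitzWith_cutoff_smul hP.g_smooth R
  choose Lf hf hf' using fun k => exists_lipschitzWith_cutoff_smul (hP.f_smooth k) R
  obtain ⟨Lω, hω, hω'⟩ := exists_lipschitzWith_cutoff_smul hP.ω_smooth R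
  obtain ⟨Lℓ, hℓ, hℓ'⟩ := exists_lipschitzWith_cutoff_smul hP.ℓ_smooth (max R R')
  have hle : ∀ k, Lf k ≤ ∑ k, Lf k := fun k =>
    Finset.single_le_sum (f := Lf) (fun _ _ => zero_le) (Finset.mem_univ k)
  set L := LK + Lg + (∑ k, Lf k) + Lω + Lℓ with hL
  have h1 : LK ≤ L := by
    rw [hL, add_assoc, add_assoc, add_assoc]; exact le_self_add
  have h2 : Lg ≤ L := by
    rw [hL, add_comm LK, add_assoc, add_assoc, add_assoc]; exact le_self_add
  have h3 : ∀ k, Lf k ≤ L := fun k => (hle k).trans (by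
    rw [hL, add_comm (LK + Lg), add_assoc, add_assoc]; exact le_self_add)
  have h4 : Lω ≤ L := by rw [hL, add_right_comm]; exact le_add_self
  have h5 : Lℓ ≤ L := le_add_self
  exact ⟨L, hK.weaken h1, fun x => (hK' x).trans h1, hg.weaken h2,
    fun y x => (hg' (y, x)).trans h2, fun k => (hf k).weaken (h3 k),
    fun k y => (hf' k y).trans (h3 k), hω.weaken h4, fun x => (hω' x).trans h4, hℓ.weaken h5,
    fun p => (hℓ' p).trans h5⟩

lemma exists_hasGrowth (hP : P.Hypotheses) : ∃ A, P.HasGrowth A := by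
  obtain ⟨C, hC, hK⟩ := hP.K_sublinear
  obtain ⟨G₁, G₂, G₃, hg⟩ := hP.g_growth
  obtain ⟨F₁, F₂, hf⟩ := hP.f_growth
  have hB : ∀ k, ∃ b, ∀ u ∈ P.U, ‖Matrix.toEuclideanLin (P.B k) u‖ ≤ b := fun k =>
    hP.U_compact.exists_bound_of_continuousOn
      (Matrix.toEuclideanLin (P.B k)).toContinuousLinearMap.continuous.continuousOn
  choose b hb using hB
  have hle : ∀ k, b k ≤ ∑ k, |b k| := fun k => (le_abs_self _).trans
    (Finset.single_le_sum (f := fun k => |b k|) (fun _ _ => abs_nonneg _) (Finset.mem_univ k))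
  have hs : 0 ≤ ∑ k, |b k| := Finset.sum_nonneg fun _ _ => abs_nonneg _
  refine ⟨C + (|G₁| + |G₂| + |G₃|) + (|F₁| + |F₂|) + ∑ k, |b k|, by positivity, fun x => ?_,
    fun y x => ?_, fun k y => ?_, fun k u hu => ?_⟩
  · refine (hK x).le.trans ?_
    gcongr
    have : 0 ≤ |G₁| + |G₂| + |G₃| + (|F₁| + |F₂|) := by positivity
    linarith
  · refine (hg y x).trans ?_
    have : G₁ * ‖x‖ ^ 2 + G₂ * ‖y‖ ^ 2 + G₃
        ≤ (|G₁| + |G₂| + |G₃|) * (1 + ‖x‖ ^ 2 + ‖y‖ ^ 2) := by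
      nlinarith [le_abs_self G₁, le_abs_self G₂, le_abs_self G₃, abs_nonneg G₁, abs_nonneg G₂,
        abs_nonneg G₃, sq_nonneg ‖x‖, sq_nonneg ‖y‖]
    refine this.trans (mul_le_mul_of_nonneg_right ?_ (by positivity))
    have : 0 ≤ |F₁| + |F₂| := by positivity
    linarith
  · refine (hf k y).trans ?_
    have : F₁ * ‖y‖ ^ 2 + F₂ ≤ (|F₁| + |F₂|) * (1 + ‖y‖ ^ 2) := by
      nlinarith [le_abs_self F₁, le_abs_self F₂, abs_nonneg F₁, abs_nonneg F₂, sq_nonneg ‖y‖]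
    refine this.trans (mul_le_mul_of_nonneg_right ?_ (by positivity))
    have : 0 ≤ |G₁| + |G₂| + |G₃| := by positivity
    linarith
  · refine (hb k u hu).trans ((hle k).trans ?_)
    have : 0 ≤ |G₁| + |G₂| + |G₃| + (|F₁| + |F₂|) := by positivity
    linarith

/-- Truncation does not affect the growth constant. -/
lemma HasGrowth.truncate {A : ℝ} (hA : P.HasGrowth A) (R R' : ℝ) :
    (P.truncate R R').HasGrowth A := by
  have key : ∀ {c a b : ℝ}, 0 ≤ c → c ≤ 1 → a ≤ b → 0 ≤ b → c * a ≤ b := by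
    intro c a b h0 h1 hab hb
    exact (mul_le_mul_of_nonneg_left hab h0).trans (mul_le_of_le_one_left hb h1)
  have hA0 := hA.nonneg
  refine ⟨hA0, fun x => ?_, fun y x => ?_, fun k y => ?_, hA.B_le⟩
  · change ‖cutoff (2 * R) x • P.K x‖ ≤ _
    rw [norm_smul, Real.norm_of_nonneg (cutoff_nonneg _ _)]
    exact key (cutoff_nonneg _ _) (cutoff_le_one _ _) (hA.K_le x) (by positivity)
  · change inner ℝ (cutoff R (y, x) • P.g y x) x ≤ _
    rw [real_inner_smul_left]
    exact key (cutoff_nonneg _ _) (cutoff_le_one _ _) (hA.g_le y x) (by positivity)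
  · change inner ℝ (cutoff R y • P.f k y) (y k) ≤ _
    rw [real_inner_smul_left]
    exact key (cutoff_nonneg _ _) (cutoff_le_one _ _) (hA.f_le k y) (by positivity)

variable {y : Fin m → Euc d} {μ : ProbabilityMeasure (Euc d)}

lemma conv_truncate (hμ : ∀ᵐ x ∂(μ : Measure (Euc d)), ‖x‖ ≤ R) {x : Euc d} (hx : ‖x‖ ≤ R) :
    conv (P.truncate R R').K μ x = conv P.K μ x := by
  refine integral_congr_ae ?_
  filter_upwards [hμ] with x' hx'
  exact cutoff_smul_eq ((norm_sub_le x x').trans (by linarith)) _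

lemma followerVelocity_truncate (hy : ‖y‖ ≤ R) (hμ : ∀ᵐ x ∂(μ : Measure (Euc d)), ‖x‖ ≤ R)
    {x : Euc d} (hx : ‖x‖ ≤ R) :
    (P.truncate R R').followerVelocity y μ x = P.followerVelocity y μ x :=
  congr_arg₂ (· + ·) (conv_truncate hμ hx) (cutoff_smul_eq (max_le hy hx) _)

lemma leaderVelocity_truncate (hy : ‖y‖ ≤ R) (hμ : ∀ᵐ x ∂(μ : Measure (Euc d)), ‖x‖ ≤ R)
    (k : Fin m) (u : Euc D) :
    (P.truncate R R').leaderVelocity k y μ u = P.leaderVelocity k y μ u :=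
  congr_arg₂ (· + ·) (congr_arg₂ (· + ·) (conv_truncate hμ ((norm_le_pi_norm y k).trans hy))
    (cutoff_smul_eq hy _)) rfl

lemma stateCost_truncate (hy : ‖y‖ ≤ R) (hμ : ∀ᵐ x ∂(μ : Measure (Euc d)), ‖x‖ ≤ R)
    (hω : ∀ x, ‖x‖ ≤ R → ‖P.ω x‖ ≤ R') :
    (P.truncate R R').stateCost y μ = P.stateCost y μ := by
  have h1 : ∫ z, (P.truncate R R').ω z ∂(μ : Measure (Euc d))
      = ∫ z, P.ω z ∂(μ : Measure (Euc d)) := by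
    refine integral_congr_ae ?_
    filter_upwards [hμ] with x hx
    exact cutoff_smul_eq hx _
  have h2 : ‖∫ z, P.ω z ∂(μ : Measure (Euc d))‖ ≤ R' := by
    have := norm_integral_le_of_norm_le_const (μ := (μ : Measure (Euc d))) (f := P.ω) (C := R')
      (by filter_upwards [hμ] with x hx using hω x hx)
    simpa using this
  rw [stateCost, stateCost, h1]
  refine integral_congr_ae ?_
  filter_upwards [hμ] with x hx
  exact cutoff_smul_eq (max_le (hy.trans (le_max_left _ _)) (max_le (hx.trans (le_max_left _ _))
    (h2.trans (le_max_right _ _)))) _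

lemma solvesLeaderODE_truncate_iff {u : ℝ → Euc D} {y₀ : Fin m → Euc d} {y : ℝ → Fin m → Euc d}
    {μ : ℝ → ProbabilityMeasure (Euc d)} (hy : ∀ t ∈ Icc 0 P.T, ‖y t‖ ≤ R)
    (hμ : ∀ t ∈ Icc 0 P.T, ∀ᵐ x ∂(μ t : Measure (Euc d)), ‖x‖ ≤ R) :
    (P.truncate R R').SolvesLeaderODE u y₀ y μ ↔ P.SolvesLeaderODE u y₀ y μ := by
  refine and_congr Iff.rfl (forall₃_congr fun t ht k => ?_)
  have : ∫ s in (0 : ℝ)..t, (P.truncate R R').leaderVelocity k (y s) (μ s) (u s)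
      = ∫ s in (0 : ℝ)..t, P.leaderVelocity k (y s) (μ s) (u s) := by
    refine intervalIntegral.integral_congr fun s hs => ?_
    rw [uIcc_of_le ht.1] at hs
    have hs' : s ∈ Icc 0 P.T := ⟨hs.1, hs.2.trans ht.2⟩
    exact leaderVelocity_truncate (hy s hs') (hμ s hs') k _
  rw [this]

lemma isMeanFieldSolution_truncate_iff {u : ℝ → Euc D} {y₀ : Fin m → Euc d}
    {μ₀ : ProbabilityMeasure (Euc d)} {y : ℝ → Fin m → Euc d}
    {μ : ℝ → ProbabilityMeasure (Euc d)} (hy : ∀ t ∈ Icc 0 P.T, ‖y t‖ ≤ R)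
    (hμ : ∀ t ∈ Icc 0 P.T, ∀ᵐ x ∂(μ t : Measure (Euc d)), ‖x‖ ≤ R) :
    (P.truncate R R').IsMeanFieldSolution u y₀ μ₀ y μ ↔ P.IsMeanFieldSolution u y₀ μ₀ y μ := by
  have key : ∀ φ : Euc d → ℝ, ∀ t ∈ Icc 0 P.T,
      ∫ x, inner ℝ (gradient φ x) ((P.truncate R R').followerVelocity (y t) (μ t) x)
        ∂(μ t : Measure (Euc d))
      = ∫ x, inner ℝ (gradient φ x) (P.followerVelocity (y t) (μ t) x)
        ∂(μ t : Measure (Euc d)) := by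
    intro φ t ht
    refine integral_congr_ae ?_
    filter_upwards [hμ t ht] with x hx
    rw [followerVelocity_truncate (hy t ht) (hμ t ht) hx]
  constructor
  · intro h
    refine ⟨(solvesLeaderODE_truncate_iff hy hμ).1 h.leaders, h.initial, h.support_bounded,
      h.continuous_W1, fun φ hφ hc t ht => ?_⟩
    rw [← key φ t ht]
    exact h.continuity_equation φ hφ hc t ht
  · intro h
    refine ⟨(solvesLeaderODE_truncate_iff hy hμ).2 h.leaders, h.initial, h.support_bounded,
      h.continuous_W1, fun φ hφ hc t ht => ?_⟩
    rw [key φ t ht]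
    exact h.continuity_equation φ hφ hc t ht

end ControlProblem

/-! ### Particle systems as Lagrangian solutions -/

section empirical

variable {N : ℕ} [NeZero N]

/-- The uniform distribution on the labels of `N` particles. -/
noncomputable def uniformLabel (N : ℕ) [NeZero N] : ProbabilityMeasure (Fin N) :=
  ⟨(N : ℝ≥0∞)⁻¹ • ∑ i, Measure.dirac i, ⟨by
    have h0 : (N : ℝ≥0∞) ≠ 0 := by exact_mod_cast NeZero.ne N
    simp [ENNReal.inv_mul_cancel h0 (ENNReal.natCast_ne_top N)]⟩⟩

/-- A configuration of `N` particles as a function of the label. -/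
def ofConfig (x : Fin N → Euc d) : C(Fin N, Euc d) := ⟨x, continuous_of_discreteTopology⟩

lemma law_ofConfig (x : Fin N → Euc d) : law (uniformLabel N) (ofConfig x) = empirical x := by
  refine Subtype.ext ?_
  change Measure.map x ((N : ℝ≥0∞)⁻¹ • ∑ i, Measure.dirac i) = (N : ℝ≥0∞)⁻¹ • ∑ i,
    Measure.dirac (x i)
  have hx : Measurable x := measurable_of_countable x
  rw [Measure.map_smul, Measure.map_finset_sum hx.aemeasurable]
  simp_rw [Measure.map_dirac' hx]

lemma norm_ofConfig_sub_le (x x' : Fin N → Euc d) : ‖ofConfig x - ofConfig x'‖ ≤ ‖x - x'‖ :=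
  (ContinuousMap.norm_le _ (norm_nonneg _)).2 fun i => norm_le_pi_norm (x - x') i

lemma norm_ofConfig_le (x : Fin N → Euc d) : ‖ofConfig x‖ ≤ ‖x‖ :=
  (ContinuousMap.norm_le _ (norm_nonneg _)).2 fun i => norm_le_pi_norm x i

lemma continuous_ofConfig : Continuous (ofConfig : (Fin N → Euc d) → C(Fin N, Euc d)) :=
  (LipschitzWith.of_dist_le_mul (K := 1) fun x x' => by
    rw [dist_eq_norm, dist_eq_norm, NNReal.coe_one, one_mul]
    exact norm_ofConfig_sub_le x x').continuous

lemma ae_empirical_norm_le {x : Fin N → Euc d} {R : ℝ} (hx : ‖x‖ ≤ R) :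
    ∀ᵐ z ∂(empirical x : Measure (Euc d)), ‖z‖ ≤ R := by
  rw [← law_ofConfig]
  exact ae_law_norm_le _ ((norm_ofConfig_le x).trans hx)

end empirical

namespace ControlProblem

variable {P : ControlProblem d D m} {N : ℕ} [NeZero N]

lemma isParticleSolution_truncate_iff {R R' : ℝ} {u : ℝ → Euc D} {y₀ : Fin m → Euc d}
    {x₀ : Fin N → Euc d} {y : ℝ → Fin m → Euc d}
    {x : ℝ → Fin N → Euc d} (hy : ∀ t ∈ Icc 0 P.T, ‖y t‖ ≤ R)
    (hx : ∀ t ∈ Icc 0 P.T, ‖x t‖ ≤ R) :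
    (P.truncate R R').IsParticleSolution u y₀ x₀ y x ↔ P.IsParticleSolution u y₀ x₀ y x := by
  have hμ : ∀ t ∈ Icc 0 P.T, ∀ᵐ z ∂(empirical (x t) : Measure (Euc d)), ‖z‖ ≤ R :=
    fun t ht => ae_empirical_norm_le (hx t ht)
  have key : ∀ t ∈ Icc 0 P.T, ∀ i,
      ∫ s in (0 : ℝ)..t, (P.truncate R R').followerVelocity (y s) (empirical (x s)) (x s i)
      = ∫ s in (0 : ℝ)..t, P.followerVelocity (y s) (empirical (x s)) (x s i) := by
    intro t ht i
    refine intervalIntegral.integral_congr fun s hs => ?_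
    rw [uIcc_of_le ht.1] at hs
    have hs' : s ∈ Icc 0 P.T := ⟨hs.1, hs.2.trans ht.2⟩
    exact followerVelocity_truncate (hy s hs') (hμ s hs') ((norm_le_pi_norm _ i).trans (hx s hs'))
  constructor
  · intro h
    refine ⟨(solvesLeaderODE_truncate_iff hy hμ).1 h.leaders, h.continuousOn, fun t ht i => ?_⟩
    rw [← key t ht i]
    exact h.followers t ht i
  · intro h
    refine ⟨(solvesLeaderODE_truncate_iff hy hμ).2 h.leaders, h.continuousOn, fun t ht i => ?_⟩
    rw [key t ht i]
    exact h.followers t ht i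

variable {L : ℝ≥0} {u : ℝ → Euc D} {y₀ : Fin m → Euc d} {x₀ : Fin N → Euc d}
  {y : ℝ → Fin m → Euc d}

lemma IsParticleSolution.isLagrangianSolution (hP : P.IsTame L) (hT : 0 ≤ P.T)
    {x : ℝ → Fin N → Euc d} (h : P.IsParticleSolution u y₀ x₀ y x) :
    P.IsLagrangianSolution (uniformLabel N) u y₀ (ofConfig x₀) y (fun t => ofConfig (x t)) where
  leaders := by
    simp_rw [law_ofConfig]
    exact h.leaders
  initial := by
    congr 1
    funext i
    rw [h.followers 0 ⟨le_rfl, hT⟩ i]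
    simp
  continuousOn := continuous_ofConfig.comp_continuousOn h.continuousOn
  followers := fun t ht i => by
    have hc : ContinuousOn (fun t => P.followerVelocity (y t)
        (law (uniformLabel N) (ofConfig (x t))) (x t i)) (Icc 0 P.T) :=
      continuousOn_followerVelocity_law hP (uniformLabel N) h.leaders.1
      (continuous_ofConfig.comp_continuousOn h.continuousOn) i
    refine ((hasDerivWithinAt_integral_of_continuousOn hT hc ht).const_add (x₀ i)).congr
      (fun s hs => ?_) ?_
    · simp_rw [law_ofConfig]
      exact h.followers s hs i
    · simp_rw [law_ofConfig]
      exact h.followers t ht i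

lemma IsLagrangianSolution.isParticleSolution (hP : P.IsTame L)
    {X : ℝ → C(Fin N, Euc d)}
    (h : P.IsLagrangianSolution (uniformLabel N) u y₀ (ofConfig x₀) y X) :
    P.IsParticleSolution u y₀ x₀ y (fun t => X t) := by
  have e : ∀ t, law (uniformLabel N) (X t) = empirical (X t) := fun t => law_ofConfig (X t)
  refine ⟨by simpa only [e] using h.leaders, continuousOn_pi.2 fun i =>
    (ContinuousEvalConst.continuous_eval_const i).comp_continuousOn h.continuousOn,
    fun t ht i => ?_⟩
  have hc := continuousOn_followerVelocity_law hP (uniformLabel N) h.leaders.1 h.continuousOn i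
  have := eq_add_integral_of_hasDerivWithinAt (fun t ht => h.followers t ht i) hc ht
  rw [h.initial] at this
  simp only [e] at this
  exact this

end ControlProblem

/-! ### Existence, bounds and stability without global Lipschitz conditions -/

/-- If the Kantorovich–Rubinstein distance of two measures with bounded support vanishes, then they
are supported in the same balls. -/
lemma KRBound.ae_norm_le {μ ν : ProbabilityMeasure (Euc d)} (h : KRBound 0 μ ν) {R R₁ : ℝ}
    (hμ : ∀ᵐ x ∂(μ : Measure (Euc d)), ‖x‖ ≤ R₁) (hν : ∀ᵐ x ∂(ν : Measure (Euc d)), ‖x‖ ≤ R) :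
    ∀ᵐ x ∂(μ : Measure (Euc d)), ‖x‖ ≤ R := by
  have hφ : LipschitzWith 1 (fun x : Euc d => max (‖x‖ - R) 0) := by
    have : LipschitzWith 1 (fun x : Euc d => ‖x‖ - R) := LipschitzWith.of_dist_le_mul fun x y => by
      rw [NNReal.coe_one, one_mul, dist_eq_norm, dist_eq_norm, sub_sub_sub_cancel_right]
      exact abs_norm_sub_norm_le x y
    exact this.max_const 0
  have h1 := h _ hφ
  have h2 : ∫ x, max (‖x‖ - R) 0 ∂(ν : Measure (Euc d)) = 0 := by
    refine integral_eq_zero_of_ae ?_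
    filter_upwards [hν] with x hx
    exact max_eq_right (by linarith)
  have h3 : ∫ x, max (‖x‖ - R) 0 ∂(μ : Measure (Euc d)) = 0 :=
    le_antisymm (by linarith) (integral_nonneg fun x => le_max_right _ _)
  replace h3 := (integral_eq_zero_iff_of_nonneg (f := fun x : Euc d => max (‖x‖ - R) 0)
    (fun x => le_max_right _ _) (integrable_of_ae_norm_le hμ hφ.continuous)).1 h3
  filter_upwards [h3] with x hx
  have := (le_max_left (‖x‖ - R) 0).trans hx.le
  simp only [Pi.zero_apply] at this
  linarith

/-- Every distribution supported in a ball is the law of the inclusion map, the followers being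
labelled by their initial positions. -/
lemma exists_law_eq {r : ℝ} (μ₀ : ProbabilityMeasure (Euc d))
    (h : ∀ᵐ x ∂(μ₀ : Measure (Euc d)), ‖x‖ ≤ r) :
    ∃ (σ : ProbabilityMeasure (Metric.closedBall (0 : Euc d) r))
      (X₀ : C(Metric.closedBall (0 : Euc d) r, Euc d)), law σ X₀ = μ₀ ∧ ∀ s, ‖X₀ s‖ ≤ r := by
  have hm : MeasurableSet (Metric.closedBall (0 : Euc d) r) := measurableSet_closedBall
  have hae : ∀ᵐ x ∂(μ₀ : Measure (Euc d)), x ∈ Metric.closedBall (0 : Euc d) r := by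
    filter_upwards [h] with x hx
    simpa using hx
  have hσ : IsProbabilityMeasure ((μ₀ : Measure (Euc d)).comap
      ((↑) : Metric.closedBall (0 : Euc d) r → Euc d)) :=
    (MeasurableEmbedding.subtype_coe hm).isProbabilityMeasure_comap (by simpa using hae)
  refine ⟨⟨_, hσ⟩, ⟨Subtype.val, continuous_subtype_val⟩, Subtype.ext ?_, fun s =>
    mem_closedBall_zero_iff.1 s.2⟩
  change Measure.map Subtype.val (Measure.comap Subtype.val (μ₀ : Measure (Euc d))) = _
  rw [map_comap_subtype_coe hm, Measure.restrict_eq_self_of_ae_mem hae]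
  rfl

namespace ControlProblem

variable {P : ControlProblem d D m}

lemma IsMeanFieldSolution.exists_norm_le {u : ℝ → Euc D} {y₀ : Fin m → Euc d}
    {μ₀ : ProbabilityMeasure (Euc d)} {y : ℝ → Fin m → Euc d}
    {μ : ℝ → ProbabilityMeasure (Euc d)} (h : P.IsMeanFieldSolution u y₀ μ₀ y μ) :
    ∃ R, ∀ t ∈ Icc 0 P.T, ‖y t‖ ≤ R ∧ ∀ᵐ x ∂(μ t : Measure (Euc d)), ‖x‖ ≤ R := by
  obtain ⟨R₁, -, h₁⟩ := h.exists_ae_norm_le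
  obtain ⟨R₂, h₂⟩ := isCompact_Icc.exists_bound_of_continuousOn h.leaders.1
  refine ⟨max R₁ R₂, fun t ht => ⟨(h₂ t ht).trans (le_max_right _ _), ?_⟩⟩
  filter_upwards [h₁ t ht] with x hx using hx.trans (le_max_left _ _)

/-- Every truncated problem has Lagrangian solutions, which stay in a ball that is independent of
the radius of truncation and of the label space. -/
lemma exists_isLagrangianSolution_truncate (hP : P.Hypotheses) (r : ℝ) :
    ∃ R, ∀ R₁ : ℝ, ∀ {S : Type} [TopologicalSpace S] [MeasurableSpace S] [OpensMeasurableSpace S]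
      [CompactSpace S] [SecondCountableTopology S] (σ : ProbabilityMeasure S)
      (u : ℝ → Euc D) (y₀ : Fin m → Euc d) (X₀ : C(S, Euc d)), P.IsControl u → ‖y₀‖ ≤ r →
      ‖X₀‖ ≤ r → ∃ y X, (P.truncate R₁ 0).IsLagrangianSolution σ u y₀ X₀ y X ∧
        ∀ t ∈ Icc 0 P.T, ‖y t‖ ≤ R ∧ ‖X t‖ ≤ R := by
  obtain ⟨A, hA⟩ := exists_hasGrowth hP
  refine ⟨√(aprioriBound A P.T r), fun R₁ S _ _ _ _ _ σ u y₀ X₀ hu hy₀ hX₀ => ?_⟩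
  obtain ⟨L, hL⟩ := exists_isTame_truncate hP R₁ 0
  have hu' : (P.truncate R₁ 0).IsControl u := hu
  obtain ⟨y, X, h⟩ := exists_isLagrangianSolution hL hP.T_pos hu' σ y₀ X₀
  refine ⟨y, X, h, fun t ht => ?_⟩
  have := h.norm_sq_le hL (hA.truncate R₁ 0) hu' hy₀ hX₀ ht
  exact ⟨Real.le_sqrt_of_sq_le this.1, Real.le_sqrt_of_sq_le this.2⟩

theorem exists_isParticleSolution (hP : P.Hypotheses) {u : ℝ → Euc D} (hu : P.IsControl u)
    (y₀ : Fin m → Euc d) {N : ℕ} [NeZero N] (x₀ : Fin N → Euc d) :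
    ∃ y x, P.IsParticleSolution u y₀ x₀ y x := by
  obtain ⟨R, hR⟩ := exists_isLagrangianSolution_truncate hP (max ‖y₀‖ ‖x₀‖)
  obtain ⟨y, X, h, hb⟩ := hR (max R 0) (uniformLabel N) u y₀ (ofConfig x₀) hu (le_max_left _ _)
    ((norm_ofConfig_le x₀).trans (le_max_right _ _))
  obtain ⟨L, hL⟩ := exists_isTame_truncate hP (max R 0) 0
  refine ⟨y, fun t => X t, (isParticleSolution_truncate_iff (R := max R 0) (R' := 0)
    (fun t ht => (hb t ht).1.trans (le_max_left _ _)) (fun t ht => ?_)).1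
      (h.isParticleSolution hL)⟩
  exact (pi_norm_le_iff_of_nonneg (le_max_right _ _)).2 fun i =>
    ((X t).norm_coe_le_norm i).trans ((hb t ht).2.trans (le_max_left _ _))

/-- The empirical measures of a solution of the particle system solve the mean-field system. -/
theorem IsParticleSolution.isMeanFieldSolution (hP : P.Hypotheses) {u : ℝ → Euc D}
    {y₀ : Fin m → Euc d} {N : ℕ} [NeZero N] {x₀ : Fin N → Euc d} {y : ℝ → Fin m → Euc d}
    {x : ℝ → Fin N → Euc d} (h : P.IsParticleSolution u y₀ x₀ y x) :
    P.IsMeanFieldSolution u y₀ (empirical x₀) y (fun t => empirical (x t)) := by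
  obtain ⟨R₁, h₁⟩ := isCompact_Icc.exists_bound_of_continuousOn h.leaders.1
  obtain ⟨R₂, h₂⟩ := isCompact_Icc.exists_bound_of_continuousOn h.continuousOn
  have hy : ∀ t ∈ Icc 0 P.T, ‖y t‖ ≤ max R₁ R₂ := fun t ht => (h₁ t ht).trans (le_max_left _ _)
  have hx : ∀ t ∈ Icc 0 P.T, ‖x t‖ ≤ max R₁ R₂ := fun t ht => (h₂ t ht).trans (le_max_right _ _)
  obtain ⟨L, hL⟩ := exists_isTame_truncate hP (max R₁ R₂) 0
  have h' := ((isParticleSolution_truncate_iff (R' := 0) hy hx).2 h).isLagrangianSolution hL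
    hP.T_pos.le
  have h'' := h'.isMeanFieldSolution hL
  simp only [law_ofConfig] at h''
  exact (isMeanFieldSolution_truncate_iff hy fun t ht => ae_empirical_norm_le (hx t ht)).1 h''

/-- Existence of mean-field solutions, with a bound that only depends on the size of the initial
datum and that holds for every solution, by uniqueness. -/
theorem exists_isMeanFieldSolution (hP : P.Hypotheses) (r : ℝ) :
    ∃ R, ∀ (u : ℝ → Euc D) (y₀ : Fin m → Euc d) (μ₀ : ProbabilityMeasure (Euc d)),
      P.IsControl u → ‖y₀‖ ≤ r → (∀ᵐ x ∂(μ₀ : Measure (Euc d)), ‖x‖ ≤ r) →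
      (∃ y μ, P.IsMeanFieldSolution u y₀ μ₀ y μ) ∧
      ∀ y μ, P.IsMeanFieldSolution u y₀ μ₀ y μ →
        ∀ t ∈ Icc 0 P.T, ‖y t‖ ≤ R ∧ ∀ᵐ x ∂(μ t : Measure (Euc d)), ‖x‖ ≤ R := by
  obtain ⟨R, hR⟩ := exists_isLagrangianSolution_truncate hP r
  refine ⟨R, fun u y₀ μ₀ hu hy₀ hμ₀ => ?_⟩
  have hr : 0 ≤ r := (norm_nonneg _).trans hy₀
  obtain ⟨σ, X₀, hσ, hX₀⟩ := exists_law_eq μ₀ hμ₀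
  have : CompactSpace (Metric.closedBall (0 : Euc d) r) :=
    isCompact_iff_compactSpace.1 (isCompact_closedBall _ _)
  have hX₀' : ‖X₀‖ ≤ r := (ContinuousMap.norm_le _ hr).2 hX₀
  have key : ∀ R₁, ∃ z ν, (P.truncate R₁ 0).IsMeanFieldSolution u y₀ μ₀ z ν ∧
      ∀ t ∈ Icc 0 P.T, ‖z t‖ ≤ R ∧ ∀ᵐ x ∂(ν t : Measure (Euc d)), ‖x‖ ≤ R := by
    intro R₁
    obtain ⟨L, hL⟩ := exists_isTame_truncate hP R₁ 0
    obtain ⟨z, X, h, hb⟩ := hR R₁ σ u y₀ X₀ hu hy₀ hX₀'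
    refine ⟨z, fun t => law σ (X t), hσ ▸ h.isMeanFieldSolution hL, fun t ht =>
      ⟨(hb t ht).1, ae_law_norm_le σ (hb t ht).2⟩⟩
  constructor
  · obtain ⟨z, ν, h, hb⟩ := key R
    exact ⟨z, ν, (isMeanFieldSolution_truncate_iff (fun t ht => (hb t ht).1)
      fun t ht => (hb t ht).2).1 h⟩
  · intro y μ h t ht
    obtain ⟨R₁, h₁⟩ := h.exists_norm_le
    obtain ⟨z, ν, h', hb⟩ := key R₁
    obtain ⟨L, hL⟩ := exists_isTame_truncate hP R₁ 0
    have h'' := (isMeanFieldSolution_truncate_iff (R' := 0) (fun t ht => (h₁ t ht).1)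
      fun t ht => (h₁ t ht).2).2 h
    have := h''.stability h' hL hu hu le_rfl (β := 0) (D₀ := 0) (fun _ _ _ => by simp)
      (KRBound.refl μ₀) ht
    simp only [add_zero, zero_mul] at this
    have e : y t = z t := sub_eq_zero.1 (norm_le_zero_iff.1 this.2)
    exact ⟨e ▸ (hb t ht).1, this.1.ae_norm_le (h₁ t ht).2 (hb t ht).2⟩

/-- The stability estimate, with a constant that only depends on the size of the initial data. -/
theorem exists_stability (hP : P.Hypotheses) (r : ℝ) :
    ∃ C, 0 ≤ C ∧ ∀ (u v : ℝ → Euc D) (y₀ : Fin m → Euc d) (μ₀ ν₀ : ProbabilityMeasure (Euc d)),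
      P.IsControl u → P.IsControl v → ‖y₀‖ ≤ r → (∀ᵐ x ∂(μ₀ : Measure (Euc d)), ‖x‖ ≤ r) →
      (∀ᵐ x ∂(ν₀ : Measure (Euc d)), ‖x‖ ≤ r) → ∀ y μ z ν,
      P.IsMeanFieldSolution u y₀ μ₀ y μ → P.IsMeanFieldSolution v y₀ ν₀ z ν → ∀ β D₀ : ℝ, 0 ≤ β →
      (∀ t ∈ Icc 0 P.T, ∀ k, ‖(∫ s in (0 : ℝ)..t, Matrix.toEuclideanLin (P.B k) (u s))
        - ∫ s in (0 : ℝ)..t, Matrix.toEuclideanLin (P.B k) (v s)‖ ≤ β) →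
      KRBound D₀ μ₀ ν₀ → ∀ t ∈ Icc 0 P.T,
        KRBound ((D₀ + β) * C) (μ t) (ν t) ∧ ‖y t - z t‖ ≤ (D₀ + β) * C := by
  obtain ⟨R, hR⟩ := exists_isMeanFieldSolution hP r
  obtain ⟨L, hL⟩ := exists_isTame_truncate hP R 0
  refine ⟨Real.exp (4 * L * P.T), (Real.exp_pos _).le, fun u v y₀ μ₀ ν₀ hu hv hy₀ hμ₀ hν₀ y μ z ν
    h h' β D₀ hβ hB hD t ht => ?_⟩
  have h₁ := (hR u y₀ μ₀ hu hy₀ hμ₀).2 y μ h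
  have h₂ := (hR v y₀ ν₀ hv hy₀ hν₀).2 z ν h'
  exact ((isMeanFieldSolution_truncate_iff (R' := 0) (fun t ht => (h₁ t ht).1)
    fun t ht => (h₁ t ht).2).2 h).stability ((isMeanFieldSolution_truncate_iff (R' := 0)
      (fun t ht => (h₂ t ht).1) fun t ht => (h₂ t ht).2).2 h') hL hu hv hβ hB hD ht

/-! ### The state cost -/

lemma IsTame.abs_stateCost_le {L : ℝ≥0} (hP : P.IsTame L) (y : Fin m → Euc d)
    (μ : ProbabilityMeasure (Euc d)) : |P.stateCost y μ| ≤ L := by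
  have := norm_integral_le_of_norm_le_const (μ := (μ : Measure (Euc d)))
    (f := fun x => P.ℓ (y, x, ∫ z, P.ω z ∂(μ : Measure (Euc d)))) (C := L)
    (Eventually.of_forall fun x => hP.ℓ_le _)
  simpa [stateCost] using this

lemma IsTame.abs_stateCost_sub_le {L : ℝ≥0} (hP : P.IsTame L) {y z : Fin m → Euc d}
    {μ ν : ProbabilityMeasure (Euc d)} {κ : ℝ} (h : KRBound κ μ ν) :
    |P.stateCost y μ - P.stateCost z ν| ≤ (L + L ^ 2) * (κ + ‖y - z‖) := by
  set a := ∫ z, P.ω z ∂(μ : Measure (Euc d))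
  set b := ∫ z, P.ω z ∂(ν : Measure (Euc d))
  have hκ := h.nonneg
  have hab : ‖a - b‖ ≤ L * κ := h.norm_sub_le hP.ω_lip
    (integrable_of_norm_le hP.ω_lip.continuous hP.ω_le)
    (integrable_of_norm_le hP.ω_lip.continuous hP.ω_le)
  have hlip : ∀ (y : Fin m → Euc d) (a : Euc d), LipschitzWith L (fun x => P.ℓ (y, x, a)) :=
    fun y a => LipschitzWith.of_dist_le_mul fun x x' => by
      simpa [Prod.dist_eq] using hP.ℓ_lip.dist_le_mul (y, x, a) (y, x', a)
  have hint : ∀ (y : Fin m → Euc d) (a : Euc d) (μ : ProbabilityMeasure (Euc d)),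
      Integrable (fun x => P.ℓ (y, x, a)) (μ : Measure (Euc d)) := fun y a μ =>
    integrable_of_norm_le (hlip y a).continuous fun x => hP.ℓ_le _
  have e1 : |P.stateCost y μ - ∫ x, P.ℓ (z, x, b) ∂(μ : Measure (Euc d))|
      ≤ L * (‖y - z‖ + L * κ) := by
    rw [stateCost, ← integral_sub (hint _ _ _) (hint _ _ _)]
    have := norm_integral_le_of_norm_le_const (μ := (μ : Measure (Euc d)))
      (f := fun x => P.ℓ (y, x, a) - P.ℓ (z, x, b)) (C := L * (‖y - z‖ + L * κ))
      (Eventually.of_forall fun x => by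
        rw [← dist_eq_norm]
        refine (hP.ℓ_lip.dist_le_mul _ _).trans ?_
        gcongr
        rw [Prod.dist_eq, Prod.dist_eq, dist_self, dist_eq_norm, dist_eq_norm]
        have hLκ : 0 ≤ L * κ := by positivity
        refine max_le (by linarith) (max_le (by positivity) ?_)
        linarith [norm_nonneg (y - z)])
    simpa using this
  have e2 : |∫ x, P.ℓ (z, x, b) ∂(μ : Measure (Euc d)) - P.stateCost z ν| ≤ L * κ :=
    h.norm_sub_le (hlip z b) (hint _ _ _) (hint _ _ _)
  have e3 := abs_sub_le (P.stateCost y μ) (∫ x, P.ℓ (z, x, b) ∂(μ : Measure (Euc d)))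
    (P.stateCost z ν)
  have := mul_nonneg (sq_nonneg (L : ℝ)) (norm_nonneg (y - z))
  nlinarith

/-- Along mean-field solutions with data of size at most `r`, the state cost is continuous in time,
bounded, and Lipschitz in the state. -/
theorem exists_stateCost_bounds (hP : P.Hypotheses) (r : ℝ) :
    ∃ C, 0 ≤ C ∧ ∀ (u v : ℝ → Euc D) (y₀ : Fin m → Euc d) (μ₀ ν₀ : ProbabilityMeasure (Euc d)),
      P.IsControl u → P.IsControl v → ‖y₀‖ ≤ r → (∀ᵐ x ∂(μ₀ : Measure (Euc d)), ‖x‖ ≤ r) →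
      (∀ᵐ x ∂(ν₀ : Measure (Euc d)), ‖x‖ ≤ r) → ∀ y μ z ν,
      P.IsMeanFieldSolution u y₀ μ₀ y μ → P.IsMeanFieldSolution v y₀ ν₀ z ν →
      ContinuousOn (fun t => P.stateCost (y t) (μ t)) (Icc 0 P.T) ∧
      ∀ t ∈ Icc 0 P.T, |P.stateCost (y t) (μ t)| ≤ C ∧
        ∀ κ : ℝ, KRBound κ (μ t) (ν t) →
          |P.stateCost (y t) (μ t) - P.stateCost (z t) (ν t)| ≤ C * (κ + ‖y t - z t‖) := by
  obtain ⟨R, hR⟩ := exists_isMeanFieldSolution hP r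
  obtain ⟨R', hR'⟩ := (isCompact_closedBall (0 : Euc d) R).exists_bound_of_continuousOn
    hP.ω_smooth.continuous.continuousOn
  have hω : ∀ x, ‖x‖ ≤ R → ‖P.ω x‖ ≤ R' := fun x hx => hR' x (by simpa using hx)
  obtain ⟨L, hL⟩ := exists_isTame_truncate hP R R'
  refine ⟨L + L ^ 2, by positivity, fun u v y₀ μ₀ ν₀ hu hv hy₀ hμ₀ hν₀ y μ z ν h h' => ?_⟩
  have h₁ := (hR u y₀ μ₀ hu hy₀ hμ₀).2 y μ h
  have h₂ := (hR v y₀ ν₀ hv hy₀ hν₀).2 z ν h'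
  have e₁ : ∀ t ∈ Icc 0 P.T, P.stateCost (y t) (μ t) = (P.truncate R R').stateCost (y t) (μ t) :=
    fun t ht => (stateCost_truncate (h₁ t ht).1 (h₁ t ht).2 hω).symm
  have e₂ : ∀ t ∈ Icc 0 P.T, P.stateCost (z t) (ν t) = (P.truncate R R').stateCost (z t) (ν t) :=
    fun t ht => (stateCost_truncate (h₂ t ht).1 (h₂ t ht).2 hω).symm
  constructor
  · refine ContinuousOn.congr ?_ e₁
    refine h.continuousOn_of_W1 (C := (L + L ^ 2) * 2) (by positivity) fun q hq s hs κ hκ hyκ => ?_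
    have hKR : KRBound κ (μ q) (μ s) := fun φ hφ => by
      have := norm_integral_sub_le_of_W1_lt hκ hφ
        (integrable_of_ae_norm_le (h₁ q hq).2 hφ.continuous)
        (integrable_of_ae_norm_le (h₁ s hs).2 hφ.continuous)
      rw [NNReal.coe_one, one_mul] at this
      exact (le_abs_self _).trans this
    refine (hL.abs_stateCost_sub_le hKR).trans ?_
    rw [mul_assoc]
    gcongr
    linarith
  · intro t ht
    refine ⟨?_, fun κ hκ => ?_⟩
    · rw [e₁ t ht]
      refine (hL.abs_stateCost_le _ _).trans ?_
      have := sq_nonneg (L : ℝ)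
      linarith
    · rw [e₁ t ht, e₂ t ht]
      exact hL.abs_stateCost_sub_le hκ

end ControlProblem

/-! ### Weak compactness of controls and lower semicontinuity of the control cost -/

/-- A sequence in a closed convex subset of a Hilbert space has its weak limits in the set. -/
lemma mem_of_forall_tendsto_inner {H : Type*} [NormedAddCommGroup H] [InnerProductSpace ℝ H]
    [CompleteSpace H] {C : Set H} (hC : Convex ℝ C) (hC' : IsClosed C) {x : ℕ → H} {x' : H}
    (hx : ∀ᶠ n in atTop, x n ∈ C)
    (h : ∀ w, Tendsto (fun n => inner ℝ w (x n)) atTop (𝓝 (inner ℝ w x'))) : x' ∈ C := by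
  by_contra hcon
  obtain ⟨f, c, hf, hc⟩ := geometric_hahn_banach_closed_point hC hC' hcon
  have e : ∀ a, f a = inner ℝ ((InnerProductSpace.toDual ℝ H).symm f) a := fun a => by
    rw [InnerProductSpace.toDual_symm_apply]
  have := le_of_tendsto (h ((InnerProductSpace.toDual ℝ H).symm f)) (b := c) (by
    filter_upwards [hx] with n hn
    rw [← e]
    exact (hf _ hn).le)
  rw [← e] at this
  linarith

/-- Bounded sequences in a separable Hilbert space have weakly convergent subsequences. -/
lemma exists_subseq_forall_tendsto_inner {H : Type*} [NormedAddCommGroup H]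
    [InnerProductSpace ℝ H] [CompleteSpace H] [TopologicalSpace.SeparableSpace H] {x : ℕ → H}
    {r : ℝ} (hx : ∀ n, ‖x n‖ ≤ r) :
    ∃ (x' : H) (j : ℕ → ℕ), StrictMono j ∧
      ∀ w, Tendsto (fun n => inner ℝ w (x (j n))) atTop (𝓝 (inner ℝ w x')) := by
  obtain ⟨a, -, j, hj, ha⟩ := WeakDual.isSeqCompact_closedBall ℝ H 0 r
    (x := fun n => StrongDual.toWeakDual (InnerProductSpace.toDual ℝ H (x n))) (fun n => by
      simpa using hx n)
  refine ⟨(InnerProductSpace.toDual ℝ H).symm (WeakDual.toStrongDual a), j, hj, fun w => ?_⟩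
  have h1 := ((WeakDual.eval_continuous (𝕜 := ℝ) w).tendsto a).comp ha
  have h2 : inner ℝ w ((InnerProductSpace.toDual ℝ H).symm (WeakDual.toStrongDual a)) = a w := by
    rw [real_inner_comm, InnerProductSpace.toDual_symm_apply]
    rfl
  rw [h2]
  refine h1.congr fun n => ?_
  rw [real_inner_comm]
  rfl

namespace ControlProblem

variable {P : ControlProblem d D m}

instance : IsFiniteMeasure P.timeMeasure := by
  unfold timeMeasure; infer_instance

/-- Weak convergence in `L²([0,T]; ℝᴰ)`. -/
def WeakL2Tendsto (P : ControlProblem d D m) (u : ℕ → ℝ → Euc D) (u' : ℝ → Euc D) : Prop :=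
  ∀ ψ : ℝ → Euc D, MemLp ψ 2 P.timeMeasure →
    Tendsto (fun n => ∫ t, inner ℝ (ψ t) (u n t) ∂P.timeMeasure) atTop
      (𝓝 (∫ t, inner ℝ (ψ t) (u' t) ∂P.timeMeasure))

lemma WeakL2Tendsto.weakL1Tendsto {u : ℕ → ℝ → Euc D} {u' : ℝ → Euc D}
    (h : P.WeakL2Tendsto u u') : P.WeakL1Tendsto u u' :=
  fun ψ hψ => h ψ (hψ.mono_exponent le_top)

lemma Hypotheses.exists_norm_le (hP : P.Hypotheses) : ∃ b, ∀ u ∈ P.U, ‖u‖ ≤ b :=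
  hP.U_compact.exists_bound_of_continuousOn continuousOn_id

lemma isControl_of_ae_mem (hP : P.Hypotheses) {u : ℝ → Euc D}
    (hu : AEStronglyMeasurable u P.timeMeasure) (h : ∀ᵐ t ∂P.timeMeasure, u t ∈ P.U) :
    P.IsControl u := by
  obtain ⟨b, hb⟩ := hP.exists_norm_le
  exact ⟨MemLp.of_bound hu b (by filter_upwards [h] with t ht using hb _ ht), h⟩

lemma IsControl.memLp_two (hP : P.Hypotheses) {u : ℝ → Euc D} (hu : P.IsControl u) :
    MemLp u 2 P.timeMeasure := by
  obtain ⟨b, hb⟩ := hP.exists_norm_le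
  exact MemLp.of_bound hu.1.1 b (by filter_upwards [hu.2] with t ht using hb _ ht)

lemma inner_toLp {ψ u : ℝ → Euc D} (hψ : MemLp ψ 2 P.timeMeasure) (hu : MemLp u 2 P.timeMeasure) :
    inner ℝ (hψ.toLp ψ) (hu.toLp u) = ∫ t, inner ℝ (ψ t) (u t) ∂P.timeMeasure := by
  rw [L2.inner_def]
  refine integral_congr_ae ?_
  filter_upwards [hψ.coeFn_toLp, hu.coeFn_toLp] with t h1 h2
  rw [h1, h2]

lemma WeakL2Tendsto.mem {u : ℕ → ℝ → Euc D} {u' : ℝ → Euc D} (h : P.WeakL2Tendsto u u')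
    (hu : ∀ n, MemLp (u n) 2 P.timeMeasure) (hu' : MemLp u' 2 P.timeMeasure)
    {C : Set (Lp (Euc D) 2 P.timeMeasure)} (hC : Convex ℝ C) (hC' : IsClosed C)
    (hmem : ∀ᶠ n in atTop, (hu n).toLp (u n) ∈ C) : hu'.toLp u' ∈ C := by
  refine mem_of_forall_tendsto_inner hC hC' hmem fun w => ?_
  have := h w (Lp.memLp w)
  rw [← inner_toLp (Lp.memLp w) hu', Lp.toLp_coeFn] at this
  refine this.congr fun n => ?_
  rw [← inner_toLp (Lp.memLp w) (hu n), Lp.toLp_coeFn]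

lemma γ_bddBelow (hP : P.Hypotheses) : ∃ b, ∀ x ∈ P.U, b ≤ P.γ x := by
  obtain ⟨a, -, ha⟩ := hP.γ_lsc.exists_isMinOn hP.U_nonempty hP.U_compact
  exact ⟨P.γ a, ha⟩

lemma aestronglyMeasurable_γ (hP : P.Hypotheses) {u : ℝ → Euc D}
    (hu : AEStronglyMeasurable u P.timeMeasure) (h : ∀ᵐ t ∂P.timeMeasure, u t ∈ P.U) :
    AEStronglyMeasurable (fun t => P.γ (u t)) P.timeMeasure := by
  have hU : MeasurableSet P.U := hP.U_compact.isClosed.measurableSet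
  have hm : Measurable (P.U.indicator P.γ) := by
    refine measurable_of_restrict_of_restrict_compl hU ?_ ?_
    · have e : P.U.domRestrict (P.U.indicator P.γ) = P.U.domRestrict P.γ :=
        funext fun x => indicator_of_mem x.2 _
      rw [e]
      exact (lowerSemicontinuous_restrict_iff.2 hP.γ_lsc).measurable
    · have e : P.Uᶜ.domRestrict (P.U.indicator P.γ) = fun _ => 0 :=
        funext fun x => indicator_of_notMem x.2 _
      rw [e]
      exact measurable_const
  refine (hm.comp_aemeasurable hu.aemeasurable).aestronglyMeasurable.congr ?_
  filter_upwards [h] with t ht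
  simp [indicator_of_mem ht]

/-- Finiteness and boundedness of the control cost in terms of a lower integral, after subtracting
the lower bound `b` of `γ`. -/
lemma integrable_γ_and_integral_le_iff (hP : P.Hypotheses) {b : ℝ} (hb : ∀ x ∈ P.U, b ≤ P.γ x)
    {u : ℝ → Euc D} (hu : AEStronglyMeasurable u P.timeMeasure)
    (h : ∀ᵐ t ∂P.timeMeasure, u t ∈ P.U) {c : ℝ}
    (hc : 0 ≤ c - b * P.timeMeasure.real univ) :
    (Integrable (fun t => P.γ (u t)) P.timeMeasure ∧ ∫ t, P.γ (u t) ∂P.timeMeasure ≤ c) ↔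
      ∫⁻ t, ENNReal.ofReal (P.γ (u t) - b) ∂P.timeMeasure
        ≤ ENNReal.ofReal (c - b * P.timeMeasure.real univ) := by
  have hm := aestronglyMeasurable_γ hP hu h
  have h0 : 0 ≤ᵐ[P.timeMeasure] fun t => P.γ (u t) - b := by
    filter_upwards [h] with t ht using sub_nonneg.2 (hb _ ht)
  have e : Integrable (fun t => P.γ (u t)) P.timeMeasure →
      ∫ t, (P.γ (u t) - b) ∂P.timeMeasure
        = ∫ t, P.γ (u t) ∂P.timeMeasure - b * P.timeMeasure.real univ := fun hi => by
    rw [integral_sub hi (integrable_const b), integral_const, smul_eq_mul, mul_comm b]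
  constructor
  · rintro ⟨hi, hle⟩
    have hi' : Integrable (fun t => P.γ (u t) - b) P.timeMeasure := hi.sub (integrable_const b)
    rw [← ofReal_integral_eq_lintegral_ofReal hi' h0, e hi]
    exact ENNReal.ofReal_le_ofReal (by linarith)
  · intro hle
    have hi : Integrable (fun t => P.γ (u t) - b) P.timeMeasure :=
      (lintegral_ofReal_ne_top_iff_integrable (hm.sub aestronglyMeasurable_const) h0).1
        (hle.trans_lt ENNReal.ofReal_lt_top).ne
    have hi' : Integrable (fun t => P.γ (u t)) P.timeMeasure :=
      (hi.add (integrable_const b)).congr (Eventually.of_forall fun t => sub_add_cancel _ _)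
    refine ⟨hi', ?_⟩
    rw [← ofReal_integral_eq_lintegral_ofReal hi h0, e hi',
      ENNReal.ofReal_le_ofReal_iff hc] at hle
    linarith

/-- The elements of `L²` with values in `U` and with control cost at most `c`. -/
def γSublevel (P : ControlProblem d D m) (c : ℝ) : Set (Lp (Euc D) 2 P.timeMeasure) :=
  {v | (∀ᵐ t ∂P.timeMeasure, v t ∈ P.U) ∧ Integrable (fun t => P.γ (v t)) P.timeMeasure ∧
    ∫ t, P.γ (v t) ∂P.timeMeasure ≤ c}

lemma convex_γSublevel (hP : P.Hypotheses) (c : ℝ) : Convex ℝ (P.γSublevel c) := by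
  rintro v ⟨hv, hvi, hvc⟩ w ⟨hw, hwi, hwc⟩ α β hα hβ hαβ
  have hae : ∀ᵐ t ∂P.timeMeasure, (α • v + β • w : Lp (Euc D) 2 P.timeMeasure) t
      = α • v t + β • w t := by
    filter_upwards [Lp.coeFn_add (α • v) (β • w), Lp.coeFn_smul α v, Lp.coeFn_smul β w]
      with t h1 h2 h3
    rw [h1, Pi.add_apply, h2, h3]
    rfl
  have hmem : ∀ᵐ t ∂P.timeMeasure, (α • v + β • w : Lp (Euc D) 2 P.timeMeasure) t ∈ P.U := by
    filter_upwards [hae, hv, hw] with t h1 h2 h3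
    rw [h1]
    exact hP.U_convex h2 h3 hα hβ hαβ
  have hle : ∀ᵐ t ∂P.timeMeasure, P.γ ((α • v + β • w : Lp (Euc D) 2 P.timeMeasure) t)
      ≤ α * P.γ (v t) + β * P.γ (w t) := by
    filter_upwards [hae, hv, hw] with t h1 h2 h3
    rw [h1]
    exact hP.γ_strictConvex.convexOn.2 h2 h3 hα hβ hαβ
  obtain ⟨b, hb⟩ := γ_bddBelow hP
  have hint := (hvi.const_mul α).add (hwi.const_mul β)
  have hi : Integrable (fun t => P.γ ((α • v + β • w : Lp (Euc D) 2 P.timeMeasure) t))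
      P.timeMeasure :=
    integrable_of_le_of_le
      (aestronglyMeasurable_γ hP (Lp.aestronglyMeasurable _) hmem)
      (by filter_upwards [hmem] with t ht using hb _ ht) hle (integrable_const b) hint
  refine ⟨hmem, hi, (integral_mono_ae hi hint hle).trans ?_⟩
  simp only [Pi.add_apply]
  rw [integral_add (hvi.const_mul α) (hwi.const_mul β), integral_const_mul, integral_const_mul]
  have h1 := mul_le_mul_of_nonneg_left hvc hα
  have h2 := mul_le_mul_of_nonneg_left hwc hβ
  calc _ ≤ α * c + β * c := add_le_add h1 h2
    _ = c := by rw [← add_mul, hαβ, one_mul]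

lemma isClosed_γSublevel (hP : P.Hypotheses) (c : ℝ) : IsClosed (P.γSublevel c) := by
  refine IsSeqClosed.isClosed fun v w hv hw => ?_
  obtain ⟨j, -, hj⟩ := (tendstoInMeasure_of_tendsto_Lp hw).exists_seq_tendsto_ae
  have hvU : ∀ᵐ t ∂P.timeMeasure, ∀ n, v n t ∈ P.U := ae_all_iff.2 fun n => (hv n).1
  have hwU : ∀ᵐ t ∂P.timeMeasure, w t ∈ P.U := by
    filter_upwards [hj, hvU] with t h1 h2
    exact hP.U_compact.isClosed.mem_of_tendsto h1 (Eventually.of_forall fun n => h2 _)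
  obtain ⟨b, hb⟩ := γ_bddBelow hP
  have hc : 0 ≤ c - b * P.timeMeasure.real univ := by
    have h1 : ∫ _, b ∂P.timeMeasure ≤ ∫ t, P.γ (v 0 t) ∂P.timeMeasure :=
      integral_mono_ae (integrable_const b) (hv 0).2.1
        (by filter_upwards [hvU] with t ht using hb _ (ht 0))
    rw [integral_const, smul_eq_mul, mul_comm] at h1
    linarith [(hv 0).2.2]
  refine ⟨hwU, (integrable_γ_and_integral_le_iff hP hb (Lp.aestronglyMeasurable _) hwU hc).2 ?_⟩
  have hn : ∀ n, ∫⁻ t, ENNReal.ofReal (P.γ (v n t) - b) ∂P.timeMeasure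
      ≤ ENNReal.ofReal (c - b * P.timeMeasure.real univ) := fun n =>
    (integrable_γ_and_integral_le_iff hP hb (Lp.aestronglyMeasurable _) (hv n).1 hc).1 (hv n).2
  have hlsc : LowerSemicontinuousOn (fun x => ENNReal.ofReal (P.γ x - b)) P.U :=
    (ENNReal.continuous_ofReal.comp (continuous_id.sub continuous_const)).comp_lowerSemicontinuousOn
      hP.γ_lsc (fun x y hxy => ENNReal.ofReal_le_ofReal (sub_le_sub_right hxy b))
  -- along a subsequence converging almost everywhere, `γ` is lower semicontinuous; Fatou's lemma
  calc ∫⁻ t, ENNReal.ofReal (P.γ (w t) - b) ∂P.timeMeasure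
      ≤ ∫⁻ t, liminf (fun n => ENNReal.ofReal (P.γ (v (j n) t) - b)) atTop ∂P.timeMeasure := by
        refine lintegral_mono_ae ?_
        filter_upwards [hj, hvU, hwU] with t h1 h2 h3
        refine le_of_forall_lt fun q hq => ?_
        obtain ⟨q', hq', hq''⟩ := exists_between hq
        refine hq'.trans_le (le_liminf_of_le (by isBoundedDefault) ?_)
        have h4 : Tendsto (fun n => v (j n) t) atTop (𝓝[P.U] (w t)) :=
          tendsto_nhdsWithin_iff.2 ⟨h1, Eventually.of_forall fun n => h2 _⟩
        filter_upwards [h4.eventually (hlsc (w t) h3 q' hq'')] with n hn using hn.le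
    _ ≤ liminf (fun n => ∫⁻ t, ENNReal.ofReal (P.γ (v (j n) t) - b) ∂P.timeMeasure) atTop := by
        refine lintegral_liminf_le' fun n => ?_
        exact ((aestronglyMeasurable_γ hP (Lp.aestronglyMeasurable _)
          (hv (j n)).1).aemeasurable.sub_const b).ennreal_ofReal
    _ ≤ ENNReal.ofReal (c - b * P.timeMeasure.real univ) :=
        liminf_le_of_le (by isBoundedDefault) fun q hq => by
          obtain ⟨n, hn'⟩ := hq.exists
          exact hn'.trans (hn (j n))

lemma convex_isClosed_values (hP : P.Hypotheses) :
    Convex ℝ {v : Lp (Euc D) 2 P.timeMeasure | ∀ᵐ t ∂P.timeMeasure, v t ∈ P.U} ∧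
      IsClosed {v : Lp (Euc D) 2 P.timeMeasure | ∀ᵐ t ∂P.timeMeasure, v t ∈ P.U} := by
  constructor
  · intro v hv w hw α β hα hβ hαβ
    change ∀ᵐ t ∂P.timeMeasure, _ ∈ P.U
    filter_upwards [Lp.coeFn_add (α • v) (β • w), Lp.coeFn_smul α v, Lp.coeFn_smul β w, hv, hw]
      with t h1 h2 h3 h4 h5
    rw [h1, Pi.add_apply, h2, h3]
    exact hP.U_convex h4 h5 hα hβ hαβ
  · refine IsSeqClosed.isClosed fun v w hv hw => ?_
    obtain ⟨j, -, hj⟩ := (tendstoInMeasure_of_tendsto_Lp hw).exists_seq_tendsto_ae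
    have hvU : ∀ᵐ t ∂P.timeMeasure, ∀ n, v n t ∈ P.U := ae_all_iff.2 fun n => hv n
    change ∀ᵐ t ∂P.timeMeasure, _ ∈ P.U
    filter_upwards [hj, hvU] with t h1 h2
    exact hP.U_compact.isClosed.mem_of_tendsto h1 (Eventually.of_forall fun n => h2 _)

/-- Sequential weak compactness of the set of controls. -/
theorem exists_subseq_weakL2Tendsto (hP : P.Hypotheses) {u : ℕ → ℝ → Euc D}
    (hu : ∀ n, P.IsControl (u n)) :
    ∃ (u' : ℝ → Euc D) (j : ℕ → ℕ), StrictMono j ∧ P.IsControl u' ∧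
      P.WeakL2Tendsto (fun n => u (j n)) u' := by
  have h2 : ∀ n, MemLp (u n) 2 P.timeMeasure := fun n => (hu n).memLp_two hP
  obtain ⟨b, hb⟩ := hP.exists_norm_le
  have : Fact ((2 : ℝ≥0∞) ≠ ∞) := ⟨ENNReal.ofNat_ne_top⟩
  have : SFinite P.timeMeasure := inferInstance
  have : SecondCountableTopology (Lp (Euc D) 2 P.timeMeasure) := Lp.SecondCountableTopology
  obtain ⟨v, j, hj, hv⟩ := exists_subseq_forall_tendsto_inner (x := fun n => (h2 n).toLp (u n))
    (r := P.timeMeasure.real univ ^ (ENNReal.toReal 2)⁻¹ * max b 0) (fun n => by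
      refine Lp.norm_le_of_ae_bound (le_max_right _ _) ?_
      filter_upwards [(h2 n).coeFn_toLp, (hu n).2] with t h1 h3
      rw [h1]
      exact (hb _ h3).trans (le_max_left _ _))
  have hweak : P.WeakL2Tendsto (fun n => u (j n)) v := fun ψ hψ => by
    have := hv (hψ.toLp ψ)
    simp_rw [inner_toLp] at this
    have e := inner_toLp hψ (Lp.memLp v)
    rw [Lp.toLp_coeFn] at e
    rwa [e] at this
  refine ⟨v, j, hj, isControl_of_ae_mem hP (Lp.aestronglyMeasurable v) ?_, hweak⟩
  obtain ⟨hc, hc'⟩ := convex_isClosed_values hP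
  have := hweak.mem (fun n => h2 (j n)) (Lp.memLp v) hc hc' (Eventually.of_forall fun n => by
    change ∀ᵐ t ∂P.timeMeasure, _ ∈ P.U
    filter_upwards [(h2 (j n)).coeFn_toLp, (hu (j n)).2] with t h1 h3
    rw [h1]
    exact h3)
  rwa [Lp.toLp_coeFn] at this

/-- Weak lower semicontinuity of the control cost: its sublevel sets are convex and strongly closed,
hence weakly closed. -/
theorem WeakL2Tendsto.integral_γ_le (hP : P.Hypotheses) {u : ℕ → ℝ → Euc D} {u' : ℝ → Euc D}
    (h : P.WeakL2Tendsto u u') (hu : ∀ n, P.IsControl (u n)) (hu' : P.IsControl u')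
    {c : ℕ → ℝ} {c' : ℝ} (hc : Tendsto c atTop (𝓝 c'))
    (hi : ∀ n, Integrable (fun t => P.γ (u n t)) P.timeMeasure)
    (hle : ∀ n, ∫ t, P.γ (u n t) ∂P.timeMeasure ≤ c n) :
    Integrable (fun t => P.γ (u' t)) P.timeMeasure ∧ ∫ t, P.γ (u' t) ∂P.timeMeasure ≤ c' := by
  have h2 : ∀ n, MemLp (u n) 2 P.timeMeasure := fun n => (hu n).memLp_two hP
  have h2' := hu'.memLp_two hP
  have key : ∀ η > 0, Integrable (fun t => P.γ (u' t)) P.timeMeasure ∧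
      ∫ t, P.γ (u' t) ∂P.timeMeasure ≤ c' + η := by
    intro η hη
    have hmem := h.mem h2 h2' (convex_γSublevel hP (c' + η)) (isClosed_γSublevel hP (c' + η)) (by
      filter_upwards [hc.eventually (gt_mem_nhds (show c' < c' + η by linarith))] with n hn
      have e : (fun t => P.γ ((h2 n).toLp (u n) t)) =ᵐ[P.timeMeasure] fun t => P.γ (u n t) := by
        filter_upwards [(h2 n).coeFn_toLp] with t ht
        rw [ht]
      refine ⟨?_, (integrable_congr e).2 (hi n), ?_⟩
      · filter_upwards [(h2 n).coeFn_toLp, (hu n).2] with t h1 h3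
        rw [h1]
        exact h3
      · rw [integral_congr_ae e]
        exact (hle n).trans hn.le)
    have e : (fun t => P.γ (h2'.toLp u' t)) =ᵐ[P.timeMeasure] fun t => P.γ (u' t) := by
      filter_upwards [h2'.coeFn_toLp] with t ht
      rw [ht]
    exact ⟨(integrable_congr e).1 hmem.2.1, (integral_congr_ae e) ▸ hmem.2.2⟩
  exact ⟨(key 1 one_pos).1, le_of_forall_pos_le_add fun η hη => (key η hη).2⟩

/-- Weak convergence of controls implies uniform convergence of their primitives. -/
theorem WeakL2Tendsto.eventually_norm_integral_sub_le (hP : P.Hypotheses) {u : ℕ → ℝ → Euc D}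
    {u' : ℝ → Euc D} (h : P.WeakL2Tendsto u u') (hu : ∀ n, P.IsControl (u n))
    (hu' : P.IsControl u') {ε : ℝ} (hε : 0 < ε) :
    ∀ᶠ n in atTop, ∀ t ∈ Icc 0 P.T, ∀ k,
      ‖(∫ s in (0 : ℝ)..t, Matrix.toEuclideanLin (P.B k) (u n s))
        - ∫ s in (0 : ℝ)..t, Matrix.toEuclideanLin (P.B k) (u' s)‖ ≤ ε := by
  have h00 : (0 : ℝ) ∈ Icc 0 P.T := ⟨le_rfl, hP.T_pos.le⟩
  have hii : ∀ {v : ℝ → Euc D}, P.IsControl v → ∀ {s t}, s ∈ Icc 0 P.T → t ∈ Icc 0 P.T →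
      IntervalIntegrable v volume s t := fun hv s t hs ht =>
    IntegrableOn.intervalIntegrable
      (IntegrableOn.mono_set (memLp_one_iff_integrable.1 hv.1) (uIcc_subset_Icc hs ht))
  -- pointwise convergence of the primitives
  have hpt : ∀ t ∈ Icc 0 P.T, Tendsto (fun n => ∫ s in (0 : ℝ)..t, u n s) atTop
      (𝓝 (∫ s in (0 : ℝ)..t, u' s)) := by
    intro t ht
    have hsub : Ioc 0 t ⊆ Icc 0 P.T := fun s hs => ⟨hs.1.le, hs.2.trans ht.2⟩
    have key : ∀ (e : Euc D) (v : ℝ → Euc D), P.IsControl v →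
        ∫ s, inner ℝ ((Ioc 0 t).indicator (fun _ => e) s) (v s) ∂P.timeMeasure
          = inner ℝ e (∫ s in (0 : ℝ)..t, v s) := by
      intro e v hv
      rw [intervalIntegral.integral_of_le ht.1, ← integral_inner (hii hv h00 ht).1,
        timeMeasure, ← integral_indicator measurableSet_Icc,
        ← integral_indicator measurableSet_Ioc]
      congr 1 with s
      by_cases hs : s ∈ Ioc 0 t
      · simp [indicator_of_mem hs, indicator_of_mem (hsub hs)]
      · by_cases hs' : s ∈ Icc 0 P.T
        · simp [indicator_of_notMem hs, indicator_of_mem hs']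
        · simp [indicator_of_notMem hs, indicator_of_notMem hs']
    have hin : ∀ e : Euc D, Tendsto (fun n => inner ℝ e (∫ s in (0 : ℝ)..t, u n s)) atTop
        (𝓝 (inner ℝ e (∫ s in (0 : ℝ)..t, u' s))) := by
      intro e
      have := h ((Ioc 0 t).indicator fun _ => e) ((memLp_const e).indicator measurableSet_Ioc)
      rw [key e u' hu'] at this
      exact this.congr fun n => key e (u n) (hu n)
    rw [(EuclideanSpace.equiv (Fin D) ℝ).toHomeomorph.isInducing.tendsto_nhds_iff, tendsto_pi_nhds]
    intro i
    have := hin (EuclideanSpace.single i 1)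
    simpa [EuclideanSpace.inner_single_left] using this
  obtain ⟨b, hb⟩ := hP.exists_norm_le
  -- the primitives are equicontinuous, so that they converge uniformly
  set M : ℝ := ∑ k, ‖(Matrix.toEuclideanLin (P.B k)).toContinuousLinearMap‖ with hM
  have hM0 : 0 ≤ M := Finset.sum_nonneg fun _ _ => norm_nonneg _
  set ε' := ε / (3 * (M + 1)) with hε'
  have hε'0 : 0 < ε' := by positivity
  set b' := max b 0 + 1
  have hb' : 0 < b' := by positivity
  obtain ⟨F, hFs, hFfin, hF⟩ := (isCompact_Icc (a := (0 : ℝ)) (b := P.T)).finite_cover_balls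
    (e := ε' / b') (by positivity)
  have hev : ∀ᶠ n in atTop, ∀ s ∈ F,
      ‖(∫ r in (0 : ℝ)..s, u n r) - ∫ r in (0 : ℝ)..s, u' r‖ < ε' :=
    (eventually_all_finite hFfin).2 fun s hs => by
      filter_upwards [(hpt s (hFs hs)).eventually (Metric.ball_mem_nhds _ hε'0)] with n hn
      rwa [← dist_eq_norm]
  have hlip : ∀ {v : ℝ → Euc D}, P.IsControl v → ∀ {s t}, s ∈ Icc 0 P.T → t ∈ Icc 0 P.T →
      ‖(∫ r in (0 : ℝ)..t, v r) - ∫ r in (0 : ℝ)..s, v r‖ ≤ b' * |t - s| := by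
    intro v hv s t hs ht
    rw [intervalIntegral.integral_interval_sub_left (hii hv h00 ht) (hii hv h00 hs)]
    refine intervalIntegral.norm_integral_le_of_norm_le_const_ae ?_
    have := (ae_restrict_iff' measurableSet_Icc).1 hv.2
    filter_upwards [this] with r hr hrs
    have h1 := hb _ (hr (uIoc_subset_uIcc.trans (uIcc_subset_Icc hs ht) hrs))
    exact h1.trans ((le_max_left b 0).trans (le_add_of_nonneg_right zero_le_one))
  filter_upwards [hev] with n hn t ht k
  obtain ⟨s, hs, hts⟩ := mem_iUnion₂.1 (hF ht)
  have hsI := hFs hs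
  rw [Metric.mem_ball, Real.dist_eq, lt_div_iff₀ hb', mul_comm] at hts
  have e1 := hlip (hu n) hsI ht
  have e2 := hlip hu' ht hsI
  rw [abs_sub_comm] at e2
  have e3 := (hn s hs).le
  have e4 : ‖(∫ r in (0 : ℝ)..t, u n r) - ∫ r in (0 : ℝ)..t, u' r‖ ≤ 3 * ε' := by
    have := norm_add₃_le (a := (∫ r in (0 : ℝ)..t, u n r) - ∫ r in (0 : ℝ)..s, u n r)
      (b := (∫ r in (0 : ℝ)..s, u n r) - ∫ r in (0 : ℝ)..s, u' r)
      (c := (∫ r in (0 : ℝ)..s, u' r) - ∫ r in (0 : ℝ)..t, u' r)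
    rw [sub_add_sub_cancel, sub_add_sub_cancel] at this
    linarith
  have e5 : ∀ v : ℝ → Euc D, P.IsControl v → ∫ s in (0 : ℝ)..t, Matrix.toEuclideanLin (P.B k) (v s)
      = (Matrix.toEuclideanLin (P.B k)).toContinuousLinearMap (∫ s in (0 : ℝ)..t, v s) :=
    fun v hv => ContinuousLinearMap.intervalIntegral_comp_comm
      (Matrix.toEuclideanLin (P.B k)).toContinuousLinearMap (hii hv h00 ht)
  rw [e5 _ (hu n), e5 _ hu', ← map_sub]
  refine (ContinuousLinearMap.le_opNorm _ _).trans ?_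
  have e6 : ‖(Matrix.toEuclideanLin (P.B k)).toContinuousLinearMap‖ ≤ M + 1 :=
    (Finset.single_le_sum (f := fun k => ‖(Matrix.toEuclideanLin (P.B k)).toContinuousLinearMap‖)
      (fun _ _ => norm_nonneg _) (Finset.mem_univ k)).trans (by linarith)
  calc _ ≤ (M + 1) * (3 * ε') := mul_le_mul e6 e4 (norm_nonneg _) (by positivity)
    _ = ε := by rw [hε']; field_simp

end ControlProblem

/-! ### Quantization of the initial distribution -/

lemma integral_empirical {N : ℕ} [NeZero N] (x : Fin N → Euc d) (φ : Euc d → ℝ) :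
    ∫ z, φ z ∂(empirical x : Measure (Euc d)) = (∑ i, φ (x i)) / N := by
  change ∫ z, φ z ∂(empiricalMeasure x) = _
  rw [empiricalMeasure, integral_smul_measure, integral_finsetSum_measure fun i _ =>
    (integrable_dirac (by finiteness))]
  simp [integral_dirac, div_eq_inv_mul]

/-- Sampling a probability measure: by the strong law of large numbers there is a sequence of points
along which the averages of countably many given functions converge to their means. -/
lemma exists_seq_tendsto_average (μ : ProbabilityMeasure (Euc d)) {ι : Type*} [Countable ι]
    {f : ι → Euc d → ℝ} (hf : ∀ k, Measurable (f k))
    (hi : ∀ k, Integrable (f k) (μ : Measure (Euc d))) {S : Set (Euc d)}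
    (hS : ∀ᵐ x ∂(μ : Measure (Euc d)), x ∈ S) :
    ∃ x : ℕ → Euc d, (∀ i, x i ∈ S) ∧ ∀ k, Tendsto (fun n : ℕ =>
      (∑ i ∈ Finset.range n, f k (x i)) / n) atTop (𝓝 (∫ z, f k z ∂(μ : Measure (Euc d)))) := by
  set Q : Measure (ℕ → Euc d) := Measure.infinitePi fun _ => (μ : Measure (Euc d)) with hQ
  have hmp : ∀ i, MeasurePreserving (Function.eval i) Q (μ : Measure (Euc d)) :=
    fun i => measurePreserving_eval_infinitePi _ i
  have h1 : ∀ᵐ x ∂Q, ∀ i, x i ∈ S := ae_all_iff.2 fun i => (hmp i).quasiMeasurePreserving.ae hS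
  have h2 : ∀ᵐ x ∂Q, ∀ k, Tendsto (fun n : ℕ => (∑ i ∈ Finset.range n, f k (x i)) / n) atTop
      (𝓝 (∫ z, f k z ∂(μ : Measure (Euc d)))) := by
    refine ae_all_iff.2 fun k => ?_
    have hint : ∀ i, Integrable (fun x : ℕ → Euc d => f k (x i)) Q := fun i =>
      (hmp i).integrable_comp_of_integrable (hi k)
    have e : ∫ x, f k (x 0) ∂Q = ∫ z, f k z ∂(μ : Measure (Euc d)) := by
      rw [← (hmp 0).map_eq, integral_map (hmp 0).measurable.aemeasurable
        (hf k).aestronglyMeasurable]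
    have hm : ∀ i, Measurable fun x : ℕ → Euc d => f k (x i) := fun i =>
      (hf k).comp (hmp i).measurable
    rw [← e]
    refine ProbabilityTheory.strong_law_ae_real (fun i (x : ℕ → Euc d) => f k (x i)) (hint 0)
      ?_ fun i => ?_
    · intro i j hij
      exact (ProbabilityTheory.iIndepFun_infinitePi (X := fun _ => f k) fun _ => hf k).indepFun hij
    · refine ⟨(hm i).aemeasurable, (hm 0).aemeasurable, ?_⟩
      have : ∀ i, Q.map (fun x : ℕ → Euc d => f k (x i)) = (μ : Measure (Euc d)).map (f k) := by
        intro i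
        rw [← (hmp i).map_eq, Measure.map_map (hf k) (hmp i).measurable]
        rfl
      rw [this, this]
  obtain ⟨x, hx⟩ := (h1.and h2).exists
  exact ⟨x, hx⟩

/-- Bounded sets can be mapped to finitely many points by small measurable displacements. -/
lemma exists_simpleFunc_norm_sub_le (r : ℝ) {ε : ℝ} (hε : 0 < ε) :
    ∃ c : SimpleFunc (Euc d) (Euc d), ∀ x, ‖x‖ ≤ r → ‖c x - x‖ ≤ ε := by
  set e := TopologicalSpace.denseSeq (Euc d)
  obtain ⟨F, hF⟩ := (isCompact_closedBall (0 : Euc d) r).elim_finite_subcover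
    (fun n => Metric.ball (e n) ε) (fun _ => Metric.isOpen_ball) (fun x _ => by
      obtain ⟨n, hn⟩ := (TopologicalSpace.denseRange_denseSeq (Euc d)).exists_dist_lt x hε
      exact mem_iUnion.2 ⟨n, hn⟩)
  refine ⟨SimpleFunc.nearestPt e (F.sup id), fun x hx => ?_⟩
  obtain ⟨n, hn, hxn⟩ := mem_iUnion₂.1 (hF (show x ∈ Metric.closedBall 0 r by simpa using hx))
  have := SimpleFunc.edist_nearestPt_le e x (Finset.le_sup (f := id) hn)
  rw [edist_dist, edist_dist, ENNReal.ofReal_le_ofReal_iff dist_nonneg] at this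
  rw [← dist_eq_norm]
  refine this.trans ?_
  rw [id, dist_comm]
  exact (Metric.mem_ball.1 hxn).le

/-- Measures charging the cells of a fine partition almost equally are close to each other. -/
lemma krBound_of_simpleFunc {r ε : ℝ} {c : SimpleFunc (Euc d) (Euc d)}
    (hc : ∀ x, ‖x‖ ≤ r → ‖c x - x‖ ≤ ε) {μ ν : ProbabilityMeasure (Euc d)}
    (hμ : ∀ᵐ x ∂(μ : Measure (Euc d)), ‖x‖ ≤ r) (hν : ∀ᵐ x ∂(ν : Measure (Euc d)), ‖x‖ ≤ r) :
    KRBound (2 * ε + ∑ p ∈ c.range, ‖p‖ * |(μ : Measure (Euc d)).real (c ⁻¹' {p})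
      - (ν : Measure (Euc d)).real (c ⁻¹' {p})|) μ ν := by
  intro φ hφ
  have h1 : ∀ ρ : ProbabilityMeasure (Euc d), (∀ᵐ x ∂(ρ : Measure (Euc d)), ‖x‖ ≤ r) →
      |∫ x, φ x ∂(ρ : Measure (Euc d))
        - (φ 0 + ∑ p ∈ c.range, (ρ : Measure (Euc d)).real (c ⁻¹' {p}) * (φ p - φ 0))| ≤ ε := by
    intro ρ hρ
    have hic : Integrable (c.map fun p => φ p - φ 0) (ρ : Measure (Euc d)) :=
      SimpleFunc.integrable_of_isFiniteMeasure _
    have e1 : ∑ p ∈ c.range, (ρ : Measure (Euc d)).real (c ⁻¹' {p}) * (φ p - φ 0)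
        = ∫ x, (φ (c x) - φ 0) ∂(ρ : Measure (Euc d)) := by
      have := SimpleFunc.map_integral (μ := (ρ : Measure (Euc d))) c (fun p => φ p - φ 0)
        (SimpleFunc.integrable_of_isFiniteMeasure _) (sub_self _)
      rw [SimpleFunc.integral_eq_integral _ hic] at this
      exact this.symm
    have hic' : Integrable (fun x => φ (c x)) (ρ : Measure (Euc d)) :=
      SimpleFunc.integrable_of_isFiniteMeasure (c.map φ)
    have e2 : φ 0 + ∫ x, (φ (c x) - φ 0) ∂(ρ : Measure (Euc d))
        = ∫ x, φ (c x) ∂(ρ : Measure (Euc d)) := by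
      rw [integral_sub hic' (integrable_const _)]
      simp
    rw [e1, e2, ← integral_sub (integrable_of_ae_norm_le hρ hφ.continuous) hic', ← Real.norm_eq_abs]
    have := norm_integral_le_of_norm_le_const (μ := (ρ : Measure (Euc d))) (C := ε)
      (f := fun x => φ x - φ (c x)) (by
        filter_upwards [hρ] with x hx
        have := hφ.dist_le_mul x (c x)
        rw [Real.dist_eq, NNReal.coe_one, one_mul, dist_comm, dist_eq_norm] at this
        exact this.trans (hc x hx))
    simpa using this
  have h2 := abs_le.1 (h1 μ hμ)
  have h3 := abs_le.1 (h1 ν hν)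
  have h4 : ∑ p ∈ c.range, (μ : Measure (Euc d)).real (c ⁻¹' {p}) * (φ p - φ 0)
      - ∑ p ∈ c.range, (ν : Measure (Euc d)).real (c ⁻¹' {p}) * (φ p - φ 0)
      ≤ ∑ p ∈ c.range, ‖p‖ * |(μ : Measure (Euc d)).real (c ⁻¹' {p})
        - (ν : Measure (Euc d)).real (c ⁻¹' {p})| := by
    rw [← Finset.sum_sub_distrib]
    refine Finset.sum_le_sum fun p _ => ?_
    rw [← sub_mul]
    refine (le_abs_self _).trans ?_
    rw [abs_mul, mul_comm]
    refine mul_le_mul_of_nonneg_right ?_ (abs_nonneg _)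
    have := hφ.dist_le_mul p 0
    rwa [Real.dist_eq, NNReal.coe_one, one_mul, dist_zero_right] at this
  linarith [h2.2, h3.1]

/-- A boundedly supported probability measure is approximated, in the Kantorovich–Rubinstein
distance, by the empirical measures of the initial segments of a sequence in its support. -/
theorem exists_seq_krBound_empirical (μ : ProbabilityMeasure (Euc d)) {r : ℝ}
    (hμ : (μ : Measure (Euc d)).support ⊆ Metric.closedBall 0 r) :
    ∃ x : ℕ → Euc d, (∀ i, x i ∈ (μ : Measure (Euc d)).support) ∧ ∀ ε > 0, ∀ᶠ n : ℕ in atTop,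
      KRBound ε (empirical fun i : Fin (n + 1) => x i) μ := by
  choose c hc using fun k : ℕ =>
    exists_simpleFunc_norm_sub_le (d := d) r (Nat.one_div_pos_of_nat (α := ℝ) (n := k))
  obtain ⟨x, hx, hlim⟩ := exists_seq_tendsto_average μ (ι := Σ k : ℕ, (c k).range)
    (f := fun q => (c q.1 ⁻¹' {(q.2 : Euc d)}).indicator 1)
    (fun q => measurable_one.indicator ((c q.1).measurableSet_preimage _))
    (fun q => (integrable_const (1 : ℝ)).indicator ((c q.1).measurableSet_preimage _))
    (Measure.support_mem_ae (μ := (μ : Measure (Euc d))))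
  refine ⟨x, hx, fun ε hε => ?_⟩
  obtain ⟨k, hk⟩ := exists_nat_one_div_lt (show 0 < ε / 4 by positivity)
  have hcell : ∀ p ∈ (c k).range, Tendsto (fun n : ℕ =>
      (empirical (fun i : Fin (n + 1) => x i) : Measure (Euc d)).real (c k ⁻¹' {p})) atTop
      (𝓝 ((μ : Measure (Euc d)).real (c k ⁻¹' {p}))) := by
    intro p hp
    have hm := (c k).measurableSet_preimage {p}
    have := (hlim ⟨k, p, hp⟩).comp (tendsto_add_atTop_nat 1)
    rw [integral_indicator_one hm] at this
    refine this.congr fun n => ?_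
    rw [← integral_indicator_one hm, integral_empirical, Function.comp_apply, Finset.sum_range]
  have hsum : Tendsto (fun n : ℕ => ∑ p ∈ (c k).range, ‖p‖ *
      |(empirical (fun i : Fin (n + 1) => x i) : Measure (Euc d)).real (c k ⁻¹' {p})
        - (μ : Measure (Euc d)).real (c k ⁻¹' {p})|) atTop (𝓝 0) := by
    have := tendsto_finsetSum (c k).range fun p hp =>
      (((hcell p hp).sub_const ((μ : Measure (Euc d)).real (c k ⁻¹' {p}))).abs).const_mul ‖p‖
    simpa using this
  filter_upwards [hsum.eventually (gt_mem_nhds (show 0 < ε / 2 by positivity))] with n hn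
  refine (krBound_of_simpleFunc (hc k) (ae_empirical_norm_le ?_)
    (ae_norm_le_of_support_subset hμ)).mono (by linarith)
  have h0 : 0 ≤ r := by
    have := hμ (hx 0)
    rw [mem_closedBall_zero_iff] at this
    exact (norm_nonneg _).trans this
  exact (pi_norm_le_iff_of_nonneg h0).2 fun i => by simpa using hμ (hx i)

/-- The Kantorovich–Rubinstein distance controls weak convergence. -/
lemma tendsto_of_kRBound {μ : ℕ → ProbabilityMeasure (Euc d)} {μ' : ProbabilityMeasure (Euc d)}
    (h : ∀ ε > 0, ∀ᶠ n in atTop, KRBound ε (μ n) μ') : Tendsto μ atTop (𝓝 μ') := by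
  refine tendsto_iff_forall_lipschitz_integral_tendsto.2 fun f _ ⟨L, hL⟩ => ?_
  refine Metric.tendsto_atTop'.2 fun ε hε => ?_
  have hpos : (0 : ℝ) < L + 1 := by positivity
  obtain ⟨n₀, hn₀⟩ := eventually_atTop.1 (h (ε / (L + 1)) (by positivity))
  refine ⟨n₀, fun n hn => ?_⟩
  have h1 := (hn₀ n hn.le).sub_le hL
  have h2 := (hn₀ n hn.le).symm.sub_le hL
  have h3 : L * (ε / (L + 1)) < ε := by
    rw [mul_div_assoc', div_lt_iff₀ hpos]
    nlinarith
  rw [Real.dist_eq, abs_lt]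
  constructor <;> linarith

/-! ### The direct method and the mean-field limit -/

namespace ControlProblem

variable {P : ControlProblem d D m}

lemma integrable_stateCost (hP : P.Hypotheses) {r : ℝ} {u : ℝ → Euc D} {y₀ : Fin m → Euc d}
    {μ₀ : ProbabilityMeasure (Euc d)} (hu : P.IsControl u) (hy₀ : ‖y₀‖ ≤ r)
    (hμ₀ : ∀ᵐ x ∂(μ₀ : Measure (Euc d)), ‖x‖ ≤ r) {y : ℝ → Fin m → Euc d}
    {μ : ℝ → ProbabilityMeasure (Euc d)} (h : P.IsMeanFieldSolution u y₀ μ₀ y μ) :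
    Integrable (fun t => P.stateCost (y t) (μ t)) P.timeMeasure := by
  obtain ⟨C, -, hC⟩ := exists_stateCost_bounds hP r
  exact (hC u u y₀ μ₀ μ₀ hu hu hy₀ hμ₀ hμ₀ y μ y μ h h).1.integrableOn_compact isCompact_Icc

/-- Along trajectories, the cost is a finite state cost plus a control cost which may be infinite. -/
lemma cost_le_coe_iff (hP : P.Hypotheses) {r : ℝ} {u : ℝ → Euc D} {y₀ : Fin m → Euc d}
    {μ₀ : ProbabilityMeasure (Euc d)} (hu : P.IsControl u) (hy₀ : ‖y₀‖ ≤ r)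
    (hμ₀ : ∀ᵐ x ∂(μ₀ : Measure (Euc d)), ‖x‖ ≤ r) {y : ℝ → Fin m → Euc d}
    {μ : ℝ → ProbabilityMeasure (Euc d)} (h : P.IsMeanFieldSolution u y₀ μ₀ y μ) (c : ℝ) :
    P.cost u y μ ≤ c ↔ Integrable (fun t => P.γ (u t)) P.timeMeasure ∧
      ∫ t, P.γ (u t) ∂P.timeMeasure ≤ c - ∫ t, P.stateCost (y t) (μ t) ∂P.timeMeasure := by
  have hs := integrable_stateCost hP hu hy₀ hμ₀ h
  have hiff : Integrable (fun t => P.stateCost (y t) (μ t) + P.γ (u t)) P.timeMeasure ↔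
      Integrable (fun t => P.γ (u t)) P.timeMeasure :=
    ⟨fun hi => (hi.sub hs).congr (Eventually.of_forall fun t => by simp), fun hi => hs.add hi⟩
  unfold cost
  split_ifs with hi
  · rw [EReal.coe_le_coe_iff, integral_add hs (hiff.1 hi)]
    exact ⟨fun hle => ⟨hiff.1 hi, by linarith⟩, fun hle => by linarith [hle.2]⟩
  · simp [hiff.not.1 hi]

/-- Trajectories depend continuously on the initial distribution and on the control, the latter in
the weak topology; hence so does the state cost. -/
theorem tendsto_integral_stateCost (hP : P.Hypotheses) {r : ℝ} {u : ℕ → ℝ → Euc D}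
    {u' : ℝ → Euc D} {y₀ : Fin m → Euc d} {ν₀ : ℕ → ProbabilityMeasure (Euc d)}
    {μ₀ : ProbabilityMeasure (Euc d)} (hu : ∀ n, P.IsControl (u n)) (hu' : P.IsControl u')
    (hy₀ : ‖y₀‖ ≤ r) (hν₀ : ∀ n, ∀ᵐ x ∂(ν₀ n : Measure (Euc d)), ‖x‖ ≤ r)
    (hμ₀ : ∀ᵐ x ∂(μ₀ : Measure (Euc d)), ‖x‖ ≤ r) {z : ℕ → ℝ → Fin m → Euc d}
    {ν : ℕ → ℝ → ProbabilityMeasure (Euc d)} {y : ℝ → Fin m → Euc d}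
    {μ : ℝ → ProbabilityMeasure (Euc d)}
    (hν : ∀ n, P.IsMeanFieldSolution (u n) y₀ (ν₀ n) (z n) (ν n))
    (hμ : P.IsMeanFieldSolution u' y₀ μ₀ y μ) (hweak : P.WeakL2Tendsto u u')
    (hinit : ∀ ε > 0, ∀ᶠ n in atTop, KRBound ε (ν₀ n) μ₀) :
    Tendsto (fun n => ∫ t, P.stateCost (z n t) (ν n t) ∂P.timeMeasure) atTop
      (𝓝 (∫ t, P.stateCost (y t) (μ t) ∂P.timeMeasure)) := by
  obtain ⟨C₁, hC₁, hstab⟩ := exists_stability hP r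
  obtain ⟨C₂, hC₂, hcost⟩ := exists_stateCost_bounds hP r
  refine tendsto_integral_of_dominated_convergence (fun _ => C₂)
    (fun n => (integrable_stateCost hP (hu n) hy₀ (hν₀ n) (hν n)).aestronglyMeasurable)
    (integrable_const C₂) (fun n => ?_) ?_
  · filter_upwards [ae_restrict_mem measurableSet_Icc] with t ht
    exact ((hcost _ _ y₀ _ _ (hu n) (hu n) hy₀ (hν₀ n) (hν₀ n) _ _ _ _ (hν n) (hν n)).2 t ht).1
  · filter_upwards [ae_restrict_mem measurableSet_Icc] with t ht
    refine Metric.tendsto_nhds.2 fun ε hε => ?_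
    set η := ε / (4 * (C₁ + 1) * (C₂ + 1)) with hη
    have hη0 : 0 < η := by positivity
    filter_upwards [hinit η hη0, hweak.eventually_norm_integral_sub_le hP hu hu' hη0] with n h1 h2
    obtain ⟨h3, h4⟩ := hstab _ _ y₀ _ _ (hu n) hu' hy₀ (hν₀ n) hμ₀ _ _ _ _ (hν n) hμ η η hη0.le
      h2 h1 t ht
    have h5 := ((hcost _ _ y₀ _ _ (hu n) hu' hy₀ (hν₀ n) hμ₀ _ _ _ _ (hν n) hμ).2 t ht).2 _ h3
    rw [Real.dist_eq]
    calc _ ≤ C₂ * ((η + η) * C₁ + (η + η) * C₁) :=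
          h5.trans (mul_le_mul_of_nonneg_left (by linarith) hC₂)
      _ = 4 * C₁ * C₂ * η := by ring
      _ < 4 * (C₁ + 1) * (C₂ + 1) * η := by
          refine mul_lt_mul_of_pos_right ?_ hη0
          nlinarith
      _ = ε := by rw [hη]; field_simp

/-- Lower semicontinuity of the cost under weak convergence of the controls and convergence of the
initial distributions. -/
theorem cost_le_of_tendsto (hP : P.Hypotheses) {r : ℝ} {u : ℕ → ℝ → Euc D}
    {u' : ℝ → Euc D} {y₀ : Fin m → Euc d} {ν₀ : ℕ → ProbabilityMeasure (Euc d)}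
    {μ₀ : ProbabilityMeasure (Euc d)} (hu : ∀ n, P.IsControl (u n)) (hu' : P.IsControl u')
    (hy₀ : ‖y₀‖ ≤ r) (hν₀ : ∀ n, ∀ᵐ x ∂(ν₀ n : Measure (Euc d)), ‖x‖ ≤ r)
    (hμ₀ : ∀ᵐ x ∂(μ₀ : Measure (Euc d)), ‖x‖ ≤ r) {z : ℕ → ℝ → Fin m → Euc d}
    {ν : ℕ → ℝ → ProbabilityMeasure (Euc d)} {y : ℝ → Fin m → Euc d}
    {μ : ℝ → ProbabilityMeasure (Euc d)}
    (hν : ∀ n, P.IsMeanFieldSolution (u n) y₀ (ν₀ n) (z n) (ν n))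
    (hμ : P.IsMeanFieldSolution u' y₀ μ₀ y μ) (hweak : P.WeakL2Tendsto u u')
    (hinit : ∀ ε > 0, ∀ᶠ n in atTop, KRBound ε (ν₀ n) μ₀) {c : ℕ → ℝ} {c' : ℝ}
    (hc : Tendsto c atTop (𝓝 c')) (hle : ∀ n, P.cost (u n) (z n) (ν n) ≤ c n) :
    P.cost u' y μ ≤ c' := by
  have hlim := hc.sub (tendsto_integral_stateCost hP hu hu' hy₀ hν₀ hμ₀ hν hμ hweak hinit)
  have hle' := fun n => (cost_le_coe_iff hP (hu n) hy₀ (hν₀ n) (hν n) (c n)).1 (hle n)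
  exact (cost_le_coe_iff hP hu' hy₀ hμ₀ hμ c').2 (hweak.integral_γ_le hP hu hu' hlim
    (fun n => (hle' n).1) fun n => (hle' n).2)

/-- Existence of optimal controls of the mean-field problem, by the direct method. -/
theorem exists_isMeanFieldOptimal (hP : P.Hypotheses) {r : ℝ} {y₀ : Fin m → Euc d}
    {μ₀ : ProbabilityMeasure (Euc d)} (hy₀ : ‖y₀‖ ≤ r)
    (hμ₀ : ∀ᵐ x ∂(μ₀ : Measure (Euc d)), ‖x‖ ≤ r) : ∃ u, P.IsMeanFieldOptimal y₀ μ₀ u := by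
  obtain ⟨R, hR⟩ := exists_isMeanFieldSolution hP r
  have hsol : ∀ u, P.IsControl u → ∃ y μ, P.IsMeanFieldSolution u y₀ μ₀ y μ := fun u hu =>
    (hR u y₀ μ₀ hu hy₀ hμ₀).1
  -- the real numbers that bound the cost of some control
  set S : Set ℝ := {c | ∃ u, P.IsControl u ∧ ∃ y μ, P.IsMeanFieldSolution u y₀ μ₀ y μ ∧
    P.cost u y μ ≤ c} with hS
  -- constant controls have finite cost
  have hne : S.Nonempty := by
    obtain ⟨a, ha⟩ := hP.U_nonempty
    have hu : P.IsControl fun _ => a :=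
      isControl_of_ae_mem hP aestronglyMeasurable_const (Eventually.of_forall fun _ => ha)
    obtain ⟨y, μ, h⟩ := hsol _ hu
    exact ⟨_, _, hu, y, μ, h, (cost_le_coe_iff hP hu hy₀ hμ₀ h
      (∫ _, P.γ a ∂P.timeMeasure + ∫ t, P.stateCost (y t) (μ t) ∂P.timeMeasure)).2
        ⟨integrable_const _, by simp⟩⟩
  have hbdd : BddBelow S := by
    obtain ⟨b, hb⟩ := γ_bddBelow hP
    obtain ⟨C, -, hC⟩ := exists_stateCost_bounds hP r
    refine ⟨∫ _, (b - C) ∂P.timeMeasure, ?_⟩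
    rintro c ⟨u, hu, y, μ, h, hle⟩
    obtain ⟨h1, h2⟩ := (cost_le_coe_iff hP hu hy₀ hμ₀ h c).1 hle
    have hs := integrable_stateCost hP hu hy₀ hμ₀ h
    have h3 : ∫ _, (b - C) ∂P.timeMeasure
        ≤ ∫ t, (P.γ (u t) + P.stateCost (y t) (μ t)) ∂P.timeMeasure := by
      refine integral_mono_ae (integrable_const _) (h1.add hs) ?_
      filter_upwards [hu.2, ae_restrict_mem measurableSet_Icc] with t ht ht'
      have h4 := ((hC u u y₀ μ₀ μ₀ hu hu hy₀ hμ₀ hμ₀ y μ y μ h h).2 t ht').1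
      have h5 := hb _ ht
      have h6 := (abs_le.1 h4).1
      change b - C ≤ P.γ (u t) + P.stateCost (y t) (μ t)
      linarith
    rw [integral_add h1 hs] at h3
    linarith
  obtain ⟨c, -, hc, hcS⟩ := exists_seq_tendsto_sInf hne hbdd
  choose u hu z ν hν hle using hcS
  -- a weak limit of a minimizing sequence is a minimizer
  obtain ⟨u', j, hj, hu', hweak⟩ := exists_subseq_weakL2Tendsto hP hu
  refine ⟨u', hu', hsol u' hu', fun y μ h v hv z' ν' h' => ?_⟩
  have hmin : P.cost u' y μ ≤ (sInf S : ℝ) :=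
    cost_le_of_tendsto hP (fun n => hu (j n)) hu' hy₀ (fun _ => hμ₀) hμ₀ (fun n => hν (j n)) h
      hweak (fun ε hε => Eventually.of_forall fun _ => (KRBound.refl μ₀).mono hε.le)
      (hc.comp hj.tendsto_atTop) (fun n => hle (j n))
  refine EReal.le_of_forall_lt_iff_le.1 fun q hq => ?_
  exact hmin.trans (EReal.coe_le_coe_iff.2 (csInf_le hbdd ⟨v, hv, z', ν', h', hq.le⟩))

/-- The particle problem is the mean-field problem for an empirical initial distribution. -/
lemma IsMeanFieldOptimal.isParticleOptimal (hP : P.Hypotheses) {y₀ : Fin m → Euc d} {N : ℕ}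
    [NeZero N] {x₀ : Fin N → Euc d} {u : ℝ → Euc D}
    (h : P.IsMeanFieldOptimal y₀ (empirical x₀) u) : P.IsParticleOptimal y₀ x₀ u :=
  ⟨h.1, exists_isParticleSolution hP h.1 y₀ x₀, fun _ _ hy v hv _ _ hz =>
    h.2.2 _ _ (hy.isMeanFieldSolution hP) v hv _ _ (hz.isMeanFieldSolution hP)⟩

/-- Weak limits of optimal controls are optimal for the limit of the initial distributions: compare
with the trajectories of any fixed competitor, whose costs converge. -/
theorem isMeanFieldOptimal_of_tendsto (hP : P.Hypotheses) {r : ℝ} {u : ℕ → ℝ → Euc D}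
    {u' : ℝ → Euc D} {y₀ : Fin m → Euc d} {ν₀ : ℕ → ProbabilityMeasure (Euc d)}
    {μ₀ : ProbabilityMeasure (Euc d)} (hu' : P.IsControl u')
    (hy₀ : ‖y₀‖ ≤ r) (hν₀ : ∀ n, ∀ᵐ x ∂(ν₀ n : Measure (Euc d)), ‖x‖ ≤ r)
    (hμ₀ : ∀ᵐ x ∂(μ₀ : Measure (Euc d)), ‖x‖ ≤ r)
    (hopt : ∀ n, P.IsMeanFieldOptimal y₀ (ν₀ n) (u n)) (hweak : P.WeakL2Tendsto u u')
    (hinit : ∀ ε > 0, ∀ᶠ n in atTop, KRBound ε (ν₀ n) μ₀) : P.IsMeanFieldOptimal y₀ μ₀ u' := by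
  obtain ⟨R, hR⟩ := exists_isMeanFieldSolution hP r
  refine ⟨hu', (hR u' y₀ μ₀ hu' hy₀ hμ₀).1, fun y μ h v hv z ν h' => ?_⟩
  refine EReal.le_of_forall_lt_iff_le.1 fun q hq => ?_
  obtain ⟨hi, hγ⟩ := (cost_le_coe_iff hP hv hy₀ hμ₀ h' q).1 hq.le
  -- the competitor `v` is also admissible for the problems with initial distributions `ν₀ n`
  choose z' ν' hsol' using fun n => (hR v y₀ (ν₀ n) hv hy₀ (hν₀ n)).1
  choose y' μ' hsol using fun n => (hopt n).2.1
  have hlim := tendsto_integral_stateCost hP (fun _ => hv) hv hy₀ hν₀ hμ₀ hsol' h'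
    (fun _ _ => tendsto_const_nhds) hinit
  refine (cost_le_of_tendsto hP (fun n => (hopt n).1) hu' hy₀ hν₀ hμ₀ hsol h hweak hinit
    (hlim.const_add (∫ t, P.γ (v t) ∂P.timeMeasure)) fun n => ?_).trans
      (EReal.coe_le_coe_iff.2 (by linarith))
  refine ((hopt n).2.2 _ _ (hsol n) v hv _ _ (hsol' n)).trans ?_
  exact (cost_le_coe_iff hP hv hy₀ (hν₀ n) (hsol' n) _).2 ⟨hi, by simp⟩

/-- Optimal controls for empirical measures sampled from `μ₀` accumulate at mean-field optimal
controls. -/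
theorem exists_isMeanFieldOptimalControl (hP : P.Hypotheses) (y₀ : Fin m → Euc d)
    {μ₀ : ProbabilityMeasure (Euc d)} (hμ₀ : IsCompact (μ₀ : Measure (Euc d)).support) :
    ∃ u, P.IsMeanFieldOptimalControl y₀ μ₀ u := by
  obtain ⟨b, hb⟩ := hμ₀.exists_bound_of_continuousOn continuousOn_id
  have hsub : (μ₀ : Measure (Euc d)).support ⊆ Metric.closedBall 0 (max ‖y₀‖ b) := fun x hx => by
    simpa using Or.inr (hb x hx)
  obtain ⟨x, hx, hKR⟩ := exists_seq_krBound_empirical μ₀ hsub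
  have hae := ae_norm_le_of_support_subset hsub
  have hae' : ∀ n : ℕ, ∀ᵐ z ∂(empirical (fun i : Fin (n + 1) => x i) : Measure (Euc d)),
      ‖z‖ ≤ max ‖y₀‖ b := fun n =>
    ae_empirical_norm_le ((pi_norm_le_iff_of_nonneg (le_max_of_le_left (norm_nonneg _))).2
      fun i => mem_closedBall_zero_iff.1 (hsub (hx i)))
  choose uN hopt using fun n : ℕ =>
    exists_isMeanFieldOptimal hP (le_max_left ‖y₀‖ b) (hae' n)
  obtain ⟨u, j, hj, hu, hweak⟩ := exists_subseq_weakL2Tendsto hP fun n => (hopt n).1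
  refine ⟨u, isMeanFieldOptimal_of_tendsto hP hu (le_max_left ‖y₀‖ b) (fun n => hae' (j n)) hae
    (fun n => hopt (j n)) hweak fun ε hε => hj.tendsto_atTop.eventually (hKR ε hε), uN,
    fun n i => x i, fun n i => ?_, tendsto_of_kRBound hKR,
    fun n => (hopt n).isParticleOptimal hP, j, hj, hweak.weakL1Tendsto⟩
  exact ⟨x i, hx i, 0, by simp, add_zero _⟩

end ControlProblem

end MeanFieldControl

theorem corollary2p11 {d D m : ℕ} (P : MeanFieldControl.ControlProblem d D m)
    (hP : P.Hypotheses) (y₀ : Fin m → MeanFieldControl.Euc d)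
    (μ₀ : MeasureTheory.ProbabilityMeasure (MeanFieldControl.Euc d))
    (hμ₀ : IsCompact (μ₀ : MeasureTheory.Measure (MeanFieldControl.Euc d)).support) :
    ∃ u : ℝ → MeanFieldControl.Euc D, P.IsMeanFieldOptimalControl y₀ μ₀ u :=
  MeanFieldControl.ControlProblem.exists_isMeanFieldOptimalControl hP y₀ hμ₀
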